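/- Let $0<\alpha<1$ and $F(q)=\int_0^q(1+\tau^2)^{-\frac{2+\alpha}{2}}\,d\tau$. For $\alpha<\beta<\min\{1,2\alpha+\tfrac12\}$ let $X$ (resp. $Y$) be the space of even, $2\pi$-periodic functions $\mathbb R\to\mathbb R$ of class $C^{1,\beta}$ (resp. $C^{0,\beta-\alpha}$), with the norm of $C^{1,\beta}([0,\pi])$ (resp. $C^{0,\beta-\alpha}([0,\pi])$), and let $X_2$ be the subspace of those $v\in X$ with $\int_0^\pi v(s)\cos(s)\,ds=0$. For $R>0$ put $$\Phi(a,\lambda,\varphi)(s)=\mathrm{PV}\!\int_{\mathbb R}F_1\Big(a,\frac{\varphi(s)-\varphi(s-t)}{|t|}\Big)\frac{dt}{|t|^{1+\alpha}}-\int_{\mathbb R}r\,F_2(t,a,\lambda,r)\Big|_{r=\varphi(s)+\varphi(s-t)}\,dt ,$$ $$F_1(a,q)=\int_0^q\frac{d\tau}{(1+a^2\tau^2)^{\frac{2+\alpha}{2}}},\qquad F_2(t,a,\lambda,r)=\int_0^1\frac{d\tau}{\{t^2+(2\lambda R+ar\tau)^2\}^{\frac{2+\alpha}{2}}},$$ so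 that $$\Phi(0,\lambda,\varphi)(s)=\mathrm{PV}\!\int_{\mathbb R}\frac{\varphi(s)-\varphi(s-t)}{|t|^{2+\alpha}}\,dt-\int_{\mathbb R}\frac{\varphi(s)+\varphi(s-t)}{\{t^2+(2\lambda R)^2\}^{\frac{2+\alpha}{2}}}\,dt ,$$ and let $\overline\Phi(a,\lambda,v)=\Phi(a,\lambda,\cos+v)$ for $v\in X_2$. For every $R>0$, $\lambda>0$ and $\varphi\in X$ the integrals defining $\Phi(0,\lambda,\varphi)$ converge and $\Phi(0,\lambda,\varphi)\in Y$. There is a unique $R>0$ such that $\Phi(0,1,\cos)\equiv0$. Fix this $R$, which depends only on $\alpha$, and put $$P_R(t)=\frac{1}{\{(2R)^2+|t|^2\}^{\frac{2+\alpha}{2}}}\qquad\Big(=\frac1{|t|^{2+\alpha}}F'\Big(\frac{2R}{|t|}\Big)\ \text{for } t\ne0\Big).$$ Then there are $\gamma>0$, real numbers $\lambda_0<0=\lambda_1<\lambda_2<\lambda_3<\cdots$ and $\mu_\infty>0$, depending only on $\alpha$, with $\lambda_k/k^{1+\alpha}\to\mu_\infty$ as $k\to\infty$, such that for every $\beta$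 as above: 1. $D_\lambda\Phi(0,1,\cos)=\gamma\cos$, where the derivative is taken in $Y$. 2. The map $\varphi\mapsto\Phi(0,1,\varphi)$, $X\to Y$, is Fréchet differentiable at $\cos$, and its derivative $L=D_\varphi\Phi(0,1,\cos)$ is, for all $\psi\in X$, $$L\psi=C^{-1}(-\Delta)^{\frac{1+\alpha}{2}}\psi-\Big(\int_{\mathbb R}P_R\Big)\psi-P_R*\psi,$$ all integrals being convergent, where $(-\Delta)^{\sigma}\psi(s)=C_\sigma\,\mathrm{PV}\int_{\mathbb R}(\psi(s)-\psi(s-t))|t|^{-1-2\sigma}\,dt$ and $C=C_{(1+\alpha)/2}>0$, with $C_\sigma=\big(\int_{\mathbb R}(1-\cos t)|t|^{-1-2\sigma}\,dt\big)^{-1}$ the usual constant. 3. $Le_k=\lambda_ke_k$ for $e_k(s)=\cos(ks)$, $k=0,1,2,\dots$ 4. The map $(\lambda,v)\mapsto\overline\Phi(0,\lambda,v)$ is Fréchet differentiable at $(1,0)$, and its derivative $$(D_\lambda\overline\Phi,D_v\overline\Phi)(0,1,0):\mathbb R\times X_2\to Y,\qquad (m,w)\mapsto m\,\gamma\cos+Lw,$$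 is continuous and invertible (with continuous inverse). -/

import Mathlib

namespace NMCBand

open Real Filter Topology MeasureTheory

noncomputable section

/-! ### Hölder seminorms on `[0, π]` -/

/-- The sup norm of `f` on `[0, π]`. -/
def supNorm (f : ℝ → ℝ) : ℝ := ⨆ s : Set.Icc (0 : ℝ) π, |f s|

/-- Pairs `0 ≤ s < s' ≤ π`. -/
def IncPair : Type := {p : ℝ × ℝ // 0 ≤ p.1 ∧ p.1 < p.2 ∧ p.2 ≤ π}

/-- The Hölder seminorm of exponent `r` of `f` on `[0, π]`. -/
def holderSeminorm (r : ℝ) (f : ℝ → ℝ) : ℝ :=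
  ⨆ p : IncPair, |f p.1.1 - f p.1.2| / |p.1.1 - p.1.2| ^ r

/-- `f` satisfies a Hölder condition of exponent `r` on the whole real line. -/
def IsHolder (r : ℝ) (f : ℝ → ℝ) : Prop := ∃ C : ℝ, ∀ x y, |f x - f y| ≤ C * |x - y| ^ r

instance : Nonempty IncPair := ⟨⟨(0, π), le_refl _, Real.pi_pos, le_refl _⟩⟩

instance : Nonempty (Set.Icc (0 : ℝ) π) := ⟨⟨0, le_refl _, Real.pi_pos.le⟩⟩

theorem supNorm_bdd {f : ℝ → ℝ} (hf : Continuous f) :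
    BddAbove (Set.range fun s : Set.Icc (0 : ℝ) π => |f s|) := by
  obtain ⟨C, hC⟩ := (isCompact_Icc (a := (0 : ℝ)) (b := π)).exists_bound_of_continuousOn
    hf.continuousOn
  refine ⟨C, ?_⟩
  rintro _ ⟨s, rfl⟩
  exact hC s s.2

theorem holder_bdd {r : ℝ} {f : ℝ → ℝ} (hf : IsHolder r f) :
    BddAbove (Set.range fun p : IncPair => |f p.1.1 - f p.1.2| / |p.1.1 - p.1.2| ^ r) := by
  obtain ⟨C, hC⟩ := hf
  refine ⟨C, ?_⟩
  rintro _ ⟨p, rfl⟩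
  have hp : 0 < |p.1.1 - p.1.2| := abs_pos.2 (sub_ne_zero.2 p.2.2.1.ne)
  exact (div_le_iff₀ (Real.rpow_pos_of_pos hp r)).2 (hC _ _)

theorem supNorm_nonneg (f : ℝ → ℝ) : 0 ≤ supNorm f := Real.iSup_nonneg fun _ => abs_nonneg _

theorem holderSeminorm_nonneg (r : ℝ) (f : ℝ → ℝ) : 0 ≤ holderSeminorm r f :=
  Real.iSup_nonneg fun _ => div_nonneg (abs_nonneg _) (Real.rpow_nonneg (abs_nonneg _) _)

theorem supNorm_add_le {f g : ℝ → ℝ} (hf : Continuous f) (hg : Continuous g) :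
    supNorm (f + g) ≤ supNorm f + supNorm g :=
  ciSup_le fun s => (abs_add_le _ _).trans
    (add_le_add (le_ciSup (supNorm_bdd hf) s) (le_ciSup (supNorm_bdd hg) s))

theorem holderSeminorm_add_le {r : ℝ} {f g : ℝ → ℝ} (hf : IsHolder r f) (hg : IsHolder r g) :
    holderSeminorm r (f + g) ≤ holderSeminorm r f + holderSeminorm r g := by
  refine ciSup_le fun p => ?_
  refine le_trans ?_ (add_le_add (le_ciSup (holder_bdd hf) p) (le_ciSup (holder_bdd hg) p))
  rw [← add_div]
  refine div_le_div_of_nonneg_right ?_ (Real.rpow_nonneg (abs_nonneg _) _)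
  have : (f + g) p.1.1 - (f + g) p.1.2 = (f p.1.1 - f p.1.2) + (g p.1.1 - g p.1.2) := by
    simp only [Pi.add_apply]; ring
  rw [this]
  exact abs_add_le _ _

theorem supNorm_smul (c : ℝ) (f : ℝ → ℝ) : supNorm (c • f) = |c| * supNorm f := by
  unfold supNorm
  rw [Real.mul_iSup_of_nonneg (abs_nonneg c)]
  simp [abs_mul]

theorem holderSeminorm_smul (r c : ℝ) (f : ℝ → ℝ) :
    holderSeminorm r (c • f) = |c| * holderSeminorm r f := by
  unfold holderSeminorm
  rw [Real.mul_iSup_of_nonneg (abs_nonneg c)]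
  congr 1
  funext p
  rw [← mul_div_assoc, ← abs_mul]
  congr 2
  simp only [Pi.smul_apply, smul_eq_mul]; ring

theorem eq_zero_of_supNorm {f : ℝ → ℝ} (hf : Continuous f)
    (hp : Function.Periodic f (2 * π)) (he : Function.Even f) (h : supNorm f = 0) : f = 0 := by
  have h0 : ∀ x ∈ Set.Icc (0 : ℝ) π, f x = 0 := fun x hx => by
    have := le_ciSup (supNorm_bdd hf) ⟨x, hx⟩
    have h2 : |f x| ≤ supNorm f := this
    rw [h] at h2
    exact abs_eq_zero.1 (le_antisymm h2 (abs_nonneg _))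
  funext x
  obtain ⟨y, hy, hxy⟩ := hp.exists_mem_Ico₀ Real.two_pi_pos x
  rw [hxy, Pi.zero_apply]
  rcases le_total y π with hyp | hyp
  · exact h0 y ⟨hy.1, hyp⟩
  · have h3 : f (2 * π - y) = f y := by
      rw [← he (2 * π - y), neg_sub]
      exact hp.sub_eq y
    rw [← h3]
    exact h0 _ ⟨by linarith [hy.2], by linarith⟩

theorem IsHolder.zero (r : ℝ) : IsHolder r 0 := ⟨0, by simp⟩

theorem IsHolder.add {r : ℝ} {f g : ℝ → ℝ} (hf : IsHolder r f) (hg : IsHolder r g) :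
    IsHolder r (f + g) := by
  obtain ⟨C, hC⟩ := hf
  obtain ⟨D, hD⟩ := hg
  refine ⟨C + D, fun x y => ?_⟩
  have : (f + g) x - (f + g) y = (f x - f y) + (g x - g y) := by
    simp only [Pi.add_apply]; ring
  rw [this, add_mul]
  exact (abs_add_le _ _).trans (add_le_add (hC x y) (hD x y))

theorem IsHolder.smul {r : ℝ} {f : ℝ → ℝ} (c : ℝ) (hf : IsHolder r f) : IsHolder r (c • f) := by
  obtain ⟨C, hC⟩ := hf
  refine ⟨|c| * C, fun x y => ?_⟩
  have : (c • f) x - (c • f) y = c * (f x - f y) := by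
    simp only [Pi.smul_apply, smul_eq_mul]; ring
  rw [this, abs_mul, mul_assoc]
  exact mul_le_mul_of_nonneg_left (hC x y) (abs_nonneg _)

/-! ### The spaces of even `2π`-periodic Hölder functions -/

/-- Even, `2π`-periodic functions of class `C^{0,r}`, as a set of functions. -/
def c0Submodule (r : ℝ) : Submodule ℝ (ℝ → ℝ) where
  carrier := {f | Continuous f ∧ Function.Periodic f (2 * π) ∧ Function.Even f ∧ IsHolder r f}
  zero_mem' := ⟨continuous_zero, fun _ => rfl, fun _ => rfl, IsHolder.zero r⟩
  add_mem' := fun hf hg => ⟨hf.1.add hg.1, hf.2.1.add hg.2.1, hf.2.2.1.add hg.2.2.1,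
    hf.2.2.2.add hg.2.2.2⟩
  smul_mem' := fun c _ hf => ⟨hf.1.const_smul c, hf.2.1.smul c, hf.2.2.1.const_smul c,
    hf.2.2.2.smul c⟩

/-- Even, `2π`-periodic functions of class `C^{1,r}`, as a set of functions. -/
def c1Submodule (r : ℝ) : Submodule ℝ (ℝ → ℝ) where
  carrier := {f | ContDiff ℝ 1 f ∧ Function.Periodic f (2 * π) ∧ Function.Even f ∧
    IsHolder r (deriv f)}
  zero_mem' := by
    refine ⟨contDiff_const, fun _ => rfl, fun _ => rfl, ?_⟩
    rw [deriv_zero]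
    exact IsHolder.zero r
  add_mem' := fun {f g} hf hg => by
    refine ⟨hf.1.add hg.1, hf.2.1.add hg.2.1, hf.2.2.1.add hg.2.2.1, ?_⟩
    have : deriv (f + g) = deriv f + deriv g := by
      funext x
      exact deriv_add (hf.1.differentiable (by norm_num) x) (hg.1.differentiable (by norm_num) x)
    rw [this]
    exact hf.2.2.2.add hg.2.2.2
  smul_mem' := fun c f hf => by
    refine ⟨hf.1.const_smul c, hf.2.1.smul c, hf.2.2.1.const_smul c, ?_⟩
    have : deriv (c • f) = c • deriv f := by
      funext x
      exact deriv_const_smul c (hf.1.differentiable (by norm_num) x)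
    rw [this]
    exact hf.2.2.2.smul c

/-- The elements of a linear space `S` of functions, as a type of its own: it is given a norm
below, and must not inherit the topology of pointwise convergence. -/
@[ext]
structure FunSpace (S : Submodule ℝ (ℝ → ℝ)) where
  /-- the function -/
  val : ℝ → ℝ
  mem : val ∈ S

namespace FunSpace

variable {S : Submodule ℝ (ℝ → ℝ)}

instance : CoeFun (FunSpace S) fun _ => ℝ → ℝ := ⟨FunSpace.val⟩
instance : Zero (FunSpace S) := ⟨⟨0, S.zero_mem⟩⟩
instance : Add (FunSpace S) := ⟨fun f g => ⟨f.val + g.val, S.add_mem f.mem g.mem⟩⟩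
instance : Neg (FunSpace S) := ⟨fun f => ⟨-f.val, S.neg_mem f.mem⟩⟩
instance : Sub (FunSpace S) := ⟨fun f g => ⟨f.val - g.val, S.sub_mem f.mem g.mem⟩⟩
instance : SMul ℕ (FunSpace S) := ⟨fun n f => ⟨n • f.val, nsmul_mem f.mem n⟩⟩
instance : SMul ℤ (FunSpace S) := ⟨fun n f => ⟨n • f.val, zsmul_mem f.mem n⟩⟩
instance : SMul ℝ (FunSpace S) := ⟨fun c f => ⟨c • f.val, S.smul_mem c f.mem⟩⟩

theorem val_injective : Function.Injective (FunSpace.val : FunSpace S → ℝ → ℝ) :=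
  fun _ _ h => FunSpace.ext h

instance : AddCommGroup (FunSpace S) :=
  val_injective.addCommGroup _ rfl (fun _ _ => rfl) (fun _ => rfl) (fun _ _ => rfl)
    (fun _ _ => rfl) (fun _ _ => rfl)

/-- The underlying function, as an additive map. -/
def valHom : FunSpace S →+ (ℝ → ℝ) where
  toFun := FunSpace.val
  map_zero' := rfl
  map_add' _ _ := rfl

instance : Module ℝ (FunSpace S) := val_injective.module ℝ valHom (fun _ _ => rfl)

end FunSpace

/-- The space `C^{0,r}_{p,e}` of even, `2π`-periodic functions of class `C^{0,r}`. -/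
abbrev C0Space (r : ℝ) : Type := FunSpace (c0Submodule r)

/-- The space `C^{1,r}_{p,e}` of even, `2π`-periodic functions of class `C^{1,r}`. -/
abbrev C1Space (r : ℝ) : Type := FunSpace (c1Submodule r)

/-- The `C^{0,r}([0, π])` norm. -/
instance (r : ℝ) : Norm (C0Space r) := ⟨fun f => supNorm f + holderSeminorm r f⟩

/-- The `C^{1,r}([0, π])` norm. -/
instance (r : ℝ) : Norm (C1Space r) :=
  ⟨fun f => supNorm f + supNorm (deriv f) + holderSeminorm r (deriv f)⟩

theorem c0_core (r : ℝ) : NormedSpace.Core ℝ (C0Space r) where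
  norm_nonneg f := add_nonneg (supNorm_nonneg _) (holderSeminorm_nonneg _ _)
  norm_smul c f := by
    change supNorm (c • f.val) + holderSeminorm r (c • f.val)
      = |c| * (supNorm f.val + holderSeminorm r f.val)
    rw [supNorm_smul, holderSeminorm_smul, mul_add]
  norm_triangle f g := by
    change supNorm (f.val + g.val) + holderSeminorm r (f.val + g.val)
      ≤ supNorm f.val + holderSeminorm r f.val + (supNorm g.val + holderSeminorm r g.val)
    have h1 := supNorm_add_le f.mem.1 g.mem.1
    have h2 := holderSeminorm_add_le f.mem.2.2.2 g.mem.2.2.2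
    linarith
  norm_eq_zero_iff f := by
    constructor
    · intro h
      have h' : supNorm f.val + holderSeminorm r f.val = 0 := h
      have h1 := supNorm_nonneg f.val
      have h2 := holderSeminorm_nonneg r f.val
      exact FunSpace.ext (eq_zero_of_supNorm f.mem.1 f.mem.2.1 f.mem.2.2.1 (by linarith))
    · rintro rfl
      change supNorm 0 + holderSeminorm r 0 = 0
      simp [supNorm, holderSeminorm]

theorem c1_deriv_add {r : ℝ} (f g : C1Space r) : deriv (f.val + g.val) = deriv f.val + deriv g.val := by
  funext x
  exact deriv_add (f.mem.1.differentiable (by norm_num) x) (g.mem.1.differentiable (by norm_num) x)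

theorem c1_deriv_smul {r : ℝ} (c : ℝ) (f : C1Space r) : deriv (c • f.val) = c • deriv f.val := by
  funext x
  exact deriv_const_smul c (f.mem.1.differentiable (by norm_num) x)

theorem c1_core (r : ℝ) : NormedSpace.Core ℝ (C1Space r) where
  norm_nonneg f := add_nonneg (add_nonneg (supNorm_nonneg _) (supNorm_nonneg _))
    (holderSeminorm_nonneg _ _)
  norm_smul c f := by
    change supNorm (c • f.val) + supNorm (deriv (c • f.val)) + holderSeminorm r (deriv (c • f.val))
      = |c| * (supNorm f.val + supNorm (deriv f.val) + holderSeminorm r (deriv f.val))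
    rw [c1_deriv_smul, supNorm_smul, supNorm_smul, holderSeminorm_smul, mul_add, mul_add]
  norm_triangle f g := by
    change supNorm (f.val + g.val) + supNorm (deriv (f.val + g.val)) + holderSeminorm r (deriv (f.val + g.val))
      ≤ supNorm f.val + supNorm (deriv f.val) + holderSeminorm r (deriv f.val)
        + (supNorm g.val + supNorm (deriv g.val) + holderSeminorm r (deriv g.val))
    rw [c1_deriv_add]
    have h1 := supNorm_add_le f.mem.1.continuous g.mem.1.continuous
    have h2 := supNorm_add_le (f.mem.1.continuous_deriv le_rfl) (g.mem.1.continuous_deriv le_rfl)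
    have h3 := holderSeminorm_add_le f.mem.2.2.2 g.mem.2.2.2
    linarith
  norm_eq_zero_iff f := by
    constructor
    · intro h
      have h' : supNorm f.val + supNorm (deriv f.val) + holderSeminorm r (deriv f.val) = 0 := h
      have h1 := supNorm_nonneg f.val
      have h2 := supNorm_nonneg (deriv f.val)
      have h3 := holderSeminorm_nonneg r (deriv f.val)
      exact FunSpace.ext (eq_zero_of_supNorm f.mem.1.continuous f.mem.2.1 f.mem.2.2.1 (by linarith))
    · rintro rfl
      change supNorm 0 + supNorm (deriv 0) + holderSeminorm r (deriv 0) = 0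
      rw [deriv_zero]
      simp [supNorm, holderSeminorm]

instance (r : ℝ) : NormedAddCommGroup (C0Space r) := NormedAddCommGroup.ofCore (c0_core r)
instance (r : ℝ) : NormedSpace ℝ (C0Space r) := NormedSpace.ofCore (c0_core r)
instance (r : ℝ) : NormedAddCommGroup (C1Space r) := NormedAddCommGroup.ofCore (c1_core r)
instance (r : ℝ) : NormedSpace ℝ (C1Space r) := NormedSpace.ofCore (c1_core r)

/-- A bounded Lipschitz function is Hölder of every exponent in `[0, 1]`. -/
theorem isHolder_of_bdd_lip {r : ℝ} (hr0 : 0 ≤ r) (hr1 : r ≤ 1) {f : ℝ → ℝ} {B : ℝ}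
    (hB : ∀ x y, |f x - f y| ≤ B) (hL : ∀ x y, |f x - f y| ≤ B * |x - y|) : IsHolder r f := by
  have hB0 : 0 ≤ B := (abs_nonneg _).trans (hB 0 0)
  refine ⟨B, fun x y => ?_⟩
  rcases le_total |x - y| 1 with h | h
  · rcases (abs_nonneg (x - y)).eq_or_lt with h0 | h0
    · have := hL x y
      rw [← h0, mul_zero] at this
      exact this.trans (mul_nonneg hB0 (Real.rpow_nonneg (abs_nonneg _) _))
    · refine (hL x y).trans (mul_le_mul_of_nonneg_left ?_ hB0)
      simpa using Real.rpow_le_rpow_of_exponent_ge h0 h hr1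
  · refine (hB x y).trans (le_mul_of_one_le_right hB0 (Real.one_le_rpow h hr0))

theorem cos_mul_mem_c0 {r : ℝ} (hr : r ∈ Set.Icc (0 : ℝ) 1) (k : ℕ) :
    (fun s : ℝ => Real.cos (k * s)) ∈ c0Submodule r := by
  refine ⟨by fun_prop, fun s => ?_, fun s => by simp, ?_⟩
  · have : (k : ℝ) * (s + 2 * π) = k * s + k * (2 * π) := by ring
    simp only [this, Real.cos_add_nat_mul_two_pi]
  · refine isHolder_of_bdd_lip (B := 2 + k) hr.1 hr.2 (fun x y => ?_) (fun x y => ?_)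
    · have h1 := Real.abs_cos_le_one (k * x)
      have h2 := Real.abs_cos_le_one (k * y)
      have h3 := abs_sub (Real.cos (k * x)) (Real.cos (k * y))
      have h4 : (0 : ℝ) ≤ k := k.cast_nonneg
      linarith
    · have h1 := Real.abs_cos_sub_cos_le (k * x) (k * y)
      rw [← mul_sub, abs_mul, Nat.abs_cast] at h1
      nlinarith [abs_nonneg (x - y)]

theorem cos_mul_mem_c1 {r : ℝ} (hr : r ∈ Set.Icc (0 : ℝ) 1) (k : ℕ) :
    (fun s : ℝ => Real.cos (k * s)) ∈ c1Submodule r := by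
  obtain ⟨-, h1, h2, -⟩ := cos_mul_mem_c0 hr k
  refine ⟨by fun_prop, h1, h2, ?_⟩
  have hd : deriv (fun s : ℝ => Real.cos (k * s)) = (-(k : ℝ)) • fun s : ℝ => Real.sin (k * s) := by
    funext s
    have h := ((hasDerivAt_id s).const_mul (k : ℝ)).cos
    simp only [id, mul_one] at h
    rw [h.deriv]
    simp [mul_comm]
  rw [hd]
  refine IsHolder.smul _ (isHolder_of_bdd_lip (B := 2 + k) hr.1 hr.2 (fun x y => ?_) fun x y => ?_)
  · have h1 := Real.abs_sin_le_one (k * x)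
    have h2 := Real.abs_sin_le_one (k * y)
    have h3 := abs_sub (Real.sin (k * x)) (Real.sin (k * y))
    have h4 : (0 : ℝ) ≤ k := k.cast_nonneg
    linarith
  · have h1 := Real.abs_sin_sub_sin_le (k * x) (k * y)
    rw [← mul_sub, abs_mul, Nat.abs_cast] at h1
    nlinarith [abs_nonneg (x - y)]

/-- `e_k = cos (k ·)` as an element of `C^{1,r}_{p,e}`. -/
def cosC1 {r : ℝ} (hr : r ∈ Set.Icc (0 : ℝ) 1) (k : ℕ) : C1Space r :=
  ⟨fun s => Real.cos (k * s), cos_mul_mem_c1 hr k⟩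

/-- `e_k = cos (k ·)` as an element of `C^{0,r}_{p,e}`. -/
def cosC0 {r : ℝ} (hr : r ∈ Set.Icc (0 : ℝ) 1) (k : ℕ) : C0Space r :=
  ⟨fun s => Real.cos (k * s), cos_mul_mem_c0 hr k⟩

/-- `X₂`: the functions of `C^{1,r}_{p,e}` that are orthogonal to `cos` in `L²(0, π)`. -/
def X2 (r : ℝ) : Submodule ℝ (C1Space r) where
  carrier := {v | ∫ s in (0 : ℝ)..π, v s * Real.cos s = 0}
  zero_mem' := by
    change ∫ s in (0 : ℝ)..π, (0 : ℝ) * Real.cos s = 0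
    simp
  add_mem' := fun {f g} hf hg => by
    change ∫ s in (0 : ℝ)..π, (f.val s + g.val s) * Real.cos s = 0
    have hf' : ∫ s in (0 : ℝ)..π, f.val s * Real.cos s = 0 := hf
    have hg' : ∫ s in (0 : ℝ)..π, g.val s * Real.cos s = 0 := hg
    simp only [add_mul]
    have h := intervalIntegral.integral_add (f := fun s => f.val s * Real.cos s)
      (g := fun s => g.val s * Real.cos s) (μ := volume)
      ((f.mem.1.continuous.mul Real.continuous_cos).intervalIntegrable 0 π)
      ((g.mem.1.continuous.mul Real.continuous_cos).intervalIntegrable 0 π)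
    rw [h, hf', hg', add_zero]
  smul_mem' := fun c f hf => by
    change ∫ s in (0 : ℝ)..π, (c * f.val s) * Real.cos s = 0
    have hf' : ∫ s in (0 : ℝ)..π, f.val s * Real.cos s = 0 := hf
    simp only [mul_assoc]
    rw [intervalIntegral.integral_const_mul, hf', mul_zero]

/-! ### Principal values and the fractional Laplacian -/

/-- The integral of `f` over `ℝ` exists as a principal value at the origin. -/
def PVIntegrable (f : ℝ → ℝ) : Prop :=
  (∀ ε > 0, IntegrableOn f {t | ε ≤ |t|}) ∧
    ∃ I : ℝ, Tendsto (fun ε : ℝ => ∫ t in {t | ε ≤ |t|}, f t) (𝓝[>] 0) (𝓝 I)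

/-- The principal value `lim_{ε ↓ 0} ∫_{|t| ≥ ε} f(t) dt`; meaningful if `PVIntegrable f`. -/
def pvIntegral (f : ℝ → ℝ) : ℝ := limUnder (𝓝[>] 0) fun ε : ℝ => ∫ t in {t | ε ≤ |t|}, f t

/-- The usual constant `C_σ` of the one-dimensional fractional Laplacian, which makes
`(-Δ)^σ` the Fourier multiplier `|ξ|^{2σ}`. -/
def fracLapConst (σ : ℝ) : ℝ := (∫ t : ℝ, (1 - Real.cos t) / |t| ^ (1 + 2 * σ))⁻¹

/-- `(-Δ)^σ w (s) = C_σ PV ∫ (w(s) - w(s - t)) |t|^{-1-2σ} dt`. -/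
def fracLap (σ : ℝ) (w : ℝ → ℝ) (s : ℝ) : ℝ :=
  fracLapConst σ * pvIntegral fun t => (w s - w (s - t)) / |t| ^ (1 + 2 * σ)

/-! ### The nonlinear operator -/

/-- `F(q) = ∫₀^q (1 + τ²)^{-(2+α)/2} dτ`. -/
def F (α q : ℝ) : ℝ := ∫ τ in (0 : ℝ)..q, (1 + τ ^ 2) ^ (-(2 + α) / 2)

/-- `F₁(a, q) = ∫₀^q (1 + a²τ²)^{-(2+α)/2} dτ`, which is `F(aq)/a` if `a ≠ 0`. -/
def F1 (α a q : ℝ) : ℝ := ∫ τ in (0 : ℝ)..q, (1 + a ^ 2 * τ ^ 2) ^ (-(2 + α) / 2)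

/-- `F₂(t, a, λ, r) = ∫₀¹ (t² + (2λR + arτ)²)^{-(2+α)/2} dτ`. -/
def F2 (α R t a lam r : ℝ) : ℝ :=
  ∫ τ in (0 : ℝ)..1, (t ^ 2 + (2 * lam * R + a * r * τ) ^ 2) ^ (-(2 + α) / 2)

/-- The integrand of `Φ₁(a, φ)(s)`. -/
def phi1Integrand (α a : ℝ) (φ : ℝ → ℝ) (s t : ℝ) : ℝ :=
  F1 α a ((φ s - φ (s - t)) / |t|) / |t| ^ (1 + α)

/-- The integrand of `Φ₂(a, λ, φ)(s)`. -/
def phi2Integrand (α R a lam : ℝ) (φ : ℝ → ℝ) (s t : ℝ) : ℝ :=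
  (φ s + φ (s - t)) * F2 α R t a lam (φ s + φ (s - t))

/-- The operator `Φ(a, λ, φ) = Φ₁(a, φ) - Φ₂(a, λ, φ)`, with values in functions. -/
def Phi (α R a lam : ℝ) (φ : ℝ → ℝ) (s : ℝ) : ℝ :=
  pvIntegral (phi1Integrand α a φ s) - ∫ t : ℝ, phi2Integrand α R a lam φ s t

/-- The integrals that define `Φ(a, λ, φ)` all converge. -/
def PhiConverges (α R a lam : ℝ) (φ : ℝ → ℝ) : Prop :=
  ∀ s, PVIntegrable (phi1Integrand α a φ s) ∧ Integrable (phi2Integrand α R a lam φ s)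

open Classical in
/-- `Φ` as a map into `Y = C^{0,β-α}_{p,e}` (with the value `0` where `Φ(a, λ, φ)` is not in `Y`). -/
def PhiY (α β R a lam : ℝ) (φ : C1Space β) : C0Space (β - α) :=
  if h : Phi α R a lam φ ∈ c0Submodule (β - α) then ⟨Phi α R a lam φ, h⟩ else 0

/-- `Φ̄(a, λ, v) = Φ(a, λ, cos + v)` for `v ∈ X₂`. -/
def PhiBar (α R a lam : ℝ) {β : ℝ} (hβ : β ∈ Set.Icc (0 : ℝ) 1) (v : X2 β) : C0Space (β - α) :=
  PhiY α β R a lam (cosC1 hβ 1 + (v : C1Space β))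

/-! ### The linearized operator -/

/-- `P_R(t) = ((2R)² + t²)^{-(2+α)/2}`. -/
def kernelP (α R t : ℝ) : ℝ := ((2 * R) ^ 2 + |t| ^ 2) ^ (-(2 + α) / 2)

/-- `C⁻¹ (-Δ)^{(1+α)/2} ψ - (∫ P_R) ψ - P_R * ψ`, where `C = C_{(1+α)/2}`. -/
def linOp (α R : ℝ) (ψ : ℝ → ℝ) (s : ℝ) : ℝ :=
  (fracLapConst ((1 + α) / 2))⁻¹ * fracLap ((1 + α) / 2) ψ s
    - (∫ t : ℝ, kernelP α R t) * ψ s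
    - convolution (kernelP α R) ψ (ContinuousLinearMap.mul ℝ ℝ) volume s

/-- The integrals that define `linOp α R ψ` all converge, and the constant is a positive number. -/
def LinOpConverges (α R : ℝ) (ψ : ℝ → ℝ) : Prop :=
  0 < fracLapConst ((1 + α) / 2) ∧
  (∀ s, PVIntegrable fun t => (ψ s - ψ (s - t)) / |t| ^ (1 + 2 * ((1 + α) / 2))) ∧
  Integrable (kernelP α R) ∧
  ConvolutionExists (kernelP α R) ψ (ContinuousLinearMap.mul ℝ ℝ) volume

end

end NMCBand

/-!
At `a = 0` the integrand `F₁` is linear in its argument and `F₂` does not depend on `r`, so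
`φ ↦ Φ(0, λ, φ)` is a *linear* operator: the singular integral `symLap (2 + α)` (an unnormalized
fractional Laplacian of order `1 + α`) minus `(∫ P_{λR}) φ + P_{λR} * φ`. Everything then rests on
mapping properties of linear operators and on their action on cosines.

*Boundedness.* Written with symmetric second differences, `symLap p` is an absolutely convergent
integral against `t ^ (-p)` over `(0, ∞)`. Cutting it at height `|s - s'|`
(`integral_mul_rpow_bound`) shows that it loses `p - 1` derivatives on the Hölder scale
(`symLap_holder`). This gives the bounded operator `bandOp : X → Y`, which is `Φ(0, 1, ·)`
(`PhiY_one_eq`), hence also its own derivative.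

*Symbol.* `cos (k s)` is an eigenfunction with eigenvalue `m k ^ (1 + α) - p₀ - p_k`, where
`p_k = ∫ P_R(t) cos (k t) dt` (`bandOp_cos`). Thus `Φ(0, 1, cos) = 0` says that
`m = ∫ (1 + cos t) P_R(t) dt`; the right side decreases strictly from `∞` to `0` in `R`
(`existsUnique_bandCoef_eq`), and its `λ`-derivative gives `γ > 0`. As a superposition of Gaussians
`P_R` has a nonnegative Fourier transform (`kernelCos_nonneg`), so that `0 ≤ p_k ≤ p₀ ≤ m`, which
is enough for the eigenvalues to increase strictly (`bandSymbol_lt_succ`).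

*Invertibility.* No Fredholm theory is needed: the inverse on the complement of `cos` is written
down (`exists_parametrix`). The principal part is inverted by `invLapCLM`, which takes two
primitives and applies `symLap (2 - α)` in between, so that its boundedness `Y → X` is again
`symLap_holder`. The true inverse differs from it by a multiplier `1 - ρ_k` with `ρ_k` absolutely
summable, and such a multiplier is a convolution with a continuous kernel on one period
(`exists_kernel_of_summable`), bounded on every Hölder space. All identities between the operators
are checked on cosine coefficients, which determine an even continuous function
(`eq_zero_of_trigCoef`).
-/

namespace NMCBand

open Real Filter Topology MeasureTheory

noncomputable section

/-! ### From `[0, π]` to the real line -/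

/-- A Hölder bound on `[0, π]` gives one on `ℝ` for functions that are even (`ε = 1`) or odd
(`ε = -1`) and `2π`-periodic: with one point in `[0, π]`, the other lies there too, or in an adjacent
half period, and they are compared through the common end point, or they are at least `π` apart. -/
theorem abs_sub_le_of_Icc {r H ε : ℝ} (hr : 0 ≤ r) {f : ℝ → ℝ}
    (hp : Function.Periodic f (2 * π)) (hε : |ε| = 1) (he : ∀ x, f (-x) = ε * f x)
    (h : ∀ x ∈ Set.Icc (0 : ℝ) π, ∀ y ∈ Set.Icc (0 : ℝ) π, |f x - f y| ≤ H * |x - y| ^ r)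
    (x y : ℝ) : |f x - f y| ≤ 2 * H * |x - y| ^ r := by
  have hπ := Real.pi_pos
  have hH : 0 ≤ H := by
    have h1 := (abs_nonneg _).trans (h 0 ⟨le_rfl, hπ.le⟩ π ⟨hπ.le, le_rfl⟩)
    have h2 : 0 < |(0 : ℝ) - π| ^ r := Real.rpow_pos_of_pos (by simp) r
    exact nonneg_of_mul_nonneg_left h1 h2
  have mono : ∀ a b : ℝ, |a| ≤ |b| → H * |a| ^ r ≤ H * |b| ^ r := fun a b hab =>
    mul_le_mul_of_nonneg_left (Real.rpow_le_rpow (abs_nonneg _) hab hr) hH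
  have heven : ∀ a b : ℝ, |ε * a - ε * b| = |a - b| := fun a b => by
    rw [← mul_sub, abs_mul, hε, one_mul]
  have hrefl : ∀ y, f (2 * π - y) = ε * f y := fun y => by
    rw [← he, ← hp (-y)]; congr 1; ring
  -- It suffices to treat `x ∈ [0, π]`.
  have key : ∀ x ∈ Set.Icc (0 : ℝ) π, ∀ y, |f x - f y| ≤ 2 * H * |x - y| ^ r := by
    intro x hx y
    have step : ∀ z y', z ∈ Set.Icc (0 : ℝ) π → y' ∈ Set.Icc (0 : ℝ) π → f z = ε * f z →
        f y = ε * f y' → |x - z| ≤ |x - y| → |z - y'| ≤ |x - y| →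
        |f x - f y| ≤ 2 * H * |x - y| ^ r := by
      intro z y' hz hy' h1 h2 h3 h4
      have e1 := (h x hx z hz).trans (mono _ _ h3)
      have e2 := (h z hz y' hy').trans (mono _ _ h4)
      have e3 : |f z - f y| ≤ H * |x - y| ^ r := by
        rw [h1, h2, heven]; exact e2
      calc |f x - f y| ≤ |f x - f z| + |f z - f y| := abs_sub_le _ _ _
        _ ≤ _ := by linarith
    have e0 : f 0 = ε * f 0 := by have := he 0; rwa [neg_zero] at this
    have eπ : f π = ε * f π := by
      have := hrefl π; rwa [show 2 * π - π = π by ring] at this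
    have h0 : (0 : ℝ) ∈ Set.Icc (0 : ℝ) π := ⟨le_rfl, hπ.le⟩
    have hπ' : π ∈ Set.Icc (0 : ℝ) π := ⟨hπ.le, le_rfl⟩
    by_cases hy : y ∈ Set.Icc (0 : ℝ) π
    · refine (h x hx y hy).trans ?_
      have : 0 ≤ H * |x - y| ^ r := by positivity
      linarith
    by_cases hy1 : y ∈ Set.Icc π (2 * π)
    · refine step π (2 * π - y) hπ' ⟨by linarith [hy1.2], by linarith [hy1.1]⟩ eπ ?_ ?_ ?_
      · rw [← hrefl, sub_sub_cancel]
      · rw [abs_of_nonpos (by linarith [hx.2]), abs_of_nonpos (by linarith [hx.2, hy1.1])]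
        linarith [hy1.1]
      · rw [abs_of_nonneg (by linarith [hy1.1]), abs_of_nonpos (by linarith [hx.2, hy1.1])]
        linarith [hx.2]
    by_cases hy2 : y ∈ Set.Icc (-π) 0
    · refine step 0 (-y) h0 ⟨by linarith [hy2.2], by linarith [hy2.1]⟩ e0 ?_ ?_ ?_
      · rw [← he, neg_neg]
      · rw [abs_of_nonneg (by linarith [hx.1]), abs_of_nonneg (by linarith [hx.1, hy2.2])]
        linarith [hy2.2]
      · rw [abs_of_nonpos (by linarith [hy2.2]), abs_of_nonneg (by linarith [hx.1, hy2.2])]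
        linarith [hx.1]
    have hfar : π ≤ |x - y| := by
      rcases le_total 0 y with h3 | h3
      · have : 2 * π < y := by
          by_contra hc
          rcases le_total y π with h4 | h4
          · exact hy ⟨h3, h4⟩
          · exact hy1 ⟨h4, by linarith⟩
        rw [abs_of_nonpos (by linarith [hx.2])]; linarith [hx.2]
      · have : y < -π := by
          by_contra hc
          exact hy2 ⟨by linarith, h3⟩
        rw [abs_of_nonneg (by linarith [hx.1])]; linarith [hx.1]
    have hle : ∀ u ∈ Set.Icc (0 : ℝ) π, ∀ w ∈ Set.Icc (0 : ℝ) π, |u - w| ≤ |x - y| :=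
      fun u hu w hw => (abs_le.2 ⟨by linarith [hu.1, hw.2], by linarith [hu.2, hw.1]⟩).trans hfar
    obtain ⟨z, hz, hyz⟩ := hp.exists_mem_Ico₀ Real.two_pi_pos y
    rcases le_total z π with hzp | hzp
    · have hz' : z ∈ Set.Icc (0 : ℝ) π := ⟨hz.1, hzp⟩
      rw [hyz]
      refine ((h x hx z hz').trans (mono _ _ (hle x hx z hz'))).trans ?_
      have : 0 ≤ H * |x - y| ^ r := by positivity
      linarith
    · have hz' : 2 * π - z ∈ Set.Icc (0 : ℝ) π := ⟨by linarith [hz.2], by linarith⟩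
      refine step 0 (2 * π - z) h0 hz' e0 ?_ (hle x hx 0 h0) (hle 0 h0 _ hz')
      rw [hyz, ← hrefl, sub_sub_cancel]
  obtain ⟨n, hn⟩ : ∃ n : ℤ, x - n * (2 * π) ∈ Set.Ico (0 : ℝ) (2 * π) := by
    refine ⟨toIcoDiv Real.two_pi_pos 0 x, ?_⟩
    have := sub_toIcoDiv_zsmul_mem_Ico Real.two_pi_pos 0 x
    simpa using this
  have hper : ∀ z, f (z - n * (2 * π)) = f z := fun z => hp.sub_int_mul_eq n
  rcases le_total (x - n * (2 * π)) π with h1 | h1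
  · have := key (x - n * (2 * π)) ⟨hn.1, h1⟩ (y - n * (2 * π))
    rwa [hper, hper, sub_sub_sub_cancel_right] at this
  · have := key (2 * π - (x - n * (2 * π))) ⟨by linarith [hn.2], by linarith⟩
      (2 * π - (y - n * (2 * π)))
    rw [hrefl, hrefl, hper, hper, heven, sub_sub_sub_cancel_left, sub_sub_sub_cancel_right,
      abs_sub_comm y x] at this
    exact this

theorem abs_le_supNorm {f : ℝ → ℝ} (hf : Continuous f) (hp : Function.Periodic f (2 * π))
    (he : ∀ x, |f (-x)| = |f x|) (x : ℝ) : |f x| ≤ supNorm f := by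
  obtain ⟨y, hy, hxy⟩ := hp.exists_mem_Ico₀ Real.two_pi_pos x
  rw [hxy]
  rcases le_total y π with h | h
  · exact le_ciSup (supNorm_bdd hf) ⟨y, hy.1, h⟩
  · rw [← he y, ← hp (-y)]
    exact le_ciSup (supNorm_bdd hf) ⟨-y + 2 * π, by linarith [hy.2], by linarith⟩

theorem abs_sub_le_holderSeminorm {r : ℝ} (hr : 0 < r) {f : ℝ → ℝ} (hf : IsHolder r f) :
    ∀ x ∈ Set.Icc (0 : ℝ) π, ∀ y ∈ Set.Icc (0 : ℝ) π,
      |f x - f y| ≤ holderSeminorm r f * |x - y| ^ r := by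
  have key : ∀ x ∈ Set.Icc (0 : ℝ) π, ∀ y ∈ Set.Icc (0 : ℝ) π, x < y →
      |f x - f y| ≤ holderSeminorm r f * |x - y| ^ r := fun x hx y hy hxy => by
    have h := le_ciSup (holder_bdd hf) ⟨(x, y), hx.1, hxy, hy.2⟩
    have hp : 0 < |x - y| := abs_pos.2 (sub_ne_zero.2 hxy.ne)
    exact (div_le_iff₀ (Real.rpow_pos_of_pos hp r)).1 h
  intro x hx y hy
  rcases lt_trichotomy x y with h | h | h
  · exact key x hx y hy h
  · subst h; simp [Real.zero_rpow hr.ne']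
  · rw [abs_sub_comm, abs_sub_comm x y]
    exact key y hy x hx h

theorem supNorm_le {f : ℝ → ℝ} {B : ℝ} (h : ∀ x ∈ Set.Icc (0 : ℝ) π, |f x| ≤ B) :
    supNorm f ≤ B := ciSup_le fun s => h s s.2

theorem holderSeminorm_le {r H : ℝ} {f : ℝ → ℝ} (h : ∀ x y, |f x - f y| ≤ H * |x - y| ^ r) :
    holderSeminorm r f ≤ H := ciSup_le fun p => by
  have hp : 0 < |p.1.1 - p.1.2| := abs_pos.2 (sub_ne_zero.2 p.2.2.1.ne)
  exact (div_le_iff₀ (Real.rpow_pos_of_pos hp r)).2 (h _ _)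

theorem IsHolder.continuous {r : ℝ} (hr : 0 < r) {f : ℝ → ℝ} (hf : IsHolder r f) :
    Continuous f := by
  obtain ⟨C, hC⟩ := hf
  refine continuous_iff_continuousAt.2 fun x => ?_
  rw [ContinuousAt, tendsto_iff_dist_tendsto_zero]
  have h : Tendsto (fun y : ℝ => C * |y - x| ^ r) (𝓝 x) (𝓝 0) := by
    have : ContinuousAt (fun y : ℝ => C * |y - x| ^ r) x := by
      have h1 : ContinuousAt (fun y : ℝ => |y - x|) x := by fun_prop
      exact (h1.rpow_const (Or.inr hr.le)).const_mul C
    simpa [ContinuousAt, Real.zero_rpow hr.ne'] using this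
  exact squeeze_zero (fun _ => dist_nonneg) (fun y => hC y x) h

/-! ### Pointwise bounds by the norms -/

namespace C0Space

variable {r : ℝ} (f : C0Space r)

theorem norm_def : ‖f‖ = supNorm f + holderSeminorm r f := rfl

theorem continuous : Continuous f := f.mem.1

theorem periodic : Function.Periodic f (2 * π) := f.mem.2.1

theorem even : Function.Even f := f.mem.2.2.1

theorem abs_le (x : ℝ) : |f x| ≤ ‖f‖ := by
  have h := abs_le_supNorm f.mem.1 f.mem.2.1 (fun x => by rw [f.mem.2.2.1 x]) x
  have := holderSeminorm_nonneg r f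
  rw [norm_def]; linarith

theorem abs_sub_le (hr : 0 < r) (x y : ℝ) : |f x - f y| ≤ 2 * ‖f‖ * |x - y| ^ r := by
  have h := abs_sub_le_of_Icc hr.le f.mem.2.1 (abs_one (α := ℝ))
    (fun x => by rw [f.mem.2.2.1 x, one_mul]) (abs_sub_le_holderSeminorm hr f.mem.2.2.2) x y
  refine h.trans (mul_le_mul_of_nonneg_right ?_ (by positivity))
  have := supNorm_nonneg f
  rw [norm_def]; linarith

theorem norm_le {B H : ℝ} (hB : ∀ x, |f x| ≤ B) (hH : ∀ x y, |f x - f y| ≤ H * |x - y| ^ r) :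
    ‖f‖ ≤ B + H := add_le_add (supNorm_le fun x _ => hB x) (holderSeminorm_le hH)

end C0Space

namespace C1Space

variable {r : ℝ} (f : C1Space r)

theorem norm_def : ‖f‖ = supNorm f + supNorm (deriv f) + holderSeminorm r (deriv f) := rfl

theorem continuous : Continuous f := f.mem.1.continuous

theorem periodic : Function.Periodic f (2 * π) := f.mem.2.1

theorem even : Function.Even f := f.mem.2.2.1

theorem hasDerivAt (x : ℝ) : HasDerivAt f (deriv f x) x :=
  (f.mem.1.differentiable (by norm_num) x).hasDerivAt

theorem continuous_deriv : Continuous (deriv f) := f.mem.1.continuous_deriv le_rfl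

theorem deriv_neg (x : ℝ) : deriv f (-x) = -deriv f x := by
  have h1 : (fun x => f (-x)) = f := funext f.even
  have h2 := deriv_comp_neg f x
  rw [h1] at h2
  linarith

theorem deriv_periodic : Function.Periodic (deriv f) (2 * π) := fun x => by
  have h1 : (fun x => f (x + 2 * π)) = f := funext f.periodic
  have h2 := deriv_comp_add_const f (2 * π) x
  rw [h1] at h2
  exact h2.symm

theorem abs_le (x : ℝ) : |f x| ≤ ‖f‖ := by
  have h := abs_le_supNorm f.continuous f.periodic (fun x => by rw [f.even x]) x
  have h1 := holderSeminorm_nonneg r (deriv f)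
  have h2 := supNorm_nonneg (deriv f)
  rw [norm_def]; linarith

theorem abs_deriv_le (x : ℝ) : |deriv f x| ≤ ‖f‖ := by
  have h := abs_le_supNorm f.continuous_deriv f.deriv_periodic
    (fun x => by rw [f.deriv_neg x, abs_neg]) x
  have h1 := holderSeminorm_nonneg r (deriv f)
  have h2 := supNorm_nonneg f
  rw [norm_def]; linarith

theorem abs_deriv_sub_le (hr : 0 < r) (x y : ℝ) :
    |deriv f x - deriv f y| ≤ 2 * ‖f‖ * |x - y| ^ r := by
  have h := abs_sub_le_of_Icc hr.le f.deriv_periodic (ε := -1) (by simp)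
    (fun x => by rw [f.deriv_neg x, neg_one_mul]) (abs_sub_le_holderSeminorm hr f.mem.2.2.2) x y
  refine h.trans (mul_le_mul_of_nonneg_right ?_ (by positivity))
  have h1 := supNorm_nonneg f
  have h2 := supNorm_nonneg (deriv f)
  rw [norm_def]; linarith

theorem abs_sub_le (x y : ℝ) : |f x - f y| ≤ ‖f‖ * |x - y| := by
  have := convex_univ.norm_image_sub_le_of_norm_hasDerivWithin_le (f := f) (f' := deriv f)
    (C := ‖f‖) (fun x _ => (f.hasDerivAt x).hasDerivWithinAt) (fun x _ => f.abs_deriv_le x)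
    (Set.mem_univ y) (Set.mem_univ x)
  exact this

theorem norm_le {B B' H : ℝ} (hB : ∀ x ∈ Set.Icc (0 : ℝ) π, |f x| ≤ B)
    (hB' : ∀ x, |deriv f x| ≤ B')
    (hH : ∀ x y, |deriv f x - deriv f y| ≤ H * |x - y| ^ r) : ‖f‖ ≤ B + B' + H :=
  add_le_add (add_le_add (supNorm_le hB) (supNorm_le fun x _ => hB' x)) (holderSeminorm_le hH)

end C1Space

/-- A function with bounds `2B` on its oscillation and `B` on its slopes is Hölder with
constant `2B` for every exponent in `[0, 1]`. -/
theorem abs_sub_le_rpow {r B : ℝ} (hr0 : 0 ≤ r) (hr1 : r ≤ 1) {f : ℝ → ℝ}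
    (hB : ∀ x y, |f x - f y| ≤ 2 * B) (hL : ∀ x y, |f x - f y| ≤ B * |x - y|) (x y : ℝ) :
    |f x - f y| ≤ 2 * B * |x - y| ^ r := by
  have hB0 : 0 ≤ 2 * B := (abs_nonneg _).trans (hB 0 0)
  rcases le_total |x - y| 1 with h | h
  · refine (hL x y).trans (mul_le_mul (by linarith) ?_ (abs_nonneg _) hB0)
    rcases (abs_nonneg (x - y)).eq_or_lt with h0 | h0
    · rw [← h0]; positivity
    · simpa using Real.rpow_le_rpow_of_exponent_ge h0 h hr1
  · exact (hB x y).trans (le_mul_of_one_le_right hB0 (Real.one_le_rpow h hr0))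

/-! ### Integrals against a homogeneous singular kernel -/

/-- The basic estimate for singular integrals: a function of size `H t ^ (1 + r)` near `0` and
`K t ^ a` near `∞` is integrated against `t ^ (-p)` by cutting at an arbitrary height `h`. -/
theorem integral_mul_rpow_bound {p r a H K h : ℝ} {d : ℝ → ℝ} (hpr : p < 2 + r) (hap : a < p - 1)
    (hh : 0 < h) (hd : Continuous d) (h1 : ∀ t, 0 < t → |d t| ≤ H * t ^ (1 + r))
    (h2 : ∀ t, 0 < t → |d t| ≤ K * t ^ a) :
    IntegrableOn (fun t => d t * t ^ (-p)) (Set.Ioi 0) ∧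
      |∫ t in Set.Ioi 0, d t * t ^ (-p)| ≤
        H * h ^ (2 + r - p) / (2 + r - p) + K * h ^ (a + 1 - p) / (p - 1 - a) := by
  have hmeas : ∀ s : Set ℝ, s ⊆ Set.Ioi 0 → MeasurableSet s →
      AEStronglyMeasurable (fun t => d t * t ^ (-p)) (volume.restrict s) := by
    intro s hs hsm
    refine ContinuousOn.aestronglyMeasurable ?_ hsm
    exact hd.continuousOn.mul fun t ht =>
      (Real.continuousAt_rpow_const t _ (Or.inl (hs ht).ne')).continuousWithinAt
  have b1 : ∀ t, 0 < t → ‖d t * t ^ (-p)‖ ≤ H * t ^ (1 + r - p) := by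
    intro t ht
    rw [norm_mul, Real.norm_eq_abs, Real.norm_of_nonneg (Real.rpow_nonneg ht.le _)]
    refine (mul_le_mul_of_nonneg_right (h1 t ht) (Real.rpow_nonneg ht.le _)).trans_eq ?_
    rw [mul_assoc, ← Real.rpow_add ht, sub_eq_add_neg]
  have b2 : ∀ t, 0 < t → ‖d t * t ^ (-p)‖ ≤ K * t ^ (a - p) := by
    intro t ht
    rw [norm_mul, Real.norm_eq_abs, Real.norm_of_nonneg (Real.rpow_nonneg ht.le _)]
    refine (mul_le_mul_of_nonneg_right (h2 t ht) (Real.rpow_nonneg ht.le _)).trans_eq ?_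
    rw [mul_assoc, ← Real.rpow_add ht, sub_eq_add_neg]
  have hI1 : IntegrableOn (fun t : ℝ => t ^ (1 + r - p)) (Set.Ioc 0 h) :=
    (intervalIntegrable_iff_integrableOn_Ioc_of_le hh.le).1
      (intervalIntegral.intervalIntegrable_rpow' (by linarith))
  have hI2 : IntegrableOn (fun t : ℝ => t ^ (a - p)) (Set.Ioi h) :=
    integrableOn_Ioi_rpow_of_lt (by linarith) hh
  have i1 : IntegrableOn (fun t => d t * t ^ (-p)) (Set.Ioc 0 h) :=
    Integrable.mono' (hI1.const_mul H) (hmeas _ (fun t ht => ht.1) measurableSet_Ioc)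
      ((ae_restrict_iff' measurableSet_Ioc).2 (ae_of_all _ fun t ht => b1 t ht.1))
  have i2 : IntegrableOn (fun t => d t * t ^ (-p)) (Set.Ioi h) :=
    Integrable.mono' (hI2.const_mul K)
      (hmeas _ (fun t ht => hh.trans ht) measurableSet_Ioi)
      ((ae_restrict_iff' measurableSet_Ioi).2 (ae_of_all _ fun t ht => b2 t (hh.trans ht)))
  have hU : Set.Ioc 0 h ∪ Set.Ioi h = Set.Ioi 0 := Set.Ioc_union_Ioi_eq_Ioi hh.le
  refine ⟨hU ▸ i1.union i2, ?_⟩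
  rw [← hU, setIntegral_union (Set.Ioc_disjoint_Ioi le_rfl) measurableSet_Ioi i1 i2]
  refine (abs_add_le _ _).trans (add_le_add ?_ ?_)
  · have := norm_integral_le_of_norm_le (hI1.const_mul H)
      ((ae_restrict_iff' measurableSet_Ioc).2 (ae_of_all _ fun t ht => b1 t ht.1))
    refine this.trans_eq ?_
    rw [integral_const_mul, ← intervalIntegral.integral_of_le hh.le,
      integral_rpow (Or.inl (by linarith)), Real.zero_rpow (by linarith)]
    rw [show 1 + r - p + 1 = 2 + r - p by ring]; ring
  · have := norm_integral_le_of_norm_le (hI2.const_mul K)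
      ((ae_restrict_iff' measurableSet_Ioi).2 (ae_of_all _ fun t ht => b2 t (hh.trans ht)))
    refine this.trans_eq ?_
    rw [integral_const_mul, integral_Ioi_rpow_of_lt (by linarith) hh]
    rw [show a - p + 1 = -(p - 1 - a) by ring, neg_div_neg_eq,
      show -(p - 1 - a) = a + 1 - p by ring]
    ring

/-- The symmetric second difference of `g` at `s` with step `t`, up to sign. -/
def secondDiff (g : ℝ → ℝ) (s t : ℝ) : ℝ := 2 * g s - g (s - t) - g (s + t)

/-- The one-dimensional fractional Laplacian of order `p - 1`, `1 < p < 3`, without its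
normalizing constant, as an absolutely convergent integral. -/
def symLap (p : ℝ) (g : ℝ → ℝ) (s : ℝ) : ℝ := ∫ t in Set.Ioi 0, secondDiff g s t * t ^ (-p)

theorem symLap_add {p : ℝ} {g₁ g₂ : ℝ → ℝ} {s : ℝ}
    (h₁ : IntegrableOn (fun t => secondDiff g₁ s t * t ^ (-p)) (Set.Ioi 0))
    (h₂ : IntegrableOn (fun t => secondDiff g₂ s t * t ^ (-p)) (Set.Ioi 0)) :
    symLap p (g₁ + g₂) s = symLap p g₁ s + symLap p g₂ s := by
  unfold symLap
  rw [← integral_add h₁ h₂]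
  congr 1; funext t
  simp only [secondDiff, Pi.add_apply]; ring

theorem symLap_smul (p c : ℝ) (g : ℝ → ℝ) (s : ℝ) : symLap p (c • g) s = c * symLap p g s := by
  unfold symLap
  rw [← integral_const_mul]
  congr 1; funext t
  simp only [secondDiff, Pi.smul_apply, smul_eq_mul]; ring

theorem secondDiff_continuous {g : ℝ → ℝ} (hg : Continuous g) (s : ℝ) :
    Continuous (secondDiff g s) := by unfold secondDiff; fun_prop

theorem abs_secondDiff_le {g : ℝ → ℝ} {B : ℝ} (hB : ∀ x, |g x| ≤ B) (s t : ℝ) :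
    |secondDiff g s t| ≤ 4 * B := by
  have h1 := abs_le.1 (hB s)
  have h2 := abs_le.1 (hB (s - t))
  have h3 := abs_le.1 (hB (s + t))
  unfold secondDiff
  exact abs_le.2 ⟨by linarith, by linarith⟩

theorem hasDerivAt_secondDiff {g g' : ℝ → ℝ} (hg : ∀ x, HasDerivAt g (g' x) x) (s t : ℝ) :
    HasDerivAt (secondDiff g s) (g' (s - t) - g' (s + t)) t := by
  have h1 : HasDerivAt (fun t => g (s - t)) (-(g' (s - t))) t := by
    simpa using (hg (s - t)).comp_const_sub s t
  have h2 : HasDerivAt (fun t => g (s + t)) (g' (s + t)) t := (hg (s + t)).comp_const_add s t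
  have := ((hasDerivAt_const t (2 * g s)).sub h1).sub h2
  convert! this using 1
  ring

theorem hasDerivAt_secondDiff_left {g g' : ℝ → ℝ} (hg : ∀ x, HasDerivAt g (g' x) x) (s t : ℝ) :
    HasDerivAt (fun s => secondDiff g s t) (secondDiff g' s t) s := by
  have h1 : HasDerivAt (fun s => g (s - t)) (g' (s - t)) s := (hg (s - t)).comp_sub_const s t
  have h2 : HasDerivAt (fun s => g (s + t)) (g' (s + t)) s := (hg (s + t)).comp_add_const s t
  exact (((hg s).const_mul 2).sub h1).sub h2

theorem abs_secondDiff_le_rpow {r H : ℝ} {f : ℝ → ℝ}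
    (hH : ∀ x y, |f x - f y| ≤ H * |x - y| ^ r) (s : ℝ) {t : ℝ} (ht : 0 < t) :
    |secondDiff f s t| ≤ 2 * H * t ^ r := by
  have h1 := hH s (s - t)
  have h2 := hH s (s + t)
  rw [sub_sub_cancel, abs_of_pos ht] at h1
  rw [sub_add_cancel_left, abs_neg, abs_of_pos ht] at h2
  have : secondDiff f s t = (f s - f (s - t)) + (f s - f (s + t)) := by unfold secondDiff; ring
  rw [this]
  exact (abs_add_le _ _).trans (by linarith)

theorem holder_const_nonneg {r H : ℝ} {f : ℝ → ℝ}
    (hH : ∀ x y, |f x - f y| ≤ H * |x - y| ^ r) : 0 ≤ H := by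
  simpa using (abs_nonneg _).trans (hH 1 0)

theorem abs_secondDiff_le_rpow_add {r H : ℝ} (hr0 : 0 ≤ r) (hr1 : r ≤ 1) {g g' : ℝ → ℝ}
    (hg : ∀ x, HasDerivAt g (g' x) x)
    (hH : ∀ x y, |g' x - g' y| ≤ H * |x - y| ^ r) (s : ℝ) {t : ℝ} (ht : 0 < t) :
    |secondDiff g s t| ≤ 2 * H * t ^ (1 + r) := by
  have hH0 := holder_const_nonneg hH
  have := (convex_Icc 0 t).norm_image_sub_le_of_norm_hasDerivWithin_le (f := secondDiff g s)
    (f' := fun t => g' (s - t) - g' (s + t)) (C := 2 * H * t ^ r)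
    (fun x _ => (hasDerivAt_secondDiff hg s x).hasDerivWithinAt) (fun x hx => ?_)
    (Set.left_mem_Icc.2 ht.le) (Set.right_mem_Icc.2 ht.le)
  · rw [show secondDiff g s 0 = 0 by unfold secondDiff; simp; ring, sub_zero, sub_zero,
      Real.norm_of_nonneg ht.le, Real.norm_eq_abs] at this
    refine this.trans_eq ?_
    rw [Real.rpow_add ht, Real.rpow_one]; ring
  · rw [Real.norm_eq_abs]
    refine (hH _ _).trans ?_
    have e : |s - x - (s + x)| = 2 * x := by
      rw [show s - x - (s + x) = -(2 * x) by ring, abs_neg, abs_of_nonneg (by linarith [hx.1])]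
    rw [e, Real.mul_rpow (by norm_num) hx.1]
    have h1 : (2 : ℝ) ^ r ≤ 2 := by
      simpa using Real.rpow_le_rpow_of_exponent_le (by norm_num : (1 : ℝ) ≤ 2) hr1
    have h2 : x ^ r ≤ t ^ r := Real.rpow_le_rpow hx.1 hx.2 hr0
    have h3 : (2 : ℝ) ^ r * x ^ r ≤ 2 * t ^ r :=
      mul_le_mul h1 h2 (Real.rpow_nonneg hx.1 _) (by norm_num)
    calc H * ((2 : ℝ) ^ r * x ^ r) ≤ H * (2 * t ^ r) := mul_le_mul_of_nonneg_left h3 hH0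
      _ = _ := by ring

/-- Moving the base point, with all of the gain taken from the base point. -/
theorem abs_secondDiff_sub_le {r H : ℝ} {g g' : ℝ → ℝ}
    (hg : ∀ x, HasDerivAt g (g' x) x)
    (hH : ∀ x y, |g' x - g' y| ≤ H * |x - y| ^ r) (s s' : ℝ) {t : ℝ} (ht : 0 < t) :
    |secondDiff g s t - secondDiff g s' t| ≤ 2 * H * |s - s'| ^ r * t := by
  have := (convex_Icc 0 t).norm_image_sub_le_of_norm_hasDerivWithin_le
    (f := fun t => secondDiff g s t - secondDiff g s' t)
    (f' := fun t => (g' (s - t) - g' (s + t)) - (g' (s' - t) - g' (s' + t)))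
    (C := 2 * H * |s - s'| ^ r)
    (fun x _ => ((hasDerivAt_secondDiff hg s x).sub
      (hasDerivAt_secondDiff hg s' x)).hasDerivWithinAt) (fun x hx => ?_)
    (Set.left_mem_Icc.2 ht.le) (Set.right_mem_Icc.2 ht.le)
  · have e : ∀ s, secondDiff g s 0 = 0 := fun s => by unfold secondDiff; simp; ring
    simp only [e, sub_zero, Real.norm_of_nonneg ht.le, Real.norm_eq_abs] at this
    exact this
  · have h1 := hH (s - x) (s' - x)
    have h2 := hH (s + x) (s' + x)
    rw [sub_sub_sub_cancel_right] at h1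
    rw [add_sub_add_right_eq_sub] at h2
    rw [Real.norm_eq_abs, show g' (s - x) - g' (s + x) - (g' (s' - x) - g' (s' + x))
      = (g' (s - x) - g' (s' - x)) - (g' (s + x) - g' (s' + x)) by ring]
    exact (abs_sub _ _).trans (by linarith)

/-- Moving the base point, with the gain of `abs_secondDiff_le_rpow` taken from the step. -/
theorem abs_secondDiff_sub_le' {r H : ℝ} {g g' : ℝ → ℝ}
    (hg : ∀ x, HasDerivAt g (g' x) x)
    (hH : ∀ x y, |g' x - g' y| ≤ H * |x - y| ^ r) (s s' : ℝ) {t : ℝ} (ht : 0 < t) :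
    |secondDiff g s t - secondDiff g s' t| ≤ 2 * H * |s - s'| * t ^ r := by
  have := convex_univ.norm_image_sub_le_of_norm_hasDerivWithin_le
    (f := fun s => secondDiff g s t) (f' := fun s => secondDiff g' s t) (C := 2 * H * t ^ r)
    (fun x _ => (hasDerivAt_secondDiff_left hg x t).hasDerivWithinAt)
    (fun x _ => abs_secondDiff_le_rpow hH x ht) (Set.mem_univ s') (Set.mem_univ s)
  refine this.trans_eq ?_
  rw [Real.norm_eq_abs]; ring

section symLap

variable {p r a B H : ℝ} {g g' : ℝ → ℝ}

theorem symLap_integrable_bound (hp1 : 1 < p) (hpr : p < 2 + r) (hr0 : 0 ≤ r) (hr1 : r ≤ 1)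
    (hg : ∀ x, HasDerivAt g (g' x) x) (hB : ∀ x, |g x| ≤ B)
    (hH : ∀ x y, |g' x - g' y| ≤ H * |x - y| ^ r) (s : ℝ) :
    IntegrableOn (fun t => secondDiff g s t * t ^ (-p)) (Set.Ioi 0) ∧
      |symLap p g s| ≤ 2 * H / (2 + r - p) + 4 * B / (p - 1) := by
  have hc : Continuous g := continuous_iff_continuousAt.2 fun x => (hg x).continuousAt
  have := integral_mul_rpow_bound (p := p) (r := r) (a := 0) (H := 2 * H) (K := 4 * B) (h := 1)
    hpr (by linarith) one_pos (secondDiff_continuous hc s)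
    (fun t ht => abs_secondDiff_le_rpow_add hr0 hr1 hg hH s ht)
    (fun t ht => by simpa using abs_secondDiff_le hB s t)
  simpa [symLap] using this

/-- `symLap p` loses `p - 1` derivatives on the Hölder scale. The hypothesis `hK` is provided by
`abs_secondDiff_sub_le` (`a = 1`) for `p > 2` and by `abs_secondDiff_sub_le'` (`a = r`) for
`p < 2`. -/
theorem symLap_holder (hp1 : 1 < p) (hpr : p < 2 + r) (hr0 : 0 ≤ r) (hr1 : r ≤ 1)
    (hap : a < p - 1) (hg : ∀ x, HasDerivAt g (g' x) x) (hB : ∀ x, |g x| ≤ B)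
    (hH : ∀ x y, |g' x - g' y| ≤ H * |x - y| ^ r)
    (hK : ∀ s s' t, 0 < t → |secondDiff g s t - secondDiff g s' t|
      ≤ 2 * H * |s - s'| ^ (1 + r - a) * t ^ a) (s s' : ℝ) :
    |symLap p g s - symLap p g s'|
      ≤ (4 * H / (2 + r - p) + 2 * H / (p - 1 - a)) * |s - s'| ^ (2 + r - p) := by
  have hc : Continuous g := continuous_iff_continuousAt.2 fun x => (hg x).continuousAt
  have i1 := (symLap_integrable_bound hp1 hpr hr0 hr1 hg hB hH s).1
  have i2 := (symLap_integrable_bound hp1 hpr hr0 hr1 hg hB hH s').1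
  rcases eq_or_ne s s' with rfl | hne
  · rw [sub_self, abs_zero, sub_self, abs_zero, Real.zero_rpow (by linarith), mul_zero]
  have hh : 0 < |s - s'| := abs_pos.2 (sub_ne_zero.2 hne)
  have := (integral_mul_rpow_bound (p := p) (r := r) (a := a) (H := 4 * H)
    (K := 2 * H * |s - s'| ^ (1 + r - a)) (h := |s - s'|)
    (d := fun t => secondDiff g s t - secondDiff g s' t) hpr hap hh
    ((secondDiff_continuous hc s).sub (secondDiff_continuous hc s')) (fun t ht => ?_)
    (fun t ht => hK s s' t ht)).2
  · have e : symLap p g s - symLap p g s'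
        = ∫ t in Set.Ioi 0, (secondDiff g s t - secondDiff g s' t) * t ^ (-p) := by
      simp only [sub_mul]
      exact (integral_sub i1 i2).symm
    rw [e]
    refine this.trans_eq ?_
    have : |s - s'| ^ (2 + r - p) = |s - s'| ^ (1 + r - a) * |s - s'| ^ (a + 1 - p) := by
      rw [← Real.rpow_add hh]; congr 1; ring
    rw [mul_assoc (2 * H), ← this]; ring
  · have h1 := abs_secondDiff_le_rpow_add hr0 hr1 hg hH s ht
    have h2 := abs_secondDiff_le_rpow_add hr0 hr1 hg hH s' ht
    exact (abs_sub _ _).trans (by linarith)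

theorem symLap_periodic {T : ℝ} (hg : Function.Periodic g T) : Function.Periodic (symLap p g) T := by
  intro s
  have : secondDiff g (s + T) = secondDiff g s := by
    funext t
    unfold secondDiff
    rw [hg, show s + T - t = s - t + T by ring, hg, show s + T + t = s + t + T by ring, hg]
  simp only [symLap, this]

theorem symLap_neg_arg {ε : ℝ} (hg : ∀ x, g (-x) = ε * g x) (s : ℝ) :
    symLap p g (-s) = ε * symLap p g s := by
  have : ∀ t, secondDiff g (-s) t = ε * secondDiff g s t := by
    intro t
    unfold secondDiff
    rw [show -s - t = -(s + t) by ring, show -s + t = -(s - t) by ring, hg, hg, hg]; ring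
  simp only [symLap, this, mul_assoc, integral_const_mul]

/-- The principal value of the difference quotient is the symmetric integral. -/
theorem tendsto_pv_symLap (hg : Continuous g) (hB : ∀ x, |g x| ≤ B) (hp1 : 1 < p) (s : ℝ)
    (hi : IntegrableOn (fun t => secondDiff g s t * t ^ (-p)) (Set.Ioi 0)) :
    (∀ ε > 0, IntegrableOn (fun t => (g s - g (s - t)) * |t| ^ (-p)) {t | ε ≤ |t|}) ∧
    Tendsto (fun ε : ℝ => ∫ t in {t | ε ≤ |t|}, (g s - g (s - t)) * |t| ^ (-p)) (𝓝[>] 0)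
      (𝓝 (symLap p g s)) := by
  have hset : ∀ ε : ℝ, 0 < ε → {t : ℝ | ε ≤ |t|} = Set.Iic (-ε) ∪ Set.Ici ε := fun ε hε => by
    ext t; simp only [Set.mem_ofPred_eq, le_abs, Set.mem_union, Set.mem_Iic, Set.mem_Ici]
    constructor
    · rintro (h | h)
      · exact Or.inr h
      · exact Or.inl (by linarith)
    · rintro (h | h)
      · exact Or.inr (by linarith)
      · exact Or.inl h
  -- integrability over a half line of either side
  have hhalf : ∀ σ : ℝ, ∀ ε : ℝ, 0 < ε →
      IntegrableOn (fun t => (g s - g (s - σ * t)) * |t| ^ (-p)) (Set.Ici ε) := fun σ ε hε => by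
    have hI : IntegrableOn (fun t : ℝ => t ^ (-p)) (Set.Ici ε) :=
      integrableOn_Ici_iff_integrableOn_Ioi (by finiteness) |>.2
        (integrableOn_Ioi_rpow_of_lt (by linarith) hε)
    refine Integrable.mono' (hI.const_mul (2 * B)) ?_ ?_
    · refine ContinuousOn.aestronglyMeasurable ?_ measurableSet_Ici
      refine ContinuousOn.mul (by fun_prop) fun t ht => ?_
      have : |t| ≠ 0 := abs_ne_zero.2 (hε.trans_le ht).ne'
      exact (continuous_abs.continuousAt.rpow_const (Or.inl this)).continuousWithinAt
    · refine (ae_restrict_iff' measurableSet_Ici).2 (ae_of_all _ fun t ht => ?_)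
      have ht0 : 0 < t := hε.trans_le ht
      rw [norm_mul, abs_of_pos ht0, Real.norm_of_nonneg (Real.rpow_nonneg ht0.le _),
        Real.norm_eq_abs]
      refine mul_le_mul_of_nonneg_right ?_ (Real.rpow_nonneg ht0.le _)
      exact (abs_sub _ _).trans (by linarith [hB s, hB (s - σ * t)])
  have hneg : ∀ ε : ℝ, 0 < ε →
      IntegrableOn (fun t => (g s - g (s - t)) * |t| ^ (-p)) (Set.Iic (-ε)) := fun ε hε => by
    have := (hhalf (-1) ε hε).comp_neg
    simpa using this
  have hpos : ∀ ε : ℝ, 0 < ε →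
      IntegrableOn (fun t => (g s - g (s - t)) * |t| ^ (-p)) (Set.Ici ε) := fun ε hε => by
    simpa using hhalf 1 ε hε
  refine ⟨fun ε hε => hset ε hε ▸ (hneg ε hε).union (hpos ε hε), ?_⟩
  have hval : ∀ ε : ℝ, 0 < ε → ∫ t in {t | ε ≤ |t|}, (g s - g (s - t)) * |t| ^ (-p)
      = ∫ t in Set.Ioi ε, secondDiff g s t * t ^ (-p) := fun ε hε => by
    rw [hset ε hε, setIntegral_union (Set.disjoint_left.2 fun t h1 h2 => by
      simp only [Set.mem_Iic, Set.mem_Ici] at h1 h2; linarith) measurableSet_Ici (hneg ε hε)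
      (hpos ε hε), ← integral_comp_neg_Ioi, integral_Ici_eq_integral_Ioi]
    have j1 : IntegrableOn (fun t => (g s - g (s - -t)) * |(-t)| ^ (-p)) (Set.Ioi ε) := by
      have := (hhalf (-1) ε hε).mono_set Set.Ioi_subset_Ici_self
      simpa using this
    rw [← integral_add j1 ((hpos ε hε).mono_set Set.Ioi_subset_Ici_self)]
    refine setIntegral_congr_fun measurableSet_Ioi fun t ht => ?_
    simp only [abs_neg, abs_of_pos (hε.trans ht), secondDiff, sub_neg_eq_add]
    ring
  have hlim : Tendsto (fun ε : ℝ => ∫ t in Set.Ioi ε, secondDiff g s t * t ^ (-p)) (𝓝[>] 0)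
      (𝓝 (symLap p g s)) := by
    have hcont : Tendsto (fun ε : ℝ => ∫ t in (0 : ℝ)..ε, secondDiff g s t * t ^ (-p)) (𝓝[>] 0)
        (𝓝 0) := by
      have hi1 : IntervalIntegrable (fun t => secondDiff g s t * t ^ (-p)) volume 0 1 :=
        (intervalIntegrable_iff_integrableOn_Ioc_of_le zero_le_one).2
          (hi.mono_set Set.Ioc_subset_Ioi_self)
      have hi2 := (intervalIntegrable_iff' (by finiteness)).1 hi1
      have := intervalIntegral.continuousOn_primitive_interval hi2 0 Set.left_mem_uIcc
      rw [ContinuousWithinAt, intervalIntegral.integral_same, Set.uIcc_of_le zero_le_one] at this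
      exact this.mono_left (nhdsWithin_le_iff.2 (mem_of_superset
        (Ioo_mem_nhdsGT one_pos) Set.Ioo_subset_Icc_self))
    have h2 := (tendsto_const_nhds (x := symLap p g s)).sub hcont
    rw [sub_zero] at h2
    refine h2.congr' ?_
    filter_upwards [self_mem_nhdsWithin] with ε hε
    have hε' : 0 < ε := hε
    have := intervalIntegral.integral_Ioi_sub_Ioi hi hε'.le
    unfold symLap
    linarith
  refine hlim.congr' ?_
  filter_upwards [self_mem_nhdsWithin] with ε hε
  exact (hval ε hε).symm

end symLap

/-! ### The kernel `P_R` -/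

section kernel

variable {α R : ℝ}

theorem kernelP_eq (α R t : ℝ) : kernelP α R t = ((2 * R) ^ 2 + t ^ 2) ^ (-(2 + α) / 2) := by
  rw [kernelP, sq_abs]

theorem kernelP_base_pos (hR : 0 < R) (t : ℝ) : 0 < (2 * R) ^ 2 + t ^ 2 := by positivity

theorem kernelP_pos (hR : 0 < R) (t : ℝ) : 0 < kernelP α R t := by
  rw [kernelP_eq]; exact Real.rpow_pos_of_pos (kernelP_base_pos hR t) _

theorem kernelP_neg (α R t : ℝ) : kernelP α R (-t) = kernelP α R t := by
  rw [kernelP_eq, kernelP_eq, neg_sq]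

theorem continuous_rpow_sq_add_sq (hR : 0 < R) (ν : ℝ) :
    Continuous fun t : ℝ => ((2 * R) ^ 2 + t ^ 2) ^ ν := by
  have h : ∀ t : ℝ, (2 * R) ^ 2 + t ^ 2 ≠ 0 := fun t => (kernelP_base_pos hR t).ne'
  exact Continuous.rpow_const (by fun_prop) fun t => Or.inl (h t)

theorem continuous_kernelP (hR : 0 < R) : Continuous (kernelP α R) := by
  rw [show kernelP α R = fun t => ((2 * R) ^ 2 + t ^ 2) ^ (-(2 + α) / 2) from
    funext (kernelP_eq α R)]
  exact continuous_rpow_sq_add_sq hR _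

theorem integrable_rpow_sq_add_sq (hR : 0 < R) {ν : ℝ} (hν : 1 < ν) :
    Integrable fun t : ℝ => ((2 * R) ^ 2 + t ^ 2) ^ (-ν / 2) := by
  have h1 : Integrable fun t : ℝ => (1 + ‖t‖ ^ 2) ^ (-ν / 2) :=
    integrable_rpow_neg_one_add_norm_sq (by simpa using hν)
  set m := min ((2 * R) ^ 2) 1 with hm
  have hm0 : 0 < m := lt_min (by positivity) one_pos
  refine (h1.const_mul (m ^ (-ν / 2))).mono' (continuous_rpow_sq_add_sq hR _).aestronglyMeasurable
    (ae_of_all _ fun t => ?_)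
  rw [Real.norm_of_nonneg (Real.rpow_nonneg (kernelP_base_pos hR t).le _),
    ← Real.mul_rpow hm0.le (by positivity)]
  refine Real.rpow_le_rpow_of_nonpos (by positivity) ?_ (by linarith)
  rw [Real.norm_eq_abs, sq_abs, mul_add, mul_one]
  have h2 : m ≤ (2 * R) ^ 2 := min_le_left _ _
  have h3 : m * t ^ 2 ≤ 1 * t ^ 2 := mul_le_mul_of_nonneg_right (min_le_right _ _) (sq_nonneg t)
  linarith

theorem integrable_kernelP (hα0 : 0 < α) (hR : 0 < R) : Integrable (kernelP α R) := by
  rw [show kernelP α R = fun t => ((2 * R) ^ 2 + t ^ 2) ^ (-(2 + α) / 2) from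
    funext (kernelP_eq α R)]
  exact integrable_rpow_sq_add_sq hR (by linarith)

/-- The cosine transform of `P_R`. -/
def kernelCos (α R ξ : ℝ) : ℝ := ∫ t, kernelP α R t * Real.cos (ξ * t)

theorem kernelCos_zero (α R : ℝ) : kernelCos α R 0 = ∫ t, kernelP α R t := by simp [kernelCos]

theorem integrable_mul_cos {f : ℝ → ℝ} (hf : Integrable f) (ξ : ℝ) :
    Integrable fun t => f t * Real.cos (ξ * t) := by
  refine hf.mul_bdd (c := 1) (by fun_prop : Continuous fun t => Real.cos (ξ * t)).aestronglyMeasurable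
    (ae_of_all _ fun t => ?_)
  exact Real.abs_cos_le_one _

theorem kernelCos_zero_pos (hα0 : 0 < α) (hR : 0 < R) : 0 < kernelCos α R 0 := by
  rw [kernelCos_zero]
  refine (integral_pos_iff_support_of_nonneg (fun t => (kernelP_pos hR t).le)
    (integrable_kernelP hα0 hR)).2 ?_
  have : Function.support (kernelP α R) = Set.univ :=
    Set.eq_univ_of_forall fun t => (kernelP_pos hR t).ne'
  rw [this]; simp

theorem kernelCos_le (hα0 : 0 < α) (hR : 0 < R) (ξ : ℝ) : kernelCos α R ξ ≤ kernelCos α R 0 := by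
  rw [kernelCos_zero]
  refine integral_mono (integrable_mul_cos (integrable_kernelP hα0 hR) ξ) (integrable_kernelP hα0 hR) fun t => ?_
  exact mul_le_of_le_one_right (kernelP_pos hR t).le (Real.cos_le_one _)

/-- A continuous nonnegative integrable function that is positive somewhere has positive
integral. -/
theorem integral_pos_of_continuous {f : ℝ → ℝ} (hf : Continuous f) (hi : Integrable f)
    (h0 : ∀ t, 0 ≤ f t) {a : ℝ} (ha : f a ≠ 0) : 0 < ∫ t, f t := by
  refine (integral_pos_iff_support_of_nonneg h0 hi).2 ?_
  exact hf.isOpen_support.measure_pos _ ⟨a, ha⟩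

theorem integral_exp_neg_mul_sq_mul_cos_nonneg {x : ℝ} (hx : 0 < x) (ξ : ℝ) :
    0 ≤ ∫ t : ℝ, Real.exp (-x * t ^ 2) * Real.cos (ξ * t) := by
  have h := fourierIntegral_gaussian (b := (x : ℂ)) (by simpa using hx) (ξ : ℂ)
  have hi : Integrable fun t : ℝ => Complex.exp (Complex.I * ξ * t) * Complex.exp (-x * t ^ 2) := by
    have := integrable_cexp_quadratic (b := (x : ℂ)) (by simpa using hx)
      (Complex.I * ξ) 0
    refine this.congr (ae_of_all _ fun t => ?_)
    simp only [add_zero]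
    rw [← Complex.exp_add, add_comm]
  have e : ∀ t : ℝ, Real.exp (-x * t ^ 2) * Real.cos (ξ * t)
      = (Complex.exp (Complex.I * ξ * t) * Complex.exp (-x * t ^ 2)).re := by
    intro t
    have h1 : Complex.exp (-(x : ℂ) * t ^ 2) = (Real.exp (-x * t ^ 2) : ℝ) := by push_cast; rfl
    have h2 : Complex.I * ξ * t = ((ξ * t : ℝ) : ℂ) * Complex.I := by push_cast; ring
    rw [h1, h2, Complex.re_mul_ofReal, Complex.exp_ofReal_mul_I_re, mul_comm]
  simp only [e]
  have hre := integral_re hi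
  simp only [RCLike.re_to_complex] at hre
  rw [hre, h]
  have h3 : ((π : ℂ) / (x : ℂ)) ^ (1 / 2 : ℂ) = (((π / x) ^ (1 / 2 : ℝ) : ℝ) : ℂ) := by
    rw [Complex.ofReal_cpow (by positivity)]; push_cast; rfl
  have h4 : Complex.exp (-(ξ : ℂ) ^ 2 / (4 * (x : ℂ))) = (Real.exp (-ξ ^ 2 / (4 * x)) : ℝ) := by
    push_cast; rfl
  rw [h3, h4, ← Complex.ofReal_mul, Complex.ofReal_re]
  positivity

/-- `P_R` is a superposition of Gaussians, so its Fourier transform is nonnegative. -/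
theorem kernelCos_nonneg (hα0 : 0 < α) (hR : 0 < R) (ξ : ℝ) : 0 ≤ kernelCos α R ξ := by
  set ν := (2 + α) / 2 with hν
  have hν0 : 0 < ν := by positivity
  have hΓ : 0 < Real.Gamma ν := Real.Gamma_pos_of_pos hν0
  have hgam : ∀ t : ℝ, ∫ x in Set.Ioi (0 : ℝ), x ^ (ν - 1) * Real.exp (-(((2 * R) ^ 2 + t ^ 2) * x))
      = kernelP α R t * Real.Gamma ν := fun t => by
    rw [Real.integral_rpow_mul_exp_neg_mul_Ioi hν0 (kernelP_base_pos hR t), kernelP_eq, one_div,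
      Real.inv_rpow (kernelP_base_pos hR t).le, ← Real.rpow_neg (kernelP_base_pos hR t).le, hν,
      neg_div]
  have hgi : ∀ t : ℝ, IntegrableOn
      (fun x : ℝ => x ^ (ν - 1) * Real.exp (-(((2 * R) ^ 2 + t ^ 2) * x))) (Set.Ioi 0) := fun t => by
    have := integrableOn_rpow_mul_exp_neg_mul_rpow (p := 1) (s := ν - 1) (by linarith) one_pos
      (kernelP_base_pos hR t)
    simpa only [Real.rpow_one, neg_mul] using this
  set G : ℝ × ℝ → ℝ := fun z => z.2 ^ (ν - 1) * Real.exp (-(((2 * R) ^ 2 + z.1 ^ 2) * z.2)) *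
    Real.cos (ξ * z.1) with hG
  have hmeas : Measurable G := by
    refine Measurable.mul (Measurable.mul ?_ ?_) ?_
    · exact measurable_snd.pow_const _
    · exact Continuous.measurable (by fun_prop)
    · exact Continuous.measurable (by fun_prop)
  have hint : Integrable G (volume.prod (volume.restrict (Set.Ioi 0))) := by
    refine (integrable_prod_iff hmeas.aestronglyMeasurable).2 ⟨ae_of_all _ fun t => ?_, ?_⟩
    · exact Integrable.mul_const (hgi t) (Real.cos (ξ * t))
    · refine ((integrable_kernelP hα0 hR).mul_const (Real.Gamma ν)).mono' ?_
        (ae_of_all _ fun t => ?_)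
      · exact hmeas.aestronglyMeasurable.norm.integral_prod_right'
      · rw [Real.norm_of_nonneg (integral_nonneg fun _ => norm_nonneg _), ← hgam t]
        refine integral_mono_of_nonneg (ae_of_all _ fun _ => norm_nonneg _) (hgi t)
          ((ae_restrict_iff' measurableSet_Ioi).2 (ae_of_all _ fun x hx => ?_))
        have hx0 : (0 : ℝ) < x := hx
        simp only [hG, norm_mul, Real.norm_eq_abs]
        rw [abs_of_nonneg (Real.rpow_nonneg hx0.le _), abs_of_pos (Real.exp_pos _)]
        exact mul_le_of_le_one_right (by positivity) (Real.abs_cos_le_one _)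
  have hswap : kernelCos α R ξ * Real.Gamma ν
      = ∫ x in Set.Ioi (0 : ℝ), ∫ t : ℝ, G (t, x) := by
    have h1 := integral_integral_swap (f := fun t x => G (t, x)) hint
    rw [← h1, kernelCos, ← integral_mul_const]
    refine integral_congr_ae (ae_of_all _ fun t => ?_)
    simp only [hG]
    rw [integral_mul_const, hgam]; ring
  have hpos : 0 ≤ kernelCos α R ξ * Real.Gamma ν := by
    rw [hswap]
    refine setIntegral_nonneg measurableSet_Ioi fun x hx => ?_
    have hx0 : (0 : ℝ) < x := hx
    have : ∀ t, G (t, x) = x ^ (ν - 1) * Real.exp (-((2 * R) ^ 2 * x)) *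
        (Real.exp (-x * t ^ 2) * Real.cos (ξ * t)) := fun t => by
      simp only [hG]
      rw [show -(((2 * R) ^ 2 + t ^ 2) * x) = -((2 * R) ^ 2 * x) + -x * t ^ 2 by ring, Real.exp_add]
      ring
    simp only [this]
    rw [integral_const_mul]
    exact mul_nonneg (by positivity) (integral_exp_neg_mul_sq_mul_cos_nonneg hx0 ξ)
  exact nonneg_of_mul_nonneg_left hpos hΓ

/-- Minus the derivative of `P_R(t)` in `R`. -/
def kernelDR (α R t : ℝ) : ℝ := 4 * (2 + α) * R * ((2 * R) ^ 2 + t ^ 2) ^ (-(4 + α) / 2)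

theorem kernelDR_pos (hα0 : 0 < α) (hR : 0 < R) (t : ℝ) : 0 < kernelDR α R t :=
  mul_pos (by positivity) (Real.rpow_pos_of_pos (kernelP_base_pos hR t) _)

theorem continuous_kernelDR (hR : 0 < R) : Continuous (kernelDR α R) :=
  (continuous_rpow_sq_add_sq hR _).const_mul _

theorem hasDerivAt_kernelP (hR : 0 < R) (t : ℝ) :
    HasDerivAt (fun R => kernelP α R t) (-kernelDR α R t) R := by
  simp only [kernelP_eq]
  have h1 : HasDerivAt (fun R : ℝ => (2 * R) ^ 2 + t ^ 2) (8 * R) R := by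
    have := (((hasDerivAt_id R).const_mul 2).pow 2).add_const (t ^ 2)
    convert! this using 1
    simp; ring
  have h2 := h1.rpow_const (p := -(2 + α) / 2) (Or.inl (kernelP_base_pos hR t).ne')
  convert! h2 using 1
  rw [kernelDR, show -(2 + α) / 2 - 1 = -(4 + α) / 2 by ring]; ring

theorem hasDerivAt_integral_kernelP (hα0 : 0 < α) (hR : 0 < R) {w : ℝ → ℝ} (hw : Continuous w)
    {B : ℝ} (hB : ∀ t, |w t| ≤ B) :
    Integrable (fun t => w t * kernelDR α R t) ∧
    HasDerivAt (fun R => ∫ t, w t * kernelP α R t) (-∫ t, w t * kernelDR α R t) R := by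
  have hB0 : 0 ≤ B := (abs_nonneg _).trans (hB 0)
  have hs : Metric.ball R (R / 2) ∈ 𝓝 R := Metric.ball_mem_nhds R (by positivity)
  have hs' : ∀ x ∈ Metric.ball R (R / 2), R / 2 < x ∧ x < 3 * R / 2 := fun x hx => by
    rw [Real.ball_eq_Ioo] at hx
    exact ⟨by linarith [hx.1], by linarith [hx.2]⟩
  have h := hasDerivAt_integral_of_dominated_loc_of_deriv_le (μ := volume)
    (F := fun R t => w t * kernelP α R t) (F' := fun R t => w t * -kernelDR α R t)
    (bound := fun t => B * (4 * (2 + α) * (3 * R / 2) *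
      ((2 * (R / 2)) ^ 2 + t ^ 2) ^ (-(4 + α) / 2))) hs ?_ ?_ ?_ ?_ ?_ ?_
  · refine ⟨by simpa using h.1.neg, ?_⟩
    have h2 := h.2
    simp only [mul_neg, integral_neg] at h2
    exact h2
  · filter_upwards [hs] with x hx
    exact (hw.mul (continuous_kernelP (by linarith [(hs' x hx).1]))).aestronglyMeasurable
  · exact (integrable_kernelP hα0 hR).bdd_mul (c := B) hw.aestronglyMeasurable (ae_of_all _ hB)
  · exact (hw.mul (continuous_kernelDR hR).neg).aestronglyMeasurable
  · refine ae_of_all _ fun t x hx => ?_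
    obtain ⟨hx1, hx2⟩ := hs' x hx
    have hx0 : 0 < x := by linarith
    rw [norm_mul, norm_neg, Real.norm_of_nonneg (kernelDR_pos hα0 hx0 t).le]
    refine mul_le_mul (hB t) ?_ (kernelDR_pos hα0 hx0 t).le hB0
    refine mul_le_mul (mul_le_mul_of_nonneg_left hx2.le (by positivity)) ?_
      (Real.rpow_nonneg (kernelP_base_pos hx0 t).le _) (by positivity)
    refine Real.rpow_le_rpow_of_nonpos (kernelP_base_pos (by positivity) t) ?_ (by linarith)
    have : (2 * (R / 2)) ^ 2 ≤ (2 * x) ^ 2 := pow_le_pow_left₀ (by positivity) (by linarith) 2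
    linarith
  · exact ((integrable_rpow_sq_add_sq (R := R / 2) (by positivity) (by linarith)).const_mul _).const_mul _
  · refine ae_of_all _ fun t x hx => ?_
    exact (hasDerivAt_kernelP (by linarith [(hs' x hx).1]) t).const_mul (w t)

/-- `∫ (1 + cos t) P_R(t) dt`, the contribution of the second integral to `Φ(0, 1, cos)`. -/
def bandCoef (α R : ℝ) : ℝ := ∫ t, (1 + Real.cos t) * kernelP α R t

theorem bandCoef_eq (hα0 : 0 < α) (hR : 0 < R) :
    bandCoef α R = kernelCos α R 0 + kernelCos α R 1 := by
  have hP := integrable_kernelP hα0 hR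
  rw [kernelCos_zero, kernelCos, ← integral_add hP (integrable_mul_cos hP 1)]
  refine integral_congr_ae (ae_of_all _ fun t => ?_)
  simp only [one_mul]; ring

theorem abs_one_add_cos_le (t : ℝ) : |1 + Real.cos t| ≤ 2 :=
  abs_le.2 ⟨by linarith [Real.neg_one_le_cos t], by linarith [Real.cos_le_one t]⟩

theorem hasDerivAt_bandCoef (hα0 : 0 < α) (hR : 0 < R) :
    HasDerivAt (bandCoef α) (-∫ t, (1 + Real.cos t) * kernelDR α R t) R :=
  (hasDerivAt_integral_kernelP hα0 hR (by fun_prop) abs_one_add_cos_le).2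

theorem bandCoef_deriv_pos (hα0 : 0 < α) (hR : 0 < R) :
    0 < ∫ t, (1 + Real.cos t) * kernelDR α R t := by
  refine integral_pos_of_continuous ?_
    (hasDerivAt_integral_kernelP hα0 hR (by fun_prop) abs_one_add_cos_le).1
    (fun t => mul_nonneg (by linarith [Real.neg_one_le_cos t]) (kernelDR_pos hα0 hR t).le)
    (a := 0) ?_
  · have := continuous_kernelDR (α := α) hR
    fun_prop
  · have := kernelDR_pos hα0 hR 0
    rw [Real.cos_zero]; positivity

theorem strictAntiOn_bandCoef (hα0 : 0 < α) : StrictAntiOn (bandCoef α) (Set.Ioi 0) := by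
  refine strictAntiOn_of_deriv_neg (convex_Ioi 0)
    (fun R hR => (hasDerivAt_bandCoef hα0 hR).continuousAt.continuousWithinAt) fun R hR => ?_
  rw [interior_Ioi] at hR
  rw [(hasDerivAt_bandCoef hα0 hR).deriv]
  linarith [bandCoef_deriv_pos hα0 hR]

/-- `bandCoef` tends to `0` at `∞`, at the rate `R ^ (-α)`. -/
theorem bandCoef_le (hα0 : 0 < α) (hR : 1 ≤ 2 * R) : bandCoef α R ≤ 2 * π * (2 * R) ^ (-α) := by
  have hR0 : 0 < R := by linarith
  have hi : Integrable fun t : ℝ => 2 * ((2 * R) ^ (-α) * (1 + t ^ 2)⁻¹) :=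
    (integrable_inv_one_add_sq.const_mul _).const_mul _
  have h : bandCoef α R ≤ ∫ t : ℝ, 2 * ((2 * R) ^ (-α) * (1 + t ^ 2)⁻¹) := by
    refine integral_mono ((integrable_kernelP hα0 hR0).bdd_mul (c := 2) (by fun_prop)
      (ae_of_all _ abs_one_add_cos_le)) hi fun t => ?_
    refine mul_le_mul (by linarith [Real.cos_le_one t]) ?_ (kernelP_pos hR0 t).le (by norm_num)
    have hb := kernelP_base_pos hR0 t
    rw [kernelP_eq, show -(2 + α) / 2 = -α / 2 + -1 by ring, Real.rpow_add hb, Real.rpow_neg_one]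
    refine mul_le_mul ?_ ?_ (inv_nonneg.2 hb.le) (by positivity)
    · rw [show (2 * R) ^ (-α) = ((2 * R) ^ 2) ^ (-α / 2) by
        rw [← Real.rpow_natCast, ← Real.rpow_mul (by linarith)]; congr 1; push_cast; ring]
      exact Real.rpow_le_rpow_of_nonpos (by positivity) (by nlinarith [sq_nonneg t]) (by linarith)
    · refine inv_anti₀ (by positivity) ?_
      nlinarith
  refine h.trans_eq ?_
  rw [integral_const_mul, integral_const_mul, integral_univ_inv_one_add_sq]; ring

/-- `bandCoef` blows up at `0`, at the rate `R ^ (-(1 + α))`. -/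
theorem le_bandCoef (hα0 : 0 < α) (hR : 0 < R) (hR1 : R ≤ 1) :
    (5 : ℝ) ^ (-(2 + α) / 2) * R ^ (-(1 + α)) ≤ bandCoef α R := by
  have hi : Integrable fun t => (1 + Real.cos t) * kernelP α R t :=
    (integrable_kernelP hα0 hR).bdd_mul (c := 2) (by fun_prop) (ae_of_all _ abs_one_add_cos_le)
  have h0 : ∀ t, 0 ≤ (1 + Real.cos t) * kernelP α R t := fun t =>
    mul_nonneg (by linarith [Real.neg_one_le_cos t]) (kernelP_pos hR t).le
  have h1 : ∫ t in Set.Icc 0 R, (1 + Real.cos t) * kernelP α R t ≤ bandCoef α R :=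
    setIntegral_le_integral hi (ae_of_all _ h0)
  refine le_trans ?_ h1
  have h2 : ∫ t in Set.Icc 0 R, (5 * R ^ 2) ^ (-(2 + α) / 2)
      ≤ ∫ t in Set.Icc 0 R, (1 + Real.cos t) * kernelP α R t := by
    refine setIntegral_mono_on (by simp) hi.integrableOn measurableSet_Icc fun t ht => ?_
    have hcos : 0 ≤ Real.cos t := Real.cos_nonneg_of_mem_Icc
      ⟨by linarith [ht.1, Real.pi_pos], by linarith [ht.2, Real.pi_gt_three]⟩
    have hle : (5 * R ^ 2) ^ (-(2 + α) / 2) ≤ kernelP α R t := by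
      rw [kernelP_eq]
      refine Real.rpow_le_rpow_of_nonpos (kernelP_base_pos hR t) ?_ (by linarith)
      nlinarith [ht.1, ht.2]
    nlinarith [kernelP_pos (α := α) hR t]
  refine le_trans (le_of_eq ?_) h2
  rw [setIntegral_const]
  simp only [Real.volume_real_Icc, sub_zero, max_eq_left hR.le, smul_eq_mul]
  rw [Real.mul_rpow (by norm_num) (by positivity), ← Real.rpow_natCast, ← Real.rpow_mul hR.le,
    show -(1 + α) = 1 + (((2 : ℕ) : ℝ) * (-(2 + α) / 2)) by push_cast; ring, Real.rpow_add hR,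
    Real.rpow_one]
  ring

theorem existsUnique_bandCoef_eq (hα0 : 0 < α) {m : ℝ} (hm : 0 < m) :
    ∃! R : ℝ, 0 < R ∧ bandCoef α R = m := by
  obtain ⟨R₁, hR₁, h₁⟩ : ∃ R, 0 < R ∧ m ≤ bandCoef α R := by
    have hc : (0 : ℝ) < 5 ^ (-(2 + α) / 2) := by positivity
    set M := max 1 (m / 5 ^ (-(2 + α) / 2)) with hM
    have hM1 : 1 ≤ M := le_max_left _ _
    have hM0 : 0 < M := one_pos.trans_le hM1
    refine ⟨M ^ (-(1 + α)⁻¹), by positivity, le_trans ?_ (le_bandCoef hα0 (by positivity)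
      (Real.rpow_le_one_of_one_le_of_nonpos hM1 (by rw [neg_nonpos]; positivity)))⟩
    rw [← Real.rpow_mul hM0.le, neg_mul_neg, inv_mul_cancel₀ (by positivity), Real.rpow_one,
      ← div_le_iff₀' hc]
    exact le_max_right _ _
  obtain ⟨R₂, hR₂, h₂⟩ : ∃ R, 0 < R ∧ bandCoef α R ≤ m := by
    have hlim : Tendsto (fun R : ℝ => 2 * π * (2 * R) ^ (-α)) atTop (𝓝 (2 * π * 0)) :=
      ((tendsto_rpow_neg_atTop hα0).comp (tendsto_id.const_mul_atTop two_pos)).const_mul _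
    rw [mul_zero] at hlim
    obtain ⟨R, hR, hR1⟩ := ((hlim.eventually (gt_mem_nhds hm)).and (eventually_ge_atTop 1)).exists
    exact ⟨R, by linarith, (bandCoef_le hα0 (by linarith)).trans hR.le⟩
  have hcont : ContinuousOn (bandCoef α) (Set.Ioi 0) := fun R hR =>
    (hasDerivAt_bandCoef hα0 hR).continuousAt.continuousWithinAt
  obtain ⟨R, hR, hRm⟩ := isPreconnected_Ioi.intermediate_value hR₂ hR₁ hcont ⟨h₂, h₁⟩
  exact ⟨R, ⟨hR, hRm⟩, fun R' hR' => (strictAntiOn_bandCoef hα0).injOn hR'.1 hR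
    (hR'.2.trans hRm.symm)⟩

/-- `P_R` depends continuously on `R` in `L¹`; it is monotone in `R`, so the `L¹` distance is the
difference of the masses. -/
theorem integral_abs_kernelP_sub (hα0 : 0 < α) (hR : 0 < R) {R' : ℝ} (hR' : 0 < R') :
    ∫ t, |kernelP α R' t - kernelP α R t| = |kernelCos α R' 0 - kernelCos α R 0| := by
  have key : ∀ R R' : ℝ, 0 < R → 0 < R' → R ≤ R' →
      ∫ t, |kernelP α R' t - kernelP α R t| = |kernelCos α R' 0 - kernelCos α R 0| := by
    intro R R' hR hR' hle
    have h : ∀ t, kernelP α R' t ≤ kernelP α R t := fun t => by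
      rw [kernelP_eq, kernelP_eq]
      refine Real.rpow_le_rpow_of_nonpos (kernelP_base_pos hR t) ?_ (by linarith)
      have := pow_le_pow_left₀ (by positivity) (by linarith : 2 * R ≤ 2 * R') 2
      linarith
    have e : ∀ t, |kernelP α R' t - kernelP α R t| = kernelP α R t - kernelP α R' t := fun t => by
      rw [abs_sub_comm, abs_of_nonneg (sub_nonneg.2 (h t))]
    have h2 := integral_mono (integrable_kernelP hα0 hR') (integrable_kernelP hα0 hR) h
    simp only [e]
    rw [integral_sub (integrable_kernelP hα0 hR) (integrable_kernelP hα0 hR'), kernelCos_zero,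
      kernelCos_zero, abs_sub_comm, abs_of_nonneg (sub_nonneg.2 h2)]
  rcases le_total R R' with h | h
  · exact key R R' hR hR' h
  · rw [abs_sub_comm (kernelCos α R' 0), ← key R' R hR' hR h]
    simp only [abs_sub_comm]

theorem continuousAt_kernelCos_zero (hα0 : 0 < α) (hR : 0 < R) :
    ContinuousAt (fun R => kernelCos α R 0) R := by
  have := (hasDerivAt_integral_kernelP hα0 hR (w := fun _ => 1) continuous_const (B := 1)
    (by simp)).2.continuousAt
  simpa [kernelCos_zero] using this

end kernel

/-! ### The symbol of `symLap` -/

/-- The Fourier multiplier of `symLap p`. -/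
def lapSymbol (p ξ : ℝ) : ℝ := ∫ t in Set.Ioi 0, 2 * (1 - Real.cos (ξ * t)) * t ^ (-p)

theorem secondDiff_cos (ξ s t : ℝ) : secondDiff (fun s => Real.cos (ξ * s)) s t
    = Real.cos (ξ * s) * (2 * (1 - Real.cos (ξ * t))) := by
  simp only [secondDiff, mul_sub, mul_add, Real.cos_sub, Real.cos_add]
  ring

theorem symLap_cos (p ξ s : ℝ) :
    symLap p (fun s => Real.cos (ξ * s)) s = lapSymbol p ξ * Real.cos (ξ * s) := by
  simp only [symLap, secondDiff_cos, lapSymbol, mul_assoc, integral_const_mul]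
  ring

theorem integrableOn_lapSymbol {p : ℝ} (hp1 : 1 < p) (hp3 : p < 3) (ξ : ℝ) :
    IntegrableOn (fun t => 2 * (1 - Real.cos (ξ * t)) * t ^ (-p)) (Set.Ioi 0) := by
  have hH : ∀ x y : ℝ, |-(Real.sin (ξ * x) * ξ) - -(Real.sin (ξ * y) * ξ)|
      ≤ ξ ^ 2 * |x - y| ^ (1 : ℝ) := fun x y => by
    have h := Real.abs_sin_sub_sin_le (ξ * x) (ξ * y)
    rw [← mul_sub, abs_mul] at h
    rw [show -(Real.sin (ξ * x) * ξ) - -(Real.sin (ξ * y) * ξ)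
      = -(ξ * (Real.sin (ξ * x) - Real.sin (ξ * y))) by ring, abs_neg, abs_mul, Real.rpow_one,
      ← sq_abs, sq, mul_assoc]
    exact mul_le_mul_of_nonneg_left h (abs_nonneg _)
  have := (symLap_integrable_bound (p := p) (r := 1) (g := fun s => Real.cos (ξ * s)) hp1
    (by linarith) zero_le_one le_rfl (fun x => by
      have := ((hasDerivAt_id x).const_mul ξ).cos
      simpa using this) (fun x => Real.abs_cos_le_one _) hH 0).1
  simpa [secondDiff_cos] using this

theorem lapSymbol_one_pos {p : ℝ} (hp1 : 1 < p) (hp3 : p < 3) : 0 < lapSymbol p 1 := by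
  have h0 : ∀ t ∈ Set.Ioi (0 : ℝ), 0 ≤ 2 * (1 - Real.cos (1 * t)) * t ^ (-p) := fun t ht =>
    mul_nonneg (by linarith [Real.cos_le_one (1 * t)]) (Real.rpow_nonneg (le_of_lt ht) _)
  rw [lapSymbol, setIntegral_pos_iff_support_of_nonneg_ae
    ((ae_restrict_iff' measurableSet_Ioi).2 (ae_of_all _ h0)) (integrableOn_lapSymbol hp1 hp3 1)]
  have hsub : Set.Ioo 0 π ⊆ Function.support (fun t : ℝ => 2 * (1 - Real.cos (1 * t)) * t ^ (-p))
      ∩ Set.Ioi 0 := fun t ht => by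
    refine ⟨?_, ht.1⟩
    have h1 : Real.cos t < 1 := by
      have := Real.cos_lt_cos_of_nonneg_of_le_pi le_rfl ht.2.le ht.1
      rwa [Real.cos_zero] at this
    have h2 := Real.rpow_pos_of_pos ht.1 (-p)
    have h3 : 0 < 2 * (1 - Real.cos (1 * t)) := by rw [one_mul]; linarith
    exact (mul_pos h3 h2).ne'
  exact lt_of_lt_of_le (by simp [Real.pi_pos]) (measure_mono hsub)

theorem lapSymbol_eq {p ξ : ℝ} (hp1 : 1 < p) (hξ : 0 ≤ ξ) :
    lapSymbol p ξ = lapSymbol p 1 * ξ ^ (p - 1) := by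
  rcases hξ.eq_or_lt with rfl | hξ
  · rw [Real.zero_rpow (by linarith)]; simp [lapSymbol]
  have h := integral_comp_mul_left_Ioi (fun t : ℝ => 2 * (1 - Real.cos (1 * t)) * t ^ (-p)) 0 hξ
  rw [mul_zero, smul_eq_mul] at h
  have e : ∀ t ∈ Set.Ioi (0 : ℝ), 2 * (1 - Real.cos (ξ * t)) * t ^ (-p)
      = ξ ^ p * (2 * (1 - Real.cos (1 * (ξ * t))) * (ξ * t) ^ (-p)) := fun t ht => by
    have h1 : ξ ^ p * ξ ^ (-p) = 1 := by rw [← Real.rpow_add hξ, add_neg_cancel, Real.rpow_zero]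
    rw [Real.mul_rpow hξ.le (le_of_lt ht), one_mul]
    linear_combination (-(2 * (1 - Real.cos (ξ * t)) * t ^ (-p))) * h1
  rw [lapSymbol, setIntegral_congr_fun measurableSet_Ioi e, integral_const_mul, h,
    Real.rpow_sub_one hξ.ne', lapSymbol]
  field_simp

theorem fracLapConst_eq (α : ℝ) : fracLapConst ((1 + α) / 2) = (lapSymbol (2 + α) 1)⁻¹ := by
  have h := integral_comp_abs (f := fun t : ℝ => (1 - Real.cos t) / t ^ (1 + 2 * ((1 + α) / 2)))
  simp only [Real.cos_abs] at h
  rw [fracLapConst, h, lapSymbol, ← integral_const_mul]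
  congr 1
  refine setIntegral_congr_fun measurableSet_Ioi fun t ht => ?_
  rw [one_mul, Real.rpow_neg (le_of_lt ht), show 1 + 2 * ((1 + α) / 2) = 2 + α by ring]
  ring

/-! ### Convolutions -/

/-- The convolution of `K` and `f`. -/
def convOp (K f : ℝ → ℝ) (s : ℝ) : ℝ := ∫ t, K t * f (s - t)

section convOp

variable {K f : ℝ → ℝ} {B : ℝ}

theorem convOp_integrable (hK : Integrable K) (hf : Continuous f) (hB : ∀ x, |f x| ≤ B) (s : ℝ) :
    Integrable fun t => K t * f (s - t) :=
  hK.mul_bdd (c := B) (by fun_prop : Continuous fun t => f (s - t)).aestronglyMeasurable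
    (ae_of_all _ fun t => hB _)

theorem abs_convOp_le (hK : Integrable K) (hB : ∀ x, |f x| ≤ B) (s : ℝ) :
    |convOp K f s| ≤ (∫ t, |K t|) * B := by
  rw [← integral_mul_const, convOp, ← Real.norm_eq_abs]
  refine norm_integral_le_of_norm_le (hK.abs.mul_const B) (ae_of_all _ fun t => ?_)
  rw [norm_mul]
  exact mul_le_mul_of_nonneg_left (hB _) (abs_nonneg _)

theorem abs_convOp_sub_le {r H : ℝ} (hK : Integrable K) (hf : Continuous f) (hB : ∀ x, |f x| ≤ B)
    (hH : ∀ x y, |f x - f y| ≤ H * |x - y| ^ r) (s s' : ℝ) :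
    |convOp K f s - convOp K f s'| ≤ (∫ t, |K t|) * H * |s - s'| ^ r := by
  have e : convOp K f s - convOp K f s' = ∫ t, K t * (f (s - t) - f (s' - t)) := by
    simp only [mul_sub]
    exact (integral_sub (convOp_integrable hK hf hB s) (convOp_integrable hK hf hB s')).symm
  rw [e, mul_assoc, ← integral_mul_const, ← Real.norm_eq_abs]
  refine norm_integral_le_of_norm_le (hK.abs.mul_const _) (ae_of_all _ fun t => ?_)
  rw [norm_mul]
  refine mul_le_mul_of_nonneg_left ?_ (abs_nonneg _)
  have := hH (s - t) (s' - t)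
  rwa [sub_sub_sub_cancel_right] at this

theorem convOp_periodic {T : ℝ} (hf : Function.Periodic f T) :
    Function.Periodic (convOp K f) T := fun s => by
  unfold convOp
  congr 1; funext t
  rw [show s + T - t = s - t + T by ring, hf]

theorem convOp_even (hK : ∀ t, K (-t) = K t) (hf : Function.Even f) :
    Function.Even (convOp K f) := fun s => by
  unfold convOp
  rw [← integral_neg_eq_self]
  congr 1; funext t
  rw [hK, show -s - -t = -(s - t) by ring, hf]

theorem convOp_cos (hK : Integrable K) (hKe : ∀ t, K (-t) = K t) (ξ s : ℝ) :
    convOp K (fun s => Real.cos (ξ * s)) s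
      = (∫ t, K t * Real.cos (ξ * t)) * Real.cos (ξ * s) := by
  have hsin : ∫ t, K t * Real.sin (ξ * t) = 0 := by
    have h := integral_neg_eq_self (fun t => K t * Real.sin (ξ * t)) volume
    simp only [hKe, mul_neg, Real.sin_neg, integral_neg] at h
    linarith
  have hi : Integrable fun t => K t * Real.sin (ξ * t) :=
    hK.mul_bdd (c := 1) (by fun_prop : Continuous fun t => Real.sin (ξ * t)).aestronglyMeasurable
      (ae_of_all _ fun t => Real.abs_sin_le_one _)
  have e : ∀ t, K t * Real.cos (ξ * (s - t)) = K t * Real.cos (ξ * t) * Real.cos (ξ * s)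
      + K t * Real.sin (ξ * t) * Real.sin (ξ * s) := fun t => by
    rw [mul_sub, Real.cos_sub]; ring
  simp only [convOp, e]
  rw [integral_add ((integrable_mul_cos hK ξ).mul_const _) (hi.mul_const _), integral_mul_const,
    integral_mul_const, hsin]
  ring

end convOp

/-! ### The bounded operators between the Hölder spaces -/

theorem C0Space.convOp_mem {r : ℝ} (hr : 0 < r) {K : ℝ → ℝ} (hK : Integrable K)
    (hKe : ∀ t, K (-t) = K t) (f : C0Space r) : convOp K f ∈ c0Submodule r :=
  have hH : IsHolder r (convOp K f) :=
    ⟨_, abs_convOp_sub_le hK f.continuous f.abs_le (f.abs_sub_le hr)⟩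
  ⟨hH.continuous hr, convOp_periodic f.periodic, convOp_even hKe f.even, hH⟩

/-- Convolution with an even integrable kernel, on `C^{0,r}`. -/
def convCLM {r : ℝ} (hr : 0 < r) {K : ℝ → ℝ} (hK : Integrable K) (hKe : ∀ t, K (-t) = K t) :
    C0Space r →L[ℝ] C0Space r :=
  LinearMap.mkContinuous
    { toFun := fun f => ⟨convOp K f, f.convOp_mem hr hK hKe⟩
      map_add' := fun f g => by
        refine FunSpace.ext (funext fun s => ?_)
        change convOp K (f.val + g.val) s = convOp K f s + convOp K g s
        simp only [convOp, Pi.add_apply, mul_add]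
        exact integral_add (convOp_integrable hK f.continuous f.abs_le s)
          (convOp_integrable hK g.continuous g.abs_le s)
      map_smul' := fun c f => by
        refine FunSpace.ext (funext fun s => ?_)
        change convOp K (c • f.val) s = c * convOp K f s
        simp only [convOp, Pi.smul_apply, smul_eq_mul, mul_left_comm _ c, integral_const_mul] }
    (3 * ∫ t, |K t|) fun f => by
      have := C0Space.norm_le ⟨convOp K f, f.convOp_mem hr hK hKe⟩ (abs_convOp_le hK f.abs_le)
        (abs_convOp_sub_le hK f.continuous f.abs_le (f.abs_sub_le hr))
      exact this.trans_eq (by ring)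

theorem norm_convCLM_sub_le {r : ℝ} (hr : 0 < r) {K K' : ℝ → ℝ} (hK : Integrable K)
    (hKe : ∀ t, K (-t) = K t) (hK' : Integrable K') (hKe' : ∀ t, K' (-t) = K' t) :
    ‖convCLM hr hK hKe - convCLM hr hK' hKe'‖ ≤ 3 * ∫ t, |K t - K' t| := by
  have h : convCLM hr hK hKe - convCLM hr hK' hKe' = convCLM hr (hK.sub hK')
      (fun t => by simp only [Pi.sub_apply, hKe, hKe']) := by
    refine ContinuousLinearMap.ext fun f => FunSpace.ext (funext fun s => ?_)
    change convOp K f s - convOp K' f s = convOp (K - K') f s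
    simp only [convOp, Pi.sub_apply, sub_mul]
    exact (integral_sub (convOp_integrable hK f.continuous f.abs_le s)
      (convOp_integrable hK' f.continuous f.abs_le s)).symm
  rw [h]
  exact LinearMap.mkContinuous_norm_le _ (mul_nonneg (by norm_num)
    (integral_nonneg fun _ => abs_nonneg _)) _

/-- The inclusion of `C^{1,q}` in `C^{0,r}`. -/
def inclCLM {q r : ℝ} (hr : 0 < r) (hr1 : r ≤ 1) : C1Space q →L[ℝ] C0Space r :=
  have hH : ∀ f : C1Space q, ∀ x y, |f x - f y| ≤ 2 * ‖f‖ * |x - y| ^ r := fun f =>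
    abs_sub_le_rpow hr.le hr1 (fun x y => (abs_sub _ _).trans (by linarith [f.abs_le x, f.abs_le y]))
      f.abs_sub_le
  LinearMap.mkContinuous
    { toFun := fun f => ⟨f, f.continuous, f.periodic, f.even, _, hH f⟩
      map_add' := fun _ _ => rfl
      map_smul' := fun _ _ => rfl } 3 fun f => by
    have := C0Space.norm_le (⟨f, f.continuous, f.periodic, f.even, _, hH f⟩ : C0Space r) f.abs_le
      (hH f)
    exact this.trans_eq (by ring)

section symLapCLM

variable {α β : ℝ}

theorem C1Space.symLap_integrable_bound (hα0 : 0 < α) (hαβ : α < β) (hβ1 : β < 1) (f : C1Space β)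
    (s : ℝ) : IntegrableOn (fun t => secondDiff f s t * t ^ (-(2 + α))) (Set.Ioi 0) ∧
      |symLap (2 + α) f s| ≤ (4 / (β - α) + 4 / (1 + α)) * ‖f‖ := by
  obtain ⟨h1, h2⟩ := NMCBand.symLap_integrable_bound (p := 2 + α) (r := β) (by linarith)
    (by linarith) (by linarith) hβ1.le f.hasDerivAt f.abs_le (f.abs_deriv_sub_le (by linarith)) s
  refine ⟨h1, h2.trans_eq ?_⟩
  rw [show 2 + β - (2 + α) = β - α by ring, show 2 + α - 1 = 1 + α by ring]; ring

theorem C1Space.symLap_holder (hα0 : 0 < α) (hαβ : α < β) (hβ1 : β < 1) (f : C1Space β) (s s' : ℝ) :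
    |symLap (2 + α) f s - symLap (2 + α) f s'|
      ≤ (8 / (β - α) + 4 / α) * ‖f‖ * |s - s'| ^ (β - α) := by
  have hβ0 : 0 < β := by linarith
  have h := NMCBand.symLap_holder (p := 2 + α) (r := β) (a := 1) (by linarith) (by linarith)
    (by linarith) hβ1.le (by linarith) f.hasDerivAt f.abs_le (f.abs_deriv_sub_le hβ0)
    (fun s s' t ht => by
      rw [show 1 + β - 1 = β by ring, Real.rpow_one]
      exact abs_secondDiff_sub_le f.hasDerivAt (f.abs_deriv_sub_le hβ0) s s' ht) s s'
  rw [show 2 + β - (2 + α) = β - α by ring, show 2 + α - 1 - 1 = α by ring] at h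
  exact h.trans_eq (by ring)

theorem C1Space.symLap_mem (hα0 : 0 < α) (hαβ : α < β) (hβ1 : β < 1) (f : C1Space β) :
    symLap (2 + α) f ∈ c0Submodule (β - α) := by
  have hH : IsHolder (β - α) (symLap (2 + α) f) := ⟨_, f.symLap_holder hα0 hαβ hβ1⟩
  refine ⟨hH.continuous (by linarith), symLap_periodic f.periodic, fun s => ?_, hH⟩
  have := symLap_neg_arg (p := 2 + α) (g := f) (ε := 1) (fun x => by rw [f.even, one_mul]) s
  rwa [one_mul] at this

/-- The operator `symLap (2 + α)`, from `C^{1,β}` to `C^{0,β-α}`. -/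
def symLapCLM (hα0 : 0 < α) (hαβ : α < β) (hβ1 : β < 1) : C1Space β →L[ℝ] C0Space (β - α) :=
  LinearMap.mkContinuous
    { toFun := fun f => ⟨symLap (2 + α) f, f.symLap_mem hα0 hαβ hβ1⟩
      map_add' := fun f g => by
        refine FunSpace.ext (funext fun s => ?_)
        change symLap (2 + α) (f.val + g.val) s = symLap (2 + α) f s + symLap (2 + α) g s
        exact symLap_add (f.symLap_integrable_bound hα0 hαβ hβ1 s).1
          (g.symLap_integrable_bound hα0 hαβ hβ1 s).1
      map_smul' := fun c f => by
        exact FunSpace.ext (funext fun s => symLap_smul (2 + α) c f s) }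
    (4 / (β - α) + 4 / (1 + α) + (8 / (β - α) + 4 / α)) fun f => by
      have := C0Space.norm_le ⟨symLap (2 + α) f, f.symLap_mem hα0 hαβ hβ1⟩
        (fun s => (f.symLap_integrable_bound hα0 hαβ hβ1 s).2) (f.symLap_holder hα0 hαβ hβ1)
      exact this.trans_eq (by ring)

/-- The operator `φ ↦ Φ(0, 1, φ)` for the radius `R`; it is linear. -/
def bandOp (hα0 : 0 < α) (hαβ : α < β) (hβ1 : β < 1) {R : ℝ} (hR : 0 < R) :
    C1Space β →L[ℝ] C0Space (β - α) :=
  symLapCLM hα0 hαβ hβ1 - kernelCos α R 0 • inclCLM (sub_pos.2 hαβ) (by linarith)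
    - (convCLM (sub_pos.2 hαβ) (integrable_kernelP hα0 hR) (kernelP_neg α R)).comp
        (inclCLM (sub_pos.2 hαβ) (by linarith))

theorem bandOp_apply (hα0 : 0 < α) (hαβ : α < β) (hβ1 : β < 1) {R : ℝ} (hR : 0 < R)
    (f : C1Space β) (s : ℝ) : bandOp hα0 hαβ hβ1 hR f s
      = symLap (2 + α) f s - kernelCos α R 0 * f s - convOp (kernelP α R) f s := rfl

theorem norm_bandOp_sub_le (hα0 : 0 < α) (hαβ : α < β) (hβ1 : β < 1) {R R' : ℝ} (hR : 0 < R)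
    (hR' : 0 < R') : ‖bandOp hα0 hαβ hβ1 hR' - bandOp (β := β) hα0 hαβ hβ1 hR‖
      ≤ 4 * |kernelCos α R' 0 - kernelCos α R 0| *
        ‖inclCLM (q := β) (sub_pos.2 hαβ) (by linarith : β - α ≤ 1)‖ := by
  set ι := inclCLM (q := β) (sub_pos.2 hαβ) (by linarith : β - α ≤ 1)
  set C := convCLM (sub_pos.2 hαβ) (integrable_kernelP hα0 hR) (kernelP_neg α R)
  set C' := convCLM (sub_pos.2 hαβ) (integrable_kernelP hα0 hR') (kernelP_neg α R')
  have e : bandOp hα0 hαβ hβ1 hR' - bandOp hα0 hαβ hβ1 hR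
      = -((kernelCos α R' 0 - kernelCos α R 0) • ι + (C' - C).comp ι) := by
    simp only [bandOp, ContinuousLinearMap.sub_comp, sub_smul]
    abel
  have h1 := norm_convCLM_sub_le (sub_pos.2 hαβ) (integrable_kernelP hα0 hR') (kernelP_neg α R')
    (integrable_kernelP hα0 hR) (kernelP_neg α R)
  rw [integral_abs_kernelP_sub hα0 hR hR'] at h1
  rw [e, norm_neg]
  refine (norm_add_le _ _).trans ?_
  rw [norm_smul, Real.norm_eq_abs]
  have h2 := ((C' - C).opNorm_comp_le ι).trans (mul_le_mul_of_nonneg_right h1 (norm_nonneg ι))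
  linarith

end symLapCLM

/-! ### The nonlinear operator at `a = 0` -/

theorem phi1Integrand_zero (α : ℝ) (φ : ℝ → ℝ) (s t : ℝ) :
    phi1Integrand α 0 φ s t = (φ s - φ (s - t)) * |t| ^ (-(2 + α)) := by
  have h : ∀ q, F1 α 0 q = q := fun q => by simp [F1]
  rw [phi1Integrand, h]
  rcases eq_or_ne t 0 with rfl | ht
  · simp
  have ht' : 0 < |t| := abs_pos.2 ht
  have h1 : |t| ^ (2 + α) = |t| * |t| ^ (1 + α) := by
    rw [show 2 + α = 1 + (1 + α) by ring, Real.rpow_add ht' 1, Real.rpow_one]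
  rw [Real.rpow_neg ht'.le, h1, div_div, div_eq_mul_inv]

theorem fracLap_integrand (α : ℝ) (φ : ℝ → ℝ) (s t : ℝ) :
    (φ s - φ (s - t)) / |t| ^ (1 + 2 * ((1 + α) / 2)) = (φ s - φ (s - t)) * |t| ^ (-(2 + α)) := by
  rw [Real.rpow_neg (abs_nonneg t), show 1 + 2 * ((1 + α) / 2) = 2 + α by ring, div_eq_mul_inv]

theorem phi2Integrand_zero (α R lam : ℝ) (φ : ℝ → ℝ) (s t : ℝ) :
    phi2Integrand α R 0 lam φ s t = (φ s + φ (s - t)) * kernelP α (lam * R) t := by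
  rw [phi2Integrand, F2, kernelP_eq]
  simp only [zero_mul, add_zero, intervalIntegral.integral_const, sub_zero, one_smul]
  rw [add_comm (t ^ 2), show 2 * (lam * R) = 2 * lam * R by ring]

theorem Phi_zero_eq {α R lam r B H : ℝ} (hα0 : 0 < α) (hR : 0 < R) (hlam : 0 < lam) (hr0 : 0 ≤ r)
    (hr1 : r ≤ 1) (hαr : α < r) {φ φ' : ℝ → ℝ} (hφ : ∀ x, HasDerivAt φ (φ' x) x)
    (hB : ∀ x, |φ x| ≤ B) (hH : ∀ x y, |φ' x - φ' y| ≤ H * |x - y| ^ r) (s : ℝ) :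
    PVIntegrable (phi1Integrand α 0 φ s) ∧ Integrable (phi2Integrand α R 0 lam φ s) ∧
    Phi α R 0 lam φ s = symLap (2 + α) φ s - kernelCos α (lam * R) 0 * φ s
      - convOp (kernelP α (lam * R)) φ s := by
  have hc : Continuous φ := continuous_iff_continuousAt.2 fun x => (hφ x).continuousAt
  have hlR : 0 < lam * R := mul_pos hlam hR
  have hK := integrable_kernelP hα0 hlR
  obtain ⟨h1, h2⟩ := tendsto_pv_symLap hc hB (p := 2 + α) (by linarith) s
    (symLap_integrable_bound (by linarith) (by linarith) hr0 hr1 hφ hB hH s).1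
  have e1 : phi1Integrand α 0 φ s = fun t => (φ s - φ (s - t)) * |t| ^ (-(2 + α)) :=
    funext (phi1Integrand_zero α φ s)
  have e2 : phi2Integrand α R 0 lam φ s
      = fun t => φ s * kernelP α (lam * R) t + kernelP α (lam * R) t * φ (s - t) := by
    funext t; rw [phi2Integrand_zero]; ring
  have i2 := convOp_integrable hK hc hB s
  refine ⟨?_, ?_, ?_⟩
  · rw [e1]; exact ⟨h1, _, h2⟩
  · rw [e2]; exact (hK.const_mul _).add i2
  · rw [Phi, e1, e2, pvIntegral, h2.limUnder_eq, integral_add (hK.const_mul _) i2,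
      integral_const_mul, ← kernelCos_zero, convOp]
    ring

theorem C1Space.PhiConverges {α β R lam : ℝ} (hα0 : 0 < α) (hαβ : α < β) (hβ1 : β < 1) (hR : 0 < R)
    (hlam : 0 < lam) (f : C1Space β) : PhiConverges α R 0 lam f := fun s =>
  have h := Phi_zero_eq hα0 hR hlam (by linarith) hβ1.le hαβ f.hasDerivAt f.abs_le
    (f.abs_deriv_sub_le (by linarith)) s
  ⟨h.1, h.2.1⟩

theorem C1Space.Phi_eq {α β R lam : ℝ} (hα0 : 0 < α) (hαβ : α < β) (hβ1 : β < 1) (hR : 0 < R)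
    (hlam : 0 < lam) (f : C1Space β) :
    Phi α R 0 lam f = (bandOp hα0 hαβ hβ1 (mul_pos hlam hR) f).val := funext fun s =>
  (Phi_zero_eq hα0 hR hlam (by linarith) hβ1.le hαβ f.hasDerivAt f.abs_le
    (f.abs_deriv_sub_le (by linarith)) s).2.2

theorem PhiY_eq {α β R lam : ℝ} (hα0 : 0 < α) (hαβ : α < β) (hβ1 : β < 1) (hR : 0 < R)
    (hlam : 0 < lam) (f : C1Space β) :
    PhiY α β R 0 lam f = bandOp hα0 hαβ hβ1 (mul_pos hlam hR) f := by
  have h := f.Phi_eq hα0 hαβ hβ1 hR hlam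
  have hm : Phi α R 0 lam f ∈ c0Submodule (β - α) := h ▸ (bandOp hα0 hαβ hβ1 _ f).mem
  rw [PhiY, dif_pos hm]
  exact FunSpace.ext h

theorem linOp_eq {α β R : ℝ} (hα0 : 0 < α) (hαβ : α < β) (hβ1 : β < 1) (hR : 0 < R)
    (f : C1Space β) :
    LinOpConverges α R f ∧ ∀ s, bandOp hα0 hαβ hβ1 hR f s = linOp α R f s := by
  have hm := lapSymbol_one_pos (p := 2 + α) (by linarith) (by linarith)
  have hC : 0 < fracLapConst ((1 + α) / 2) := by rw [fracLapConst_eq]; positivity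
  have hpv := fun s => tendsto_pv_symLap f.continuous f.abs_le (p := 2 + α) (by linarith) s
    (f.symLap_integrable_bound hα0 hαβ hβ1 s).1
  have hK := integrable_kernelP hα0 hR
  refine ⟨⟨hC, fun s => ?_, hK, fun s => ?_⟩, fun s => ?_⟩
  · simp only [fracLap_integrand]
    exact ⟨(hpv s).1, _, (hpv s).2⟩
  · exact convOp_integrable hK f.continuous f.abs_le s
  · rw [bandOp_apply, linOp, fracLap]
    simp only [fracLap_integrand]
    rw [pvIntegral, (hpv s).2.limUnder_eq, inv_mul_cancel_left₀ hC.ne', ← kernelCos_zero]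
    rfl

/-- The eigenvalue of the linearized operator at `cos (ξ s)`. -/
def bandSymbol (α R ξ : ℝ) : ℝ := lapSymbol (2 + α) ξ - kernelCos α R 0 - kernelCos α R ξ

theorem bandOp_cos {α β R : ℝ} (hα0 : 0 < α) (hαβ : α < β) (hβ1 : β < 1) (hR : 0 < R)
    (hX : β ∈ Set.Icc (0 : ℝ) 1) (hY : β - α ∈ Set.Icc (0 : ℝ) 1) (k : ℕ) :
    bandOp hα0 hαβ hβ1 hR (cosC1 hX k) = bandSymbol α R k • cosC0 hY k := by
  refine FunSpace.ext (funext fun s => ?_)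
  rw [bandOp_apply]
  change symLap (2 + α) (fun s => Real.cos (k * s)) s - kernelCos α R 0 * Real.cos (k * s)
    - convOp (kernelP α R) (fun s => Real.cos (k * s)) s = bandSymbol α R k * Real.cos (k * s)
  rw [symLap_cos, convOp_cos (integrable_kernelP hα0 hR) (kernelP_neg α R), bandSymbol, kernelCos,
    kernelCos]
  ring

theorem Phi_cos {α R : ℝ} (hα0 : 0 < α) (hα1 : α < 1) (hR : 0 < R) (s : ℝ) :
    Phi α R 0 1 Real.cos s = (lapSymbol (2 + α) 1 - bandCoef α R) * Real.cos s := by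
  have h := (Phi_zero_eq (r := 1) (B := 1) (H := 1) hα0 hR one_pos zero_le_one le_rfl hα1
    Real.hasDerivAt_cos Real.abs_cos_le_one (fun x y => by
      rw [neg_sub_neg, abs_sub_comm, one_mul, Real.rpow_one]
      exact Real.abs_sin_sub_sin_le x y) s).2.2
  have e : Real.cos = fun s => Real.cos (1 * s) := by simp
  rw [h, one_mul, bandCoef_eq hα0 hR]
  have h1 := symLap_cos (2 + α) 1 s
  have h2 := convOp_cos (integrable_kernelP hα0 hR) (kernelP_neg α R) 1 s
  rw [← e, one_mul] at h1 h2
  rw [h1, h2, kernelCos, kernelCos]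
  ring

/-! ### Fourier coefficients -/

/-- The Fourier coefficient `∫ f(s) cos(ks - θ) ds` over a period. The phase `θ` treats cosine
coefficients (`θ = 0`) and sine coefficients (`θ = π / 2`) together. -/
def trigCoef (θ : ℝ) (k : ℕ) (f : ℝ → ℝ) : ℝ := ∫ s in (-π)..π, f s * Real.cos (k * s - θ)

theorem integral_period_shift {h : ℝ → ℝ} (hp : Function.Periodic h (2 * π)) (t : ℝ) :
    ∫ s in (-π)..π, h (s + t) = ∫ s in (-π)..π, h s := by
  rw [intervalIntegral.integral_comp_add_right]
  have := hp.intervalIntegral_add_eq (-π + t) (-π)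
  rwa [show -π + t + 2 * π = π + t by ring, show -π + 2 * π = π by ring] at this

theorem cos_phase_periodic (k : ℕ) (θ : ℝ) :
    Function.Periodic (fun s : ℝ => Real.cos (k * s - θ)) (2 * π) := fun s => by
  have : (k : ℝ) * (s + 2 * π) - θ = k * s - θ + k * (2 * π) := by ring
  simp only [this, Real.cos_add_nat_mul_two_pi]

theorem integral_shift_mul_cos {g : ℝ → ℝ} (hp : Function.Periodic g (2 * π)) (k : ℕ) (θ t : ℝ) :
    ∫ s in (-π)..π, g (s - t) * Real.cos (k * s - θ)
      = ∫ s in (-π)..π, g s * Real.cos (k * (s + t) - θ) := by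
  have h : Function.Periodic (fun s => g s * Real.cos (k * (s + t) - θ)) (2 * π) := fun s => by
    have h1 := cos_phase_periodic k θ (s + t)
    simp only at h1 ⊢
    rw [hp, show s + 2 * π + t = s + t + 2 * π by ring, h1]
  rw [← integral_period_shift h (-t)]
  simp only [neg_add_cancel_right, sub_eq_add_neg]

theorem trigCoef_secondDiff {g : ℝ → ℝ} (hg : Continuous g) (hp : Function.Periodic g (2 * π))
    (k : ℕ) (θ t : ℝ) : trigCoef θ k (fun s => secondDiff g s t)
      = 2 * (1 - Real.cos (k * t)) * trigCoef θ k g := by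
  have h1 := integral_shift_mul_cos hp k θ t
  have h2 := integral_shift_mul_cos hp k θ (-t)
  simp only [sub_neg_eq_add] at h2
  have i1 : IntervalIntegrable (fun s => 2 * g s * Real.cos (k * s - θ)) volume (-π) π :=
    Continuous.intervalIntegrable (by fun_prop) _ _
  have i2 : IntervalIntegrable (fun s => g (s - t) * Real.cos (k * s - θ)) volume (-π) π :=
    Continuous.intervalIntegrable (by fun_prop) _ _
  have i3 : IntervalIntegrable (fun s => g (s + t) * Real.cos (k * s - θ)) volume (-π) π :=
    Continuous.intervalIntegrable (by fun_prop) _ _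
  have i4 : IntervalIntegrable (fun s => g s * Real.cos (k * (s + t) - θ)) volume (-π) π :=
    Continuous.intervalIntegrable (by fun_prop) _ _
  have i5 : IntervalIntegrable (fun s => g s * Real.cos (k * (s + -t) - θ)) volume (-π) π :=
    Continuous.intervalIntegrable (by fun_prop) _ _
  simp only [trigCoef, secondDiff, sub_mul _ _ (Real.cos _)]
  rw [intervalIntegral.integral_sub (i1.sub i2) i3, intervalIntegral.integral_sub i1 i2, h1, h2,
    ← intervalIntegral.integral_sub i1 i4, ← intervalIntegral.integral_sub (i1.sub i4) i5,
    ← intervalIntegral.integral_const_mul]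
  refine intervalIntegral.integral_congr fun s _ => ?_
  have e1 : (k : ℝ) * (s + t) - θ = (k * s - θ) + k * t := by ring
  have e2 : (k : ℝ) * (s + -t) - θ = (k * s - θ) - k * t := by ring
  simp only [e1, e2, Real.cos_add, Real.cos_sub (k * s - θ)]
  ring

/-- `symLap` acts on Fourier coefficients as the multiplier `lapSymbol`. -/
theorem trigCoef_symLap {p r B H : ℝ} {g g' : ℝ → ℝ} (hp1 : 1 < p) (hpr : p < 2 + r) (hr0 : 0 ≤ r)
    (hr1 : r ≤ 1) (hg : ∀ x, HasDerivAt g (g' x) x) (hB : ∀ x, |g x| ≤ B)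
    (hH : ∀ x y, |g' x - g' y| ≤ H * |x - y| ^ r) (hper : Function.Periodic g (2 * π))
    (k : ℕ) (θ : ℝ) : trigCoef θ k (symLap p g) = lapSymbol p k * trigCoef θ k g := by
  have hc : Continuous g := continuous_iff_continuousAt.2 fun x => (hg x).continuousAt
  have hle : -π ≤ π := by linarith [Real.pi_pos]
  set G : ℝ → ℝ → ℝ := fun s t => secondDiff g s t * t ^ (-p) * Real.cos (k * s - θ) with hG
  have hmeas : Measurable (Function.uncurry G) := by
    refine Measurable.mul (Measurable.mul ?_ ?_) ?_
    · exact Continuous.measurable (by unfold secondDiff; fun_prop)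
    · exact measurable_snd.pow_const _
    · exact Continuous.measurable (by fun_prop)
  have hint : Integrable (Function.uncurry G) ((volume.restrict (Set.Ioc (-π) π)).prod
      (volume.restrict (Set.Ioi 0))) := by
    refine (integrable_prod_iff hmeas.aestronglyMeasurable).2 ⟨ae_of_all _ fun s => ?_, ?_⟩
    · exact Integrable.mul_const
        (symLap_integrable_bound hp1 hpr hr0 hr1 hg hB hH s).1 (Real.cos (k * s - θ))
    · refine Integrable.mono' (integrable_const (2 * H / (2 + r - p) + 4 * B / (p - 1)))
        hmeas.aestronglyMeasurable.norm.integral_prod_right' (ae_of_all _ fun s => ?_)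
      have h := integral_mul_rpow_bound (p := p) (r := r) (a := 0) (H := 2 * H) (K := 4 * B)
        (h := 1) (d := fun t => |secondDiff g s t|) hpr (by linarith) one_pos
        (secondDiff_continuous hc s).abs
        (fun t ht => by rw [abs_abs]; exact abs_secondDiff_le_rpow_add hr0 hr1 hg hH s ht)
        (fun t ht => by simpa using abs_secondDiff_le hB s t)
      rw [Real.norm_of_nonneg (integral_nonneg fun _ => norm_nonneg _)]
      refine le_trans (integral_mono_of_nonneg (ae_of_all _ fun _ => norm_nonneg _) h.1
        ((ae_restrict_iff' measurableSet_Ioi).2 (ae_of_all _ fun t ht => ?_)))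
        ((le_abs_self _).trans (h.2.trans_eq (by simp)))
      have ht0 : (0 : ℝ) < t := ht
      simp only [Function.uncurry, hG, norm_mul, Real.norm_eq_abs]
      rw [abs_of_nonneg (Real.rpow_nonneg ht0.le _)]
      exact mul_le_of_le_one_right (by positivity) (Real.abs_cos_le_one _)
  have h1 : trigCoef θ k (symLap p g)
      = ∫ s in Set.Ioc (-π) π, ∫ t in Set.Ioi 0, G s t := by
    rw [trigCoef, intervalIntegral.integral_of_le hle]
    simp only [symLap, hG, integral_mul_const]
  rw [h1, integral_integral_swap hint, lapSymbol, ← integral_mul_const]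
  refine setIntegral_congr_fun measurableSet_Ioi fun t _ => ?_
  have h2 := trigCoef_secondDiff hc hper k θ t
  rw [trigCoef, intervalIntegral.integral_of_le hle] at h2
  rw [mul_right_comm, ← h2, ← integral_mul_const]
  refine integral_congr_ae (ae_of_all _ fun s => ?_)
  simp only [hG]; ring

/-- Convolution with an even kernel acts on Fourier coefficients as a multiplier. -/
theorem trigCoef_convOp {K f : ℝ → ℝ} {B : ℝ} (hK : Integrable K) (hKe : ∀ t, K (-t) = K t)
    (hf : Continuous f) (hB : ∀ x, |f x| ≤ B) (hper : Function.Periodic f (2 * π)) (k : ℕ) (θ : ℝ) :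
    trigCoef θ k (convOp K f) = (∫ t, K t * Real.cos (k * t)) * trigCoef θ k f := by
  have hle : -π ≤ π := by linarith [Real.pi_pos]
  set G : ℝ → ℝ → ℝ := fun s t => K t * f (s - t) * Real.cos (k * s - θ) with hG
  have hint : Integrable (Function.uncurry G)
      ((volume.restrict (Set.Ioc (-π) π)).prod volume) := by
    have h0 := (integrable_const (μ := volume.restrict (Set.Ioc (-π) π)) (1 : ℝ)).mul_prod hK
    have h1 := h0.mul_bdd (c := B) (g := fun z : ℝ × ℝ => f (z.1 - z.2))
      (by fun_prop : Continuous fun z : ℝ × ℝ => f (z.1 - z.2)).aestronglyMeasurable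
      (ae_of_all _ fun z => hB _)
    have h2 := h1.mul_bdd (c := 1) (g := fun z : ℝ × ℝ => Real.cos (k * z.1 - θ))
      (by fun_prop : Continuous fun z : ℝ × ℝ => Real.cos (k * z.1 - θ)).aestronglyMeasurable
      (ae_of_all _ fun z => Real.abs_cos_le_one _)
    refine h2.congr (ae_of_all _ fun z => ?_)
    simp [Function.uncurry, hG]
  have h1 : trigCoef θ k (convOp K f) = ∫ s in Set.Ioc (-π) π, ∫ t, G s t := by
    rw [trigCoef, intervalIntegral.integral_of_le hle]
    simp only [convOp, hG, integral_mul_const]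
  have hinner : ∀ t, ∫ s in Set.Ioc (-π) π, G s t
      = K t * ∫ s in (-π)..π, f s * Real.cos (k * (s + t) - θ) := fun t => by
    rw [← integral_shift_mul_cos hper, intervalIntegral.integral_of_le hle, ← integral_const_mul]
    simp only [hG, mul_assoc]
  have hsplit : ∀ t, ∫ s in (-π)..π, f s * Real.cos (k * (s + t) - θ)
      = Real.cos (k * t) * trigCoef θ k f
        - Real.sin (k * t) * ∫ s in (-π)..π, f s * Real.sin (k * s - θ) := fun t => by
    rw [trigCoef, ← intervalIntegral.integral_const_mul, ← intervalIntegral.integral_const_mul,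
      ← intervalIntegral.integral_sub (Continuous.intervalIntegrable (by fun_prop) _ _)
        (Continuous.intervalIntegrable (by fun_prop) _ _)]
    refine intervalIntegral.integral_congr fun s _ => ?_
    have e : (k : ℝ) * (s + t) - θ = (k * s - θ) + k * t := by ring
    simp only [e, Real.cos_add]; ring
  have hsin : ∫ t, K t * Real.sin (k * t) = 0 := by
    have h := integral_neg_eq_self (fun t => K t * Real.sin (k * t)) volume
    simp only [hKe, mul_neg, Real.sin_neg, integral_neg] at h
    linarith
  have hi : Integrable fun t => K t * Real.sin (k * t) :=
    hK.mul_bdd (c := 1) (by fun_prop : Continuous fun t => Real.sin (k * t)).aestronglyMeasurable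
      (ae_of_all _ fun t => Real.abs_sin_le_one _)
  rw [h1, integral_integral_swap hint]
  simp only [hinner, hsplit, mul_sub, ← mul_assoc]
  rw [integral_sub ((integrable_mul_cos hK k).mul_const _) (hi.mul_const _), integral_mul_const,
    integral_mul_const, hsin, zero_mul, sub_zero]

theorem trigCoef_deriv {u v : ℝ → ℝ} (hu : ∀ x, HasDerivAt u (v x) x) (hv : Continuous v)
    (hper : Function.Periodic u (2 * π)) (k : ℕ) (θ : ℝ) :
    trigCoef θ k v = k * trigCoef (θ + π / 2) k u := by
  have hc : Continuous u := continuous_iff_continuousAt.2 fun x => (hu x).continuousAt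
  have hd : ∀ x : ℝ, HasDerivAt (fun s => Real.cos (k * s - θ)) (-(k * Real.sin (k * x - θ))) x :=
    fun x => by
    have := (((hasDerivAt_id x).const_mul (k : ℝ)).sub_const θ).cos
    convert! this using 1
    simp; ring
  have h := intervalIntegral.integral_mul_deriv_eq_deriv_mul (a := -π) (b := π)
    (u := fun s => Real.cos (k * s - θ)) (u' := fun x => -(k * Real.sin (k * x - θ))) (v := u)
    (v' := v) (fun x _ => hd x) (fun x _ => hu x)
    (Continuous.intervalIntegrable (by fun_prop) _ _) (hv.intervalIntegrable _ _)
  have h1 : u (-π) = u π := by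
    have := hper (-π); rw [← this]; congr 1; ring
  have h2 : Real.cos (k * -π - θ) = Real.cos (k * π - θ) := by
    have := cos_phase_periodic k θ (-π)
    simp only at this
    rw [← this]; congr 2; ring
  rw [h1, h2, sub_self, zero_sub, ← intervalIntegral.integral_neg] at h
  rw [trigCoef, trigCoef, ← intervalIntegral.integral_const_mul]
  refine Eq.trans ?_ (h.trans ?_)
  · exact intervalIntegral.integral_congr fun s _ => mul_comm _ _
  · refine intervalIntegral.integral_congr fun s _ => ?_
    have e : (k : ℝ) * s - (θ + π / 2) = (k * s - θ) - π / 2 := by ring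
    simp only [e, Real.cos_sub_pi_div_two]; ring

theorem trigCoef_neg_pi (k : ℕ) (f : ℝ → ℝ) : trigCoef (-π) k f = -trigCoef 0 k f := by
  rw [trigCoef, trigCoef, ← intervalIntegral.integral_neg]
  refine intervalIntegral.integral_congr fun s _ => ?_
  simp only [sub_neg_eq_add, Real.cos_add_pi, sub_zero]; ring

theorem integral_cos_int_mul {n : ℤ} (hn : n ≠ 0) : ∫ s in (-π)..π, Real.cos (n * s) = 0 := by
  have hn' : (n : ℝ) ≠ 0 := by exact_mod_cast hn
  rw [intervalIntegral.integral_comp_mul_left _ hn', integral_cos, mul_neg, Real.sin_neg,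
    Real.sin_int_mul_pi]
  simp

theorem trigCoef_cos (j k : ℕ) : trigCoef 0 k (fun s => Real.cos (j * s))
    = if j = k then (if k = 0 then 2 * π else π) else 0 := by
  have e : ∀ s : ℝ, Real.cos (j * s) * Real.cos (k * s - 0)
      = 1 / 2 * (Real.cos (((j - k : ℤ) : ℝ) * s) + Real.cos (((j + k : ℤ) : ℝ) * s)) := fun s => by
    push_cast
    rw [sub_zero, sub_mul, add_mul, Real.cos_sub, Real.cos_add]; ring
  simp only [trigCoef, e]
  rw [intervalIntegral.integral_const_mul, intervalIntegral.integral_add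
    (Continuous.intervalIntegrable (by fun_prop) _ _)
    (Continuous.intervalIntegrable (by fun_prop) _ _)]
  have h0 : ∀ n : ℤ, n = 0 → ∫ s in (-π)..π, Real.cos (n * s) = 2 * π := fun n hn => by
    subst hn; simp; ring
  by_cases hjk : j = k
  · subst hjk
    rw [if_pos rfl, h0 _ (sub_self _)]
    by_cases hj : j = 0
    · subst hj
      rw [if_pos rfl, h0 _ (by simp)]; ring
    · rw [if_neg hj, integral_cos_int_mul (by omega)]; ring
  · rw [if_neg hjk, integral_cos_int_mul (by omega), integral_cos_int_mul (by omega)]; ring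

/-- An even periodic continuous function is determined by its cosine coefficients. -/
theorem eq_zero_of_trigCoef {f : ℝ → ℝ} (hf : Continuous f) (hp : Function.Periodic f (2 * π))
    (he : Function.Even f) (h : ∀ k, trigCoef 0 k f = 0) : f = 0 := by
  have : Fact (0 < 2 * π) := ⟨Real.two_pi_pos⟩
  have hp' : Function.Periodic (fun s => (f s : ℂ)) (2 * π) := fun s => by simp only [hp s]
  have hcont : Continuous hp'.lift := by
    refine continuous_coinduced_dom.2 ?_
    exact Complex.continuous_ofReal.comp hf
  set g : C(AddCircle (2 * π), ℂ) := ⟨hp'.lift, hcont⟩ with hg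
  have hsin : ∀ n : ℤ, ∫ s in (-π)..π, f s * Real.sin (n * s) = 0 := fun n => by
    have h1 := intervalIntegral.integral_comp_neg (a := -π) (b := π)
      (fun s => f s * Real.sin (n * s))
    simp only [he _, mul_neg, Real.sin_neg, neg_neg, intervalIntegral.integral_neg] at h1
    linarith
  have hcos : ∀ n : ℤ, ∫ s in (-π)..π, f s * Real.cos (n * s) = 0 := fun n => by
    have h1 := h n.natAbs
    rw [trigCoef] at h1
    rw [← h1]
    refine intervalIntegral.integral_congr fun s _ => ?_
    have : ((n.natAbs : ℕ) : ℝ) = |(n : ℝ)| := by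
      rw [Nat.cast_natAbs, Int.cast_abs]
    simp only [sub_zero, this]
    congr 1
    rcases abs_choice (n : ℝ) with h2 | h2 <;> rw [h2]
    rw [neg_mul, Real.cos_neg]
  have hcoef : ∀ n : ℤ, fourierCoeff g n = 0 := fun n => by
    rw [fourierCoeff_eq_intervalIntegral _ _ (-π), show -π + 2 * π = π by ring]
    have e : ∀ s : ℝ, (fourier (-n) (s : AddCircle (2 * π)) : ℂ) • g (s : AddCircle (2 * π))
        = ((f s * Real.cos (n * s) : ℝ) : ℂ) - ((f s * Real.sin (n * s) : ℝ) : ℂ) * Complex.I := by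
      intro s
      have h1 : g (s : AddCircle (2 * π)) = f s := hp'.lift_coe s
      have h2 : 2 * (π : ℂ) * Complex.I * ((-n : ℤ) : ℂ) * (s : ℂ) / ((2 * π : ℝ) : ℂ)
          = ((-(n * s) : ℝ) : ℂ) * Complex.I := by
        have : (π : ℂ) ≠ 0 := by exact_mod_cast Real.pi_ne_zero
        push_cast
        field_simp
      rw [h1, fourier_coe_apply, h2, Complex.exp_mul_I, ← Complex.ofReal_cos, ← Complex.ofReal_sin,
        Real.cos_neg, Real.sin_neg, smul_eq_mul]
      push_cast; ring
    simp only [e]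
    rw [intervalIntegral.integral_sub, intervalIntegral.integral_mul_const,
      intervalIntegral.integral_ofReal, intervalIntegral.integral_ofReal, hcos, hsin]
    · simp
    · exact Continuous.intervalIntegrable (by fun_prop) _ _
    · exact Continuous.intervalIntegrable (by fun_prop) _ _
  have hz : fourierCoeff g = 0 := funext hcoef
  have hsum : Summable (fourierCoeff g) := by rw [hz]; exact summable_zero
  funext s
  have h1 := has_pointwise_sum_fourier_series_of_summable hsum (s : AddCircle (2 * π))
  rw [hz] at h1
  simp only [Pi.zero_apply, zero_smul] at h1
  have h2 := h1.unique hasSum_zero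
  have h3 : g (s : AddCircle (2 * π)) = f s := hp'.lift_coe s
  rw [h3] at h2
  exact_mod_cast h2

theorem abs_trigCoef_le {B : ℝ} {f : ℝ → ℝ} (hB : ∀ x, |f x| ≤ B) (θ : ℝ) (k : ℕ) :
    |trigCoef θ k f| ≤ B * (2 * π) := by
  have := intervalIntegral.norm_integral_le_of_norm_le_const (a := -π) (b := π) (C := B)
    (f := fun s => f s * Real.cos (k * s - θ)) fun s _ => by
      rw [norm_mul]
      exact (mul_le_of_le_one_right (norm_nonneg _) (Real.abs_cos_le_one _)).trans (hB s)
  rwa [show |π - -π| = 2 * π by rw [sub_neg_eq_add, abs_of_pos (by positivity)]; ring] at this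

theorem trigCoef_add {f g : ℝ → ℝ} (hf : Continuous f) (hg : Continuous g) (θ : ℝ) (k : ℕ) :
    trigCoef θ k (f + g) = trigCoef θ k f + trigCoef θ k g := by
  simp only [trigCoef, Pi.add_apply, add_mul]
  exact intervalIntegral.integral_add (Continuous.intervalIntegrable (by fun_prop) _ _)
    (Continuous.intervalIntegrable (by fun_prop) _ _)

theorem trigCoef_smul (c : ℝ) (f : ℝ → ℝ) (θ : ℝ) (k : ℕ) :
    trigCoef θ k (c • f) = c * trigCoef θ k f := by
  simp only [trigCoef, Pi.smul_apply, smul_eq_mul, mul_assoc, intervalIntegral.integral_const_mul]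

/-- The cosine coefficients, as bounded functionals on `C^{0,r}`. -/
def coefCLM (r : ℝ) (k : ℕ) : C0Space r →L[ℝ] ℝ :=
  LinearMap.mkContinuous
    { toFun := fun f => trigCoef 0 k f
      map_add' := fun f g => trigCoef_add f.continuous g.continuous 0 k
      map_smul' := fun c f => trigCoef_smul c f 0 k } (2 * π) fun f => by
    rw [mul_comm]; exact abs_trigCoef_le f.abs_le 0 k

theorem coefCLM_apply (r : ℝ) (k : ℕ) (f : C0Space r) : coefCLM r k f = trigCoef 0 k f := rfl

theorem C0Space.ext_coef {r : ℝ} {f g : C0Space r} (h : ∀ k, coefCLM r k f = coefCLM r k g) :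
    f = g := by
  rw [← sub_eq_zero]
  refine FunSpace.ext (eq_zero_of_trigCoef (f - g).continuous (f - g).periodic (f - g).even
    fun k => ?_)
  rw [← coefCLM_apply, map_sub, h, sub_self]

theorem coefCLM_cosC0 {r : ℝ} (hr : r ∈ Set.Icc (0 : ℝ) 1) (j k : ℕ) : coefCLM r k (cosC0 hr j)
    = if j = k then (if k = 0 then 2 * π else π) else 0 := trigCoef_cos j k

/-- Orthogonality to `cos` on `(0, π)` is the vanishing of the first cosine coefficient. -/
theorem mem_X2_iff {r : ℝ} (f : C1Space r) : f ∈ X2 r ↔ trigCoef 0 1 f = 0 := by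
  have h : trigCoef 0 1 f = 2 * ∫ s in (0 : ℝ)..π, f s * Real.cos s := by
    have hi : ∀ a b, IntervalIntegrable (fun s => f s * Real.cos s) volume a b := fun a b =>
      Continuous.intervalIntegrable (by have := f.continuous; fun_prop) _ _
    have h1 := intervalIntegral.integral_comp_neg (a := 0) (b := π) (fun s => f s * Real.cos s)
    simp only [f.even _, Real.cos_neg, neg_zero] at h1
    simp only [trigCoef, Nat.cast_one, one_mul, sub_zero]
    rw [← intervalIntegral.integral_add_adjacent_intervals (hi (-π) 0) (hi 0 π), ← h1]; ring
  rw [h]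
  constructor
  · intro hf
    have hf' : ∫ s in (0 : ℝ)..π, f s * Real.cos s = 0 := hf
    rw [hf', mul_zero]
  · intro hf
    exact (mul_eq_zero.1 hf).resolve_left two_ne_zero

/-- The linearized operator is diagonal in the cosine basis. -/
theorem coefCLM_bandOp {α β R : ℝ} (hα0 : 0 < α) (hαβ : α < β) (hβ1 : β < 1) (hR : 0 < R)
    (f : C1Space β) (k : ℕ) : coefCLM (β - α) k (bandOp hα0 hαβ hβ1 hR f)
      = bandSymbol α R k * trigCoef 0 k f := by
  rw [bandOp, sub_apply, sub_apply, map_sub, map_sub,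
    smul_apply, map_smul, smul_eq_mul]
  have h1 : coefCLM (β - α) k (symLapCLM hα0 hαβ hβ1 f) = _ :=
    trigCoef_symLap (p := 2 + α) (by linarith) (by linarith) (by linarith) hβ1.le f.hasDerivAt
      f.abs_le (f.abs_deriv_sub_le (by linarith)) f.periodic k 0
  have h2 : coefCLM (β - α) k ((convCLM (sub_pos.2 hαβ) (integrable_kernelP hα0 hR)
      (kernelP_neg α R)).comp (inclCLM (sub_pos.2 hαβ) (by linarith)) f) = _ :=
    trigCoef_convOp (integrable_kernelP hα0 hR) (kernelP_neg α R) f.continuous f.abs_le f.periodic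
      k 0
  have h3 : coefCLM (β - α) k (inclCLM (sub_pos.2 hαβ) (by linarith) f) = trigCoef 0 k f := rfl
  rw [h1, h2, h3, bandSymbol]
  unfold kernelCos
  ring

/-! ### Inverting the principal part -/

theorem hasDerivAt_primitive {w : ℝ → ℝ} (hw : Continuous w) (x : ℝ) :
    HasDerivAt (fun s => ∫ t in (0 : ℝ)..s, w t) (w x) x :=
  intervalIntegral.integral_hasDerivAt_right (hw.intervalIntegrable _ _)
    hw.aestronglyMeasurable.stronglyMeasurableAtFilter hw.continuousAt

theorem primitive_periodic {w : ℝ → ℝ} (hw : Continuous w) (hp : Function.Periodic w (2 * π))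
    (h0 : ∫ t in (-π)..π, w t = 0) : Function.Periodic (fun s => ∫ t in (0 : ℝ)..s, w t) (2 * π) := by
  intro s
  beta_reduce
  have h1 := hp.intervalIntegral_add_eq s (-π)
  rw [show -π + 2 * π = π by ring, h0] at h1
  rw [← intervalIntegral.integral_add_adjacent_intervals (hw.intervalIntegrable 0 s)
    (hw.intervalIntegrable s (s + 2 * π)), h1, add_zero]

/-- The primitive has the opposite parity. -/
theorem primitive_neg {w : ℝ → ℝ} {ε : ℝ} (hε : ∀ x, w (-x) = ε * w x) (s : ℝ) :
    ∫ t in (0 : ℝ)..(-s), w t = -ε * ∫ t in (0 : ℝ)..s, w t := by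
  have h := intervalIntegral.integral_comp_neg (a := 0) (b := s) w
  simp only [hε, neg_zero, intervalIntegral.integral_const_mul] at h
  rw [intervalIntegral.integral_symm, ← h]; ring

theorem integral_odd_eq_zero {w : ℝ → ℝ} (hw : ∀ x, w (-x) = -1 * w x) :
    ∫ t in (-π)..π, w t = 0 := by
  have h := intervalIntegral.integral_comp_neg (a := -π) (b := π) w
  simp only [hw, neg_neg, intervalIntegral.integral_const_mul] at h
  linarith

namespace C0Space

section

variable {r : ℝ} (f g : C0Space r)

/-- The mean of `f` over a period. -/
def mean : ℝ := (2 * π)⁻¹ * coefCLM r 0 f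

theorem abs_mean_le : |f.mean| ≤ ‖f‖ := by
  have h := abs_trigCoef_le f.abs_le 0 0
  rw [mean, abs_mul, abs_of_pos (by positivity), inv_mul_le_iff₀ (by positivity)]
  rw [mul_comm] at h
  exact h

/-- The periodic primitive of `f - mean f`. -/
def prim (s : ℝ) : ℝ := ∫ x in (0 : ℝ)..s, (f x - f.mean)

theorem continuous_sub_mean : Continuous fun x => f x - f.mean := f.continuous.sub continuous_const

theorem hasDerivAt_prim (x : ℝ) : HasDerivAt f.prim (f x - f.mean) x :=
  hasDerivAt_primitive f.continuous_sub_mean x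

theorem prim_periodic : Function.Periodic f.prim (2 * π) := by
  refine primitive_periodic f.continuous_sub_mean (fun x => by simp only [f.periodic x]) ?_
  have h : coefCLM r 0 f = ∫ t in (-π)..π, f t := by simp [coefCLM_apply, trigCoef]
  rw [intervalIntegral.integral_sub (f.continuous.intervalIntegrable _ _)
    intervalIntegrable_const, intervalIntegral.integral_const, smul_eq_mul, mean, ← h]
  have := Real.pi_pos
  field_simp
  ring

theorem prim_neg (s : ℝ) : f.prim (-s) = -1 * f.prim s :=
  primitive_neg (w := fun x => f x - f.mean) (ε := 1) (fun x => by simp only [f.even x, one_mul]) s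

theorem abs_prim_le (s : ℝ) : |f.prim s| ≤ 4 * π * ‖f‖ := by
  obtain ⟨y, hy, hsy⟩ := f.prim_periodic.exists_mem_Ico₀ Real.two_pi_pos s
  rw [hsy]
  have h := intervalIntegral.norm_integral_le_of_norm_le_const (a := 0) (b := y) (C := 2 * ‖f‖)
    (f := fun x => f x - f.mean) fun x _ =>
      (abs_sub _ _).trans (by linarith [f.abs_le x, f.abs_mean_le])
  refine h.trans ?_
  rw [sub_zero, abs_of_nonneg hy.1]
  nlinarith [hy.2, norm_nonneg f]

theorem abs_sub_mean_sub_le (hr : 0 < r) (x y : ℝ) :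
    |(f x - f.mean) - (f y - f.mean)| ≤ 2 * ‖f‖ * |x - y| ^ r := by
  rw [sub_sub_sub_cancel_right]; exact f.abs_sub_le hr x y

theorem mean_add : (f + g).mean = f.mean + g.mean := by rw [mean, map_add, mul_add]; rfl

theorem mean_smul (c : ℝ) : (c • f).mean = c * f.mean := by
  rw [mean, map_smul, smul_eq_mul, mul_left_comm]; rfl

theorem prim_add : (f + g).prim = f.prim + g.prim := by
  funext s
  have h := intervalIntegral.integral_add (f.continuous_sub_mean.intervalIntegrable 0 s)
    (g.continuous_sub_mean.intervalIntegrable 0 s) (μ := volume)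
  refine Eq.trans ?_ h
  refine intervalIntegral.integral_congr fun x _ => ?_
  rw [mean_add]
  change f x + g x - _ = _
  ring

theorem prim_smul (c : ℝ) : (c • f).prim = c • f.prim := by
  funext s
  refine Eq.trans ?_ (intervalIntegral.integral_const_mul c _)
  refine intervalIntegral.integral_congr fun x _ => ?_
  rw [mean_smul]
  change c * f x - _ = _
  ring

end

section

variable {α β : ℝ}

theorem symLap_prim_integrable_bound (hα0 : 0 < α) (hαβ : α < β)
    (hβ1 : β < 1) (f : C0Space (β - α)) (s : ℝ) :
    IntegrableOn (fun t => secondDiff f.prim s t * t ^ (-(2 - α))) (Set.Ioi 0) ∧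
      |symLap (2 - α) f.prim s| ≤ (4 / β + 16 * π / (1 - α)) * ‖f‖ := by
  obtain ⟨h1, h2⟩ := symLap_integrable_bound (p := 2 - α) (r := β - α) (by linarith) (by linarith)
    (by linarith) (by linarith) f.hasDerivAt_prim f.abs_prim_le
    (f.abs_sub_mean_sub_le (by linarith)) s
  refine ⟨h1, h2.trans_eq ?_⟩
  rw [show 2 + (β - α) - (2 - α) = β by ring, show 2 - α - 1 = 1 - α by ring]; ring

theorem symLap_prim_holder (hα0 : 0 < α) (hαβ : α < β)
    (hβ1 : β < 1) (f : C0Space (β - α)) (s s' : ℝ) :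
    |symLap (2 - α) f.prim s - symLap (2 - α) f.prim s'|
      ≤ (8 / β + 4 / (1 - β)) * ‖f‖ * |s - s'| ^ β := by
  have h := symLap_holder (p := 2 - α) (r := β - α) (a := β - α) (by linarith) (by linarith)
    (by linarith) (by linarith) (by linarith) f.hasDerivAt_prim f.abs_prim_le
    (f.abs_sub_mean_sub_le (by linarith)) (fun s s' t ht => by
      rw [show 1 + (β - α) - (β - α) = 1 by ring, Real.rpow_one]
      exact abs_secondDiff_sub_le' f.hasDerivAt_prim (f.abs_sub_mean_sub_le (by linarith)) s s' ht)
    s s'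
  rw [show 2 + (β - α) - (2 - α) = β by ring, show 2 - α - 1 - (β - α) = 1 - β by ring] at h
  exact h.trans_eq (by ring)

theorem continuous_symLap_prim (hα0 : 0 < α) (hαβ : α < β)
    (hβ1 : β < 1) (f : C0Space (β - α)) : Continuous (symLap (2 - α) f.prim) :=
  IsHolder.continuous (r := β) (by linarith) ⟨_, f.symLap_prim_holder hα0 hαβ hβ1⟩

theorem hasDerivAt_invLap (hα0 : 0 < α) (hαβ : α < β)
    (hβ1 : β < 1) (f : C0Space (β - α)) (s : ℝ) :
    HasDerivAt (fun s => ∫ t in (0 : ℝ)..s, symLap (2 - α) f.prim t) (symLap (2 - α) f.prim s) s :=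
  hasDerivAt_primitive (f.continuous_symLap_prim hα0 hαβ hβ1) s

theorem deriv_invLap (hα0 : 0 < α) (hαβ : α < β)
    (hβ1 : β < 1) (f : C0Space (β - α)) :
    deriv (fun s => ∫ t in (0 : ℝ)..s, symLap (2 - α) f.prim t) = symLap (2 - α) f.prim :=
  funext fun s => (f.hasDerivAt_invLap hα0 hαβ hβ1 s).deriv

theorem invLap_mem (hα0 : 0 < α) (hαβ : α < β)
    (hβ1 : β < 1) (f : C0Space (β - α)) :
    (fun s => ∫ t in (0 : ℝ)..s, symLap (2 - α) f.prim t) ∈ c1Submodule β := by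
  have hc := f.continuous_symLap_prim hα0 hαβ hβ1
  have hodd := fun s => symLap_neg_arg (p := 2 - α) f.prim_neg s
  refine ⟨?_, ?_, fun s => ?_, ?_⟩
  · rw [contDiff_one_iff_deriv, f.deriv_invLap hα0 hαβ hβ1]
    exact ⟨fun s => (f.hasDerivAt_invLap hα0 hαβ hβ1 s).differentiableAt, hc⟩
  · exact primitive_periodic hc (symLap_periodic f.prim_periodic) (integral_odd_eq_zero hodd)
  · beta_reduce
    rw [primitive_neg hodd, neg_neg, one_mul]
  · rw [f.deriv_invLap hα0 hαβ hβ1]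
    exact ⟨_, f.symLap_prim_holder hα0 hαβ hβ1⟩

end

end C0Space

/-- An inverse of the principal part `symLap (2 + α)`, up to a constant factor and on functions
modulo constants: `|ξ| ^ (-(1 + α))` is `|ξ| ^ (1 - α)` divided by `ξ ^ 2`, so one takes two
primitives and applies `symLap (2 - α)` in between. -/
def invLapCLM {α β : ℝ} (hα0 : 0 < α) (hαβ : α < β) (hβ1 : β < 1) :
    C0Space (β - α) →L[ℝ] C1Space β :=
  LinearMap.mkContinuous
    { toFun := fun f => ⟨fun s => ∫ t in (0 : ℝ)..s, symLap (2 - α) f.prim t,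
        f.invLap_mem hα0 hαβ hβ1⟩
      map_add' := fun f g => by
        refine FunSpace.ext (funext fun s => ?_)
        refine Eq.trans ?_ (intervalIntegral.integral_add
          ((f.continuous_symLap_prim hα0 hαβ hβ1).intervalIntegrable 0 s)
          ((g.continuous_symLap_prim hα0 hαβ hβ1).intervalIntegrable 0 s))
        refine intervalIntegral.integral_congr fun x _ => ?_
        rw [C0Space.prim_add]
        exact symLap_add (f.symLap_prim_integrable_bound hα0 hαβ hβ1 x).1
          (g.symLap_prim_integrable_bound hα0 hαβ hβ1 x).1
      map_smul' := fun c f => by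
        refine FunSpace.ext (funext fun s => ?_)
        refine Eq.trans ?_ (intervalIntegral.integral_const_mul c _)
        refine intervalIntegral.integral_congr fun x _ => ?_
        rw [C0Space.prim_smul, symLap_smul] }
    ((4 / β + 16 * π / (1 - α)) * π + (4 / β + 16 * π / (1 - α)) + (8 / β + 4 / (1 - β)))
    fun f => by
      have hα1 : 0 < 1 - α := by linarith
      have hβ0 : 0 < β := by linarith
      have h := C1Space.norm_le (B := (4 / β + 16 * π / (1 - α)) * ‖f‖ * π)
        ⟨fun s => ∫ t in (0 : ℝ)..s, symLap (2 - α) f.prim t, f.invLap_mem hα0 hαβ hβ1⟩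
        (fun s hs => by
          have := intervalIntegral.norm_integral_le_of_norm_le_const (a := 0) (b := s)
            (f := symLap (2 - α) f.prim)
            fun x _ => (f.symLap_prim_integrable_bound hα0 hαβ hβ1 x).2
          refine le_trans this (mul_le_mul_of_nonneg_left ?_ (by positivity))
          rw [sub_zero, abs_of_nonneg hs.1]; exact hs.2)
        (fun s => by
          rw [f.deriv_invLap hα0 hαβ hβ1]; exact (f.symLap_prim_integrable_bound hα0 hαβ hβ1 s).2)
        (fun s s' => by
          rw [f.deriv_invLap hα0 hαβ hβ1]; exact f.symLap_prim_holder hα0 hαβ hβ1 s s')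
      exact h.trans_eq (by ring)

theorem trigCoef_invLapCLM {α β : ℝ} (hα0 : 0 < α) (hαβ : α < β) (hβ1 : β < 1)
    (f : C0Space (β - α)) {k : ℕ} (hk : k ≠ 0) :
    (k : ℝ) ^ 2 * trigCoef 0 k (invLapCLM hα0 hαβ hβ1 f)
      = -(lapSymbol (2 - α) k * coefCLM (β - α) k f) := by
  have h1 := trigCoef_deriv (f.hasDerivAt_invLap hα0 hαβ hβ1)
    (f.continuous_symLap_prim hα0 hαβ hβ1) (invLapCLM hα0 hαβ hβ1 f).periodic k (-(π / 2))
  have h2 := trigCoef_symLap (p := 2 - α) (r := β - α) (by linarith) (by linarith) (by linarith)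
    (by linarith) f.hasDerivAt_prim f.abs_prim_le (f.abs_sub_mean_sub_le (by linarith))
    f.prim_periodic k (-(π / 2))
  have h3 := trigCoef_deriv f.hasDerivAt_prim f.continuous_sub_mean f.prim_periodic k (-π)
  have h4 : trigCoef (-π) k (fun x => f x - f.mean) = -coefCLM (β - α) k f := by
    have e : (fun x => f x - f.mean) = f.val + (-f.mean) • fun s : ℝ => Real.cos ((0 : ℕ) * s) := by
      funext x; simp [sub_eq_add_neg]
    rw [trigCoef_neg_pi, e, trigCoef_add f.continuous (by fun_prop), trigCoef_smul, trigCoef_cos,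
      if_neg (Ne.symm hk), mul_zero, add_zero]
    rfl
  rw [neg_add_cancel] at h1
  rw [show -π + π / 2 = -(π / 2) by ring, h4] at h3
  have h5 : trigCoef 0 k (invLapCLM hα0 hαβ hβ1 f)
    = trigCoef 0 k (fun s => ∫ t in (0 : ℝ)..s, symLap (2 - α) f.prim t) := rfl
  rw [h5]
  linear_combination (-(k : ℝ)) * h1 + (k : ℝ) * h2 - lapSymbol (2 - α) k * h3

/-! ### Multipliers with summable coefficients -/

/-- An absolutely summable multiplier that vanishes at frequency `0` is convolution with the sum of
its cosine series over one period. -/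
theorem exists_kernel_of_summable {ρ : ℕ → ℝ} (hρ : Summable fun k => |ρ k|) (hρ0 : ρ 0 = 0) :
    ∃ K : ℝ → ℝ, Integrable K ∧ (∀ t, K (-t) = K t) ∧
      ∀ k : ℕ, ∫ t, K t * Real.cos (k * t) = ρ k := by
  have hle : -π ≤ π := by linarith [Real.pi_pos]
  set N : ℝ → ℝ := fun t => ∑' j : ℕ, ρ j * Real.cos (j * t) with hN
  have hb : ∀ (j : ℕ) (t : ℝ), ‖ρ j * Real.cos (j * t)‖ ≤ |ρ j| := fun j t => by
    rw [norm_mul]; exact mul_le_of_le_one_right (norm_nonneg _) (Real.abs_cos_le_one _)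
  have hNc : Continuous N := continuous_tsum (fun j => by fun_prop) hρ hb
  refine ⟨(Set.Icc (-π) π).indicator fun t => π⁻¹ * N t, ?_, fun t => ?_, fun k => ?_⟩
  · rw [integrable_indicator_iff measurableSet_Icc]
    exact (continuous_const.mul hNc).continuousOn.integrableOn_Icc
  · have h1 : -t ∈ Set.Icc (-π) π ↔ t ∈ Set.Icc (-π) π :=
      ⟨fun h => ⟨by linarith [h.2], by linarith [h.1]⟩, fun h => ⟨by linarith [h.2], by linarith [h.1]⟩⟩
    by_cases ht : t ∈ Set.Icc (-π) π
    · rw [Set.indicator_of_mem ht, Set.indicator_of_mem (h1.2 ht)]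
      simp only [hN, mul_neg, Real.cos_neg]
    · rw [Set.indicator_of_notMem ht, Set.indicator_of_notMem (mt h1.1 ht)]
  · have e : ∀ t, (Set.Icc (-π) π).indicator (fun t => π⁻¹ * N t) t * Real.cos (k * t)
        = (Set.Icc (-π) π).indicator (fun t => π⁻¹ * N t * Real.cos (k * t)) t := fun t => by
      by_cases ht : t ∈ Set.Icc (-π) π
      · rw [Set.indicator_of_mem ht, Set.indicator_of_mem ht]
      · rw [Set.indicator_of_notMem ht, Set.indicator_of_notMem ht, zero_mul]
    simp only [e]
    rw [integral_indicator measurableSet_Icc, integral_Icc_eq_integral_Ioc,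
      ← intervalIntegral.integral_of_le hle]
    have hsum : HasSum (fun j => ∫ t in (-π)..π, ρ j * Real.cos (j * t) * Real.cos (k * t))
        (∫ t in (-π)..π, N t * Real.cos (k * t)) := by
      refine intervalIntegral.hasSum_integral_of_dominated_convergence (fun j _ => |ρ j|)
        (fun j => (by fun_prop : Continuous fun t : ℝ =>
          ρ j * Real.cos (j * t) * Real.cos (k * t)).aestronglyMeasurable)
        (fun j => ae_of_all _ fun t _ => ?_) (ae_of_all _ fun t _ => hρ) (by simp)
        (ae_of_all _ fun t _ => ?_)
      · rw [norm_mul]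
        exact (mul_le_of_le_one_right (norm_nonneg _) (Real.abs_cos_le_one _)).trans (hb j t)
      · exact (Summable.of_norm_bounded hρ fun j => hb j t).hasSum.mul_right _
    have hterm : ∀ j : ℕ, ∫ t in (-π)..π, ρ j * Real.cos (j * t) * Real.cos (k * t)
        = if j = k then π * ρ k else 0 := fun j => by
      have := trigCoef_cos j k
      simp only [trigCoef, sub_zero] at this
      simp only [mul_assoc]
      rw [intervalIntegral.integral_const_mul, this]
      by_cases hjk : j = k
      · subst hjk
        by_cases hj : j = 0
        · subst hj; simp [hρ0]
        · simp [hj, mul_comm]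
      · simp [hjk]
    simp only [hterm] at hsum
    have h2 := hsum.unique (hasSum_ite_eq k (π * ρ k))
    simp only [mul_assoc]
    rw [intervalIntegral.integral_const_mul, h2]
    exact inv_mul_cancel_left₀ Real.pi_ne_zero _

/-! ### The eigenvalues -/

section eigenvalues

variable {α R : ℝ}

theorem bandSymbol_eq (hα0 : 0 < α) {ξ : ℝ} (hξ : 0 ≤ ξ) : bandSymbol α R ξ
    = lapSymbol (2 + α) 1 * ξ ^ (1 + α) - kernelCos α R 0 - kernelCos α R ξ := by
  rw [bandSymbol, lapSymbol_eq (by linarith) hξ, show 2 + α - 1 = 1 + α by ring]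

theorem bandSymbol_zero_neg (hα0 : 0 < α) (hR : 0 < R) : bandSymbol α R 0 < 0 := by
  rw [bandSymbol_eq hα0 le_rfl, Real.zero_rpow (by linarith)]
  linarith [kernelCos_zero_pos hα0 hR]

theorem bandSymbol_one (hα0 : 0 < α) (hR : 0 < R) :
    bandSymbol α R 1 = lapSymbol (2 + α) 1 - bandCoef α R := by
  rw [bandSymbol, bandCoef_eq hα0 hR]; ring

/-- The fractional part of the symbol grows by more than its value at `1` in each step, while
the smooth part `kernelCos` oscillates by no more than that, being positive. -/
theorem bandSymbol_lt_succ (hα0 : 0 < α) (hα1 : α < 1) (hR : 0 < R)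
    (hm : lapSymbol (2 + α) 1 = bandCoef α R) (k : ℕ) :
    bandSymbol α R k < bandSymbol α R (k + 1 : ℕ) := by
  have hm0 := lapSymbol_one_pos (p := 2 + α) (by linarith) (by linarith)
  rcases Nat.eq_zero_or_pos k with rfl | hk
  · have h1 := bandSymbol_one hα0 hR
    have h0 := bandSymbol_zero_neg hα0 hR
    simp only [Nat.cast_zero, zero_add, Nat.cast_one]
    linarith
  have hk1 : (1 : ℝ) ≤ k := by exact_mod_cast hk
  have hk0 : (0 : ℝ) < k := by linarith
  have hpow : (k : ℝ) ^ (1 + α) + (1 + α) ≤ ((k + 1 : ℕ) : ℝ) ^ (1 + α) := by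
    have hB := one_add_mul_self_le_rpow_one_add (s := (k : ℝ)⁻¹) (p := 1 + α)
      (by linarith [inv_pos.2 hk0]) (by linarith)
    have e : ((k + 1 : ℕ) : ℝ) = k * (1 + (k : ℝ)⁻¹) := by
      push_cast; field_simp
    have e2 : (k : ℝ) ^ (1 + α) = k * (k : ℝ) ^ α := by rw [Real.rpow_add hk0, Real.rpow_one]
    have h1 : 1 ≤ (k : ℝ) ^ α := Real.one_le_rpow hk1 hα0.le
    rw [e, Real.mul_rpow hk0.le (by positivity)]
    refine le_trans ?_ (mul_le_mul_of_nonneg_left hB (by positivity))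
    have e3 : (k : ℝ) ^ (1 + α) * (1 + (1 + α) * (k : ℝ)⁻¹)
        = (k : ℝ) ^ (1 + α) + (1 + α) * (k : ℝ) ^ α := by
      rw [e2]; field_simp
    rw [e3]
    nlinarith
  rw [bandSymbol_eq hα0 hk0.le, bandSymbol_eq hα0 (Nat.cast_nonneg _)]
  have h1 := kernelCos_nonneg hα0 hR k
  have h2 := kernelCos_le hα0 hR ((k + 1 : ℕ) : ℝ)
  have h3 := kernelCos_nonneg hα0 hR 1
  rw [bandCoef_eq hα0 hR] at hm
  have h4 := mul_le_mul_of_nonneg_left hpow hm0.le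
  nlinarith

theorem tendsto_bandSymbol_div (hα0 : 0 < α) (hR : 0 < R) :
    Tendsto (fun k : ℕ => bandSymbol α R k / (k : ℝ) ^ (1 + α)) atTop
      (𝓝 (lapSymbol (2 + α) 1)) := by
  have hinf : Tendsto (fun k : ℕ => (k : ℝ) ^ (1 + α)) atTop atTop :=
    (tendsto_rpow_atTop (by linarith)).comp tendsto_natCast_atTop_atTop
  have h0 : Tendsto (fun k : ℕ => (kernelCos α R 0 + kernelCos α R k) / (k : ℝ) ^ (1 + α)) atTop
      (𝓝 0) := by
    refine squeeze_zero (fun k => ?_) (fun k => ?_)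
      (hinf.const_div_atTop (2 * kernelCos α R 0))
    · have h1 := kernelCos_nonneg hα0 hR k
      have h2 := kernelCos_zero_pos hα0 hR
      positivity
    · refine div_le_div_of_nonneg_right ?_ (by positivity)
      linarith [kernelCos_le hα0 hR (k : ℝ)]
  have h1 := (tendsto_const_nhds (x := lapSymbol (2 + α) 1)).sub h0
  rw [sub_zero] at h1
  refine h1.congr' ?_
  filter_upwards [eventually_gt_atTop 0] with k hk
  have hk0 : (0 : ℝ) < k := by exact_mod_cast hk
  rw [bandSymbol_eq hα0 hk0.le]
  have : (k : ℝ) ^ (1 + α) ≠ 0 := (Real.rpow_pos_of_pos hk0 _).ne'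
  field_simp
  ring

theorem summable_inv_bandSymbol (hα0 : 0 < α) (hα1 : α < 1) (hR : 0 < R) :
    Summable fun k : ℕ => |(bandSymbol α R k)⁻¹| := by
  have hm0 := lapSymbol_one_pos (p := 2 + α) (by linarith) (by linarith)
  set m := lapSymbol (2 + α) 1
  have hs : Summable fun k : ℕ => 2 / m * ((k : ℝ) ^ (1 + α))⁻¹ :=
    (Real.summable_nat_rpow_inv.2 (by linarith)).mul_left _
  refine Summable.of_norm_bounded_eventually_nat hs ?_
  have h1 := (tendsto_bandSymbol_div hα0 hR).eventually (lt_mem_nhds (half_lt_self hm0))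
  filter_upwards [h1, eventually_gt_atTop 0] with k hk hk0
  have hk0' : (0 : ℝ) < (k : ℝ) ^ (1 + α) := Real.rpow_pos_of_pos (by exact_mod_cast hk0) _
  rw [lt_div_iff₀ hk0'] at hk
  have hpos : 0 < m / 2 * (k : ℝ) ^ (1 + α) := by positivity
  rw [Real.norm_eq_abs, abs_abs, abs_of_pos (inv_pos.2 (hpos.trans hk))]
  refine (inv_anti₀ hpos hk.le).trans_eq ?_
  field_simp

end eigenvalues

/-! ### The parametrix -/

/-- The linearized operator is inverted off its kernel by a bounded operator. With `m_k` the symbol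
of the principal part and `λ_k` the eigenvalue, `1 / λ_k = (1 / m_k) (1 - ρ_k)` where
`ρ_k = 1 - m_k / λ_k` is `O(1 / λ_k)` and thus summable; taking `ρ_1 = 1` removes the kernel. -/
theorem exists_parametrix {α β R : ℝ} (hα0 : 0 < α) (hαβ : α < β) (hβ1 : β < 1) (hR : 0 < R)
    (hne : ∀ k : ℕ, k ≠ 1 → bandSymbol α R k ≠ 0) :
    ∃ Q : C0Space (β - α) →L[ℝ] C1Space β, ∀ f,
      trigCoef 0 1 (Q f) = 0 ∧
      ∀ k : ℕ, k ≠ 1 → bandSymbol α R k * trigCoef 0 k (Q f) = coefCLM (β - α) k f := by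
  have hr : 0 < β - α := sub_pos.2 hαβ
  have hX : β ∈ Set.Icc (0 : ℝ) 1 := ⟨by linarith, hβ1.le⟩
  have hm := lapSymbol_one_pos (p := 2 + α) (by linarith) (by linarith)
  have hm' := lapSymbol_one_pos (p := 2 - α) (by linarith) (by linarith)
  set m := lapSymbol (2 + α) 1
  set m' := lapSymbol (2 - α) 1
  set ρ : ℕ → ℝ := fun k => if k = 0 then 0 else if k = 1 then 1 else
    1 - m * (k : ℝ) ^ (1 + α) / bandSymbol α R k with hρ
  have hρs : Summable fun k => |ρ k| := by
    refine Summable.of_norm_bounded_eventually_nat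
      ((summable_inv_bandSymbol hα0 (by linarith) hR).mul_left (2 * kernelCos α R 0)) ?_
    filter_upwards [eventually_gt_atTop 1] with k hk
    have hk0 : k ≠ 0 := by omega
    have hk1 : k ≠ 1 := by omega
    have e : ρ k = -(kernelCos α R 0 + kernelCos α R k) * (bandSymbol α R k)⁻¹ := by
      simp only [hρ, if_neg hk0, if_neg hk1]
      rw [← div_eq_mul_inv, eq_div_iff (hne k hk1), sub_mul, one_mul, div_mul_cancel₀ _ (hne k hk1),
        bandSymbol_eq hα0 (Nat.cast_nonneg k)]
      ring
    have h1 := kernelCos_nonneg hα0 hR k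
    have h2 := kernelCos_zero_pos hα0 hR
    rw [Real.norm_eq_abs, abs_abs, e, abs_mul, abs_neg, abs_of_nonneg (by positivity)]
    refine mul_le_mul_of_nonneg_right ?_ (abs_nonneg _)
    linarith [kernelCos_le hα0 hR (k : ℝ)]
  obtain ⟨K, hK, hKe, hKc⟩ := exists_kernel_of_summable hρs (by simp [hρ])
  set N := convCLM hr hK hKe
  set ι : C1Space β →L[ℝ] C0Space (β - α) := inclCLM hr (by linarith)
  -- `Q₀` inverts up to a constant; the sign is that of the two primitives in `invLapCLM`.
  set Q₀ : C0Space (β - α) →L[ℝ] C1Space β := (-(m * m')⁻¹) •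
    (invLapCLM hα0 hαβ hβ1).comp (ContinuousLinearMap.id ℝ _ - N)
  have hcoefN : ∀ f k, coefCLM (β - α) k (N f) = ρ k * coefCLM (β - α) k f := fun f k => by
    rw [← hKc k]
    exact trigCoef_convOp hK hKe f.continuous f.abs_le f.periodic k 0
  have hQ₀c : ∀ f (k : ℕ), k ≠ 0 → m * (k : ℝ) ^ (1 + α) * trigCoef 0 k (Q₀ f)
      = (1 - ρ k) * coefCLM (β - α) k f := fun f k hk => by
    have hk0 : (0 : ℝ) < k := by exact_mod_cast Nat.pos_of_ne_zero hk
    have h1 := trigCoef_invLapCLM hα0 hαβ hβ1 (f - N f) hk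
    rw [map_sub (coefCLM (β - α) k), hcoefN, lapSymbol_eq (by linarith) hk0.le] at h1
    have h2 : trigCoef 0 k (Q₀ f)
        = -(m * m')⁻¹ * trigCoef 0 k (invLapCLM hα0 hαβ hβ1 (f - N f)) :=
      trigCoef_smul _ _ 0 k
    have h3 : (k : ℝ) ^ 2 = (k : ℝ) ^ (1 + α) * (k : ℝ) ^ (2 - α - 1) := by
      rw [← Real.rpow_add hk0, ← Real.rpow_natCast]; congr 1; push_cast; ring
    have h4 : (k : ℝ) ^ (2 - α - 1) ≠ 0 := (Real.rpow_pos_of_pos hk0 _).ne'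
    rw [h3] at h1
    rw [h2]
    set t := trigCoef 0 k (invLapCLM hα0 hαβ hβ1 (f - N f))
    have h5 : (k : ℝ) ^ (1 + α) * t
        = -(m' * (coefCLM (β - α) k f - ρ k * coefCLM (β - α) k f)) := by
      refine mul_left_cancel₀ h4 ?_
      linear_combination h1
    have h6 : m * (k : ℝ) ^ (1 + α) * (-(m * m')⁻¹ * t) = -m'⁻¹ * ((k : ℝ) ^ (1 + α) * t) := by
      field_simp
    rw [h6, h5]
    field_simp
  -- The constant mode is corrected by an operator of rank one.
  refine ⟨Q₀ + ((2 * π)⁻¹ • ((bandSymbol α R 0)⁻¹ • coefCLM (β - α) 0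
    - ((coefCLM (β - α) 0).comp ι).comp Q₀)).smulRight (cosC1 hX 0), fun f => ?_⟩
  have hQ : ∀ k : ℕ, trigCoef 0 k ((Q₀ + ((2 * π)⁻¹ • ((bandSymbol α R 0)⁻¹ • coefCLM (β - α) 0
      - ((coefCLM (β - α) 0).comp ι).comp Q₀)).smulRight (cosC1 hX 0)) f)
      = trigCoef 0 k (Q₀ f) + (2 * π)⁻¹ * ((bandSymbol α R 0)⁻¹ * coefCLM (β - α) 0 f
        - trigCoef 0 0 (Q₀ f)) * if 0 = k then (if k = 0 then 2 * π else π) else 0 := fun k => by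
    rw [← trigCoef_cos 0 k, ← trigCoef_smul,
      ← trigCoef_add (Q₀ f).continuous (by fun_prop)]
    rfl
  refine ⟨?_, fun k hk => ?_⟩
  · have h1 := hQ₀c f 1 one_ne_zero
    rw [hQ]
    simp only [hρ, Nat.cast_one, Real.one_rpow, mul_one, one_ne_zero, if_false, if_true, sub_self,
      zero_mul] at h1
    rw [(mul_eq_zero.1 h1).resolve_left hm.ne']
    simp
  · rw [hQ]
    by_cases hk0 : k = 0
    · subst hk0
      have h1 := hne 0 hk
      rw [Nat.cast_zero] at h1 ⊢
      have := Real.pi_pos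
      simp only [if_true]
      field_simp
      ring
    · rw [if_neg (Ne.symm hk0), mul_zero, add_zero]
      have hk0' : (0 : ℝ) < k := by exact_mod_cast Nat.pos_of_ne_zero hk0
      have h1 := hQ₀c f k hk0
      simp only [hρ, if_neg hk0, if_neg hk] at h1
      rw [sub_sub_cancel, div_mul_eq_mul_div, eq_div_iff (hne k hk)] at h1
      refine mul_left_cancel₀ (mul_pos hm (Real.rpow_pos_of_pos hk0' (1 + α))).ne' ?_
      linear_combination h1

/-! ### The derivatives at the straight band -/

section derivatives

variable {α β R : ℝ}

theorem PhiY_one_eq (hα0 : 0 < α) (hαβ : α < β) (hβ1 : β < 1) (hR : 0 < R) (f : C1Space β) :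
    PhiY α β R 0 1 f = bandOp hα0 hαβ hβ1 hR f := by
  rw [PhiY_eq hα0 hαβ hβ1 hR one_pos]
  exact FunSpace.ext (funext fun s => by rw [bandOp_apply, bandOp_apply, one_mul])

theorem hasDerivAt_PhiY_cos (hα0 : 0 < α) (hαβ : α < β) (hβ1 : β < 1) (hR : 0 < R)
    (hX : β ∈ Set.Icc (0 : ℝ) 1) (hY : β - α ∈ Set.Icc (0 : ℝ) 1) :
    HasDerivAt (fun lam : ℝ => PhiY α β R 0 lam (cosC1 hX 1))
      ((R * ∫ t, (1 + Real.cos t) * kernelDR α R t) • cosC0 hY 1) 1 := by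
  have h1 : HasDerivAt (fun lam : ℝ => bandCoef α (lam * R))
      ((-∫ t, (1 + Real.cos t) * kernelDR α R t) * R) 1 := by
    have h2 : HasDerivAt (fun lam : ℝ => lam * R) R 1 := by
      simpa using (hasDerivAt_id (1 : ℝ)).mul_const R
    have h3 := hasDerivAt_bandCoef hα0 hR
    rw [← one_mul R] at h3
    have := HasDerivAt.comp (1 : ℝ) h3 h2
    rwa [one_mul] at this
  have h4 := (h1.const_sub (lapSymbol (2 + α) 1)).smul_const (cosC0 hY 1)
  rw [neg_mul, neg_neg, mul_comm] at h4
  refine h4.congr_of_eventuallyEq ?_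
  filter_upwards [lt_mem_nhds (zero_lt_one (α := ℝ))] with lam hlam
  rw [PhiY_eq hα0 hαβ hβ1 hR hlam, bandOp_cos, ← bandSymbol_one hα0 (mul_pos hlam hR), Nat.cast_one]

/-- The dependence of `Φ(0, λ, φ)` on `λ` and on `φ` decouples to first order at `(1, cos)`: the
mixed term is `(B_λ - B_1) v` with `B_λ = Φ(0, λ, ·)` linear and continuous in `λ` for the operator
norm. -/
theorem hasFDerivAt_PhiBar (hα0 : 0 < α) (hαβ : α < β) (hβ1 : β < 1) (hR : 0 < R)
    (hX : β ∈ Set.Icc (0 : ℝ) 1) {e : C0Space (β - α)}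
    (he : HasDerivAt (fun lam : ℝ => PhiY α β R 0 lam (cosC1 hX 1)) e 1) :
    HasFDerivAt (fun p : ℝ × X2 β => PhiBar α R 0 p.1 hX p.2)
      ((ContinuousLinearMap.fst ℝ ℝ (X2 β)).smulRight e
        + ((bandOp hα0 hαβ hβ1 hR).comp (X2 β).subtypeL).comp (ContinuousLinearMap.snd ℝ ℝ (X2 β)))
      (1, 0) := by
  set L : C1Space β →L[ℝ] C0Space (β - α) := bandOp hα0 hαβ hβ1 hR
  set M := (L.comp (X2 β).subtypeL).comp (ContinuousLinearMap.snd ℝ ℝ (X2 β))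
  set Rem : ℝ × X2 β → C0Space (β - α) := fun p => PhiY α β R 0 p.1 (p.2 : C1Space β) - L p.2
    with hRem
  have h1 : HasFDerivAt (fun p : ℝ × X2 β => PhiY α β R 0 p.1 (cosC1 hX 1))
      ((ContinuousLinearMap.fst ℝ ℝ (X2 β)).smulRight e) (1, 0) := by
    have h0 : HasFDerivAt (Prod.fst : ℝ × X2 β → ℝ) (ContinuousLinearMap.fst ℝ ℝ (X2 β)) (1, 0) :=
      hasFDerivAt_fst
    have h := HasFDerivAt.comp (g := fun lam : ℝ => PhiY α β R 0 lam (cosC1 hX 1))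
      ((1, 0) : ℝ × X2 β) (by exact he.hasFDerivAt) h0
    convert! h using 1
  have h3 : HasFDerivAt Rem (0 : ℝ × X2 β →L[ℝ] C0Space (β - α)) (1, 0) := by
    rw [hasFDerivAt_iff_isLittleO]
    have hzero : Rem (1, 0) = 0 := by
      simp only [hRem, PhiY_one_eq hα0 hαβ hβ1 hR, ZeroMemClass.coe_zero, map_zero, sub_zero]
    simp only [hzero, zero_apply, sub_zero]
    set c : ℝ := ‖inclCLM (q := β) (sub_pos.2 hαβ) (by linarith : β - α ≤ 1)‖
    have hg : Tendsto (fun p : ℝ × X2 β => 4 * |kernelCos α (p.1 * R) 0 - kernelCos α R 0| * c)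
        (𝓝 (1, 0)) (𝓝 0) := by
      have hc : ContinuousAt (fun p : ℝ × X2 β => kernelCos α (p.1 * R) 0) (1, 0) := by
        have h4 : ContinuousAt (fun p : ℝ × X2 β => p.1 * R) (1, 0) := by fun_prop
        refine ContinuousAt.comp (g := fun R => kernelCos α R 0) ?_ h4
        simpa using continuousAt_kernelCos_zero hα0 hR
      have h5 : ContinuousAt
          (fun p : ℝ × X2 β => 4 * |kernelCos α (p.1 * R) 0 - kernelCos α R 0| * c) (1, 0) := by
        fun_prop
      simpa [ContinuousAt] using h5
    have hpos : ∀ᶠ p : ℝ × X2 β in 𝓝 (1, 0), 0 < p.1 :=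
      (continuous_fst.tendsto _).eventually (lt_mem_nhds (zero_lt_one (α := ℝ)))
    refine Asymptotics.isLittleO_iff.2 fun δ hδ => ?_
    filter_upwards [hpos, hg.eventually (gt_mem_nhds hδ)] with p hp hpδ
    have e1 : Rem p = (bandOp hα0 hαβ hβ1 (mul_pos hp hR) - L) (p.2 : C1Space β) := by
      simp only [hRem, PhiY_eq hα0 hαβ hβ1 hR hp, sub_apply]
    have hn : ‖(p.2 : C1Space β)‖ ≤ ‖p - (1, 0)‖ := by
      have : (p - (1, 0)).2 = p.2 := by simp
      calc ‖(p.2 : C1Space β)‖ = ‖(p - (1, 0)).2‖ := by rw [this]; rfl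
        _ ≤ _ := norm_snd_le _
    rw [e1]
    refine (ContinuousLinearMap.le_opNorm _ _).trans ?_
    refine mul_le_mul ?_ hn (norm_nonneg _) hδ.le
    exact (norm_bandOp_sub_le hα0 hαβ hβ1 hR (mul_pos hp hR)).trans hpδ.le
  have h4 := (h1.add M.hasFDerivAt).add h3
  rw [add_zero] at h4
  refine h4.congr_of_eventuallyEq ?_
  have hpos : ∀ᶠ p : ℝ × X2 β in 𝓝 (1, 0), 0 < p.1 :=
    (continuous_fst.tendsto _).eventually (lt_mem_nhds (zero_lt_one (α := ℝ)))
  filter_upwards [hpos] with p hp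
  have e1 : M p = L p.2 := rfl
  simp only [PhiBar, hRem, Pi.add_apply, e1]
  rw [PhiY_eq hα0 hαβ hβ1 hR hp, PhiY_eq hα0 hαβ hβ1 hR hp, PhiY_eq hα0 hαβ hβ1 hR hp, map_add]
  abel

/-- When the eigenvalue at `cos` vanishes and no other does, `cos` spans both the kernel and a
complement of the range of `bandOp`, so `(m, w) ↦ m γ cos + bandOp w` is an isomorphism on
`ℝ × X₂`. -/
theorem exists_equiv (hα0 : 0 < α) (hαβ : α < β) (hβ1 : β < 1) (hR : 0 < R)
    (hY : β - α ∈ Set.Icc (0 : ℝ) 1) {γ : ℝ} (hγ : γ ≠ 0) (h1 : bandSymbol α R 1 = 0)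
    (hne : ∀ k : ℕ, k ≠ 1 → bandSymbol α R k ≠ 0) :
    ∃ T : (ℝ × X2 β) ≃L[ℝ] C0Space (β - α), (T : (ℝ × X2 β) →L[ℝ] C0Space (β - α))
      = (ContinuousLinearMap.fst ℝ ℝ (X2 β)).smulRight (γ • cosC0 hY 1)
        + ((bandOp hα0 hαβ hβ1 hR).comp (X2 β).subtypeL).comp
          (ContinuousLinearMap.snd ℝ ℝ (X2 β)) := by
  obtain ⟨Q, hQ⟩ := exists_parametrix hα0 hαβ hβ1 hR hne
  set A := (ContinuousLinearMap.fst ℝ ℝ (X2 β)).smulRight (γ • cosC0 hY 1)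
        + ((bandOp hα0 hαβ hβ1 hR).comp (X2 β).subtypeL).comp
          (ContinuousLinearMap.snd ℝ ℝ (X2 β))
  have hA : ∀ (p : ℝ × X2 β) (k : ℕ), coefCLM (β - α) k (A p)
      = p.1 * (γ * if 1 = k then π else 0) + bandSymbol α R k * trigCoef 0 k (p.2 : C1Space β) := by
    intro p k
    have e : A p = p.1 • γ • cosC0 hY 1 + bandOp hα0 hαβ hβ1 hR p.2 := rfl
    rw [e, map_add, map_smul, map_smul, coefCLM_cosC0, coefCLM_bandOp, smul_eq_mul, smul_eq_mul]
    by_cases hk : 1 = k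
    · subst hk; simp
    · simp [hk]
  set B : C0Space (β - α) →L[ℝ] ℝ × X2 β := ((π * γ)⁻¹ • coefCLM (β - α) 1).prod
    (Q.codRestrict (X2 β) fun f => (mem_X2_iff _).2 (hQ f).1)
  have hB1 : ∀ f, (B f).1 = (π * γ)⁻¹ * coefCLM (β - α) 1 f := fun f => rfl
  have hB2 : ∀ f, ((B f).2 : C1Space β) = Q f := fun f => rfl
  have hπγ : π * γ ≠ 0 := mul_ne_zero Real.pi_ne_zero hγ
  refine ⟨ContinuousLinearEquiv.equivOfInverse A B (fun p => ?_) (fun f => ?_), rfl⟩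
  · have hw := (mem_X2_iff _).1 p.2.2
    refine Prod.ext ?_ (Subtype.ext ?_)
    · rw [hB1, hA, Nat.cast_one, h1, zero_mul, add_zero, if_pos rfl]
      field_simp
    · rw [hB2]
      have hr : 0 < β - α := sub_pos.2 hαβ
      have hext : inclCLM hr hY.2 (Q (A p)) = inclCLM hr hY.2 (p.2 : C1Space β) := by
        refine C0Space.ext_coef fun k => ?_
        change trigCoef 0 k (Q (A p)) = trigCoef 0 k (p.2 : C1Space β)
        by_cases hk : k = 1
        · subst hk; rw [hw, (hQ _).1]
        · have h2 := (hQ (A p)).2 k hk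
          rw [hA, if_neg (Ne.symm hk), mul_zero, mul_zero, zero_add] at h2
          exact mul_left_cancel₀ (hne k hk) h2
      exact FunSpace.ext (congrArg (FunSpace.val (S := c0Submodule (β - α))) hext)
  · refine C0Space.ext_coef fun k => ?_
    rw [hA, hB1, hB2]
    by_cases hk : k = 1
    · subst hk
      rw [Nat.cast_one, h1, zero_mul, add_zero, if_pos rfl]
      field_simp
    · rw [if_neg (Ne.symm hk), mul_zero, mul_zero, zero_add, (hQ f).2 k hk]

end derivatives

/-- The kernel `P_R` in terms of the profile `F`. -/
theorem kernelP_eq_deriv_F {α R : ℝ} {t : ℝ} (ht : t ≠ 0) :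
    kernelP α R t = 1 / |t| ^ (2 + α) * deriv (F α) (2 * R / |t|) := by
  have ht' : 0 < |t| := abs_pos.2 ht
  have hc : Continuous fun τ : ℝ => (1 + τ ^ 2) ^ (-(2 + α) / 2) :=
    Continuous.rpow_const (by fun_prop) fun τ => Or.inl (by positivity)
  have hd : deriv (F α) (2 * R / |t|) = (1 + (2 * R / |t|) ^ 2) ^ (-(2 + α) / 2) :=
    (hasDerivAt_primitive hc _).deriv
  have e : (2 * R) ^ 2 + |t| ^ 2 = |t| ^ 2 * (1 + (2 * R / |t|) ^ 2) := by
    field_simp; ring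
  have e2 : (|t| ^ 2) ^ (-(2 + α) / 2) = 1 / |t| ^ (2 + α) := by
    rw [← Real.rpow_natCast, ← Real.rpow_mul ht'.le, one_div, ← Real.rpow_neg ht'.le]
    congr 1; push_cast; ring
  rw [hd, kernelP, e, Real.mul_rpow (by positivity) (by positivity), e2]

end

end NMCBand

open NMCBand Filter in
theorem proposition5p1 (α : ℝ) (hα0 : 0 < α) (hα1 : α < 1) :
    -- `Φ(0, λ, ·)` is well defined from `X` to `Y`
    (∀ R : ℝ, 0 < R → ∀ β : ℝ, α < β → β < min 1 (2 * α + 1 / 2) →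
      ∀ lam : ℝ, 0 < lam → ∀ φ : NMCBand.C1Space β,
        NMCBand.PhiConverges α R 0 lam φ ∧
        NMCBand.Phi α R 0 lam φ ∈ NMCBand.c0Submodule (β - α)) ∧
    -- existence and uniqueness of `R`
    (∃! R : ℝ, 0 < R ∧ ∀ s : ℝ, NMCBand.Phi α R 0 1 Real.cos s = 0) ∧
    ∀ R : ℝ, 0 < R → (∀ s : ℝ, NMCBand.Phi α R 0 1 Real.cos s = 0) →
      -- the two expressions of the kernel
      (∀ t : ℝ, t ≠ 0 →
        NMCBand.kernelP α R t = 1 / |t| ^ (2 + α) * deriv (NMCBand.F α) (2 * R / |t|)) ∧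
      ∃ (γ : ℝ) (ev : ℕ → ℝ) (μ : ℝ), 0 < γ ∧
        ev 0 < 0 ∧ ev 1 = 0 ∧ StrictMono ev ∧
        0 < μ ∧ Filter.Tendsto (fun k : ℕ => ev k / (k : ℝ) ^ (1 + α)) Filter.atTop (nhds μ) ∧
        ∀ (β : ℝ) (_ : α < β) (_ : β < min 1 (2 * α + 1 / 2))
          (hX : β ∈ Set.Icc (0 : ℝ) 1) (hY : β - α ∈ Set.Icc (0 : ℝ) 1),
          -- the derivative in `λ`
          HasDerivAt (fun lam : ℝ => NMCBand.PhiY α β R 0 lam (NMCBand.cosC1 hX 1))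
            (γ • NMCBand.cosC0 hY 1) 1 ∧
          -- the derivative in `φ`
          ∃ L : NMCBand.C1Space β →L[ℝ] NMCBand.C0Space (β - α),
            HasFDerivAt (fun φ : NMCBand.C1Space β => NMCBand.PhiY α β R 0 1 φ) L
              (NMCBand.cosC1 hX 1) ∧
            (∀ ψ : NMCBand.C1Space β, NMCBand.LinOpConverges α R ψ ∧
              ∀ s : ℝ, L ψ s = NMCBand.linOp α R ψ s) ∧
            (∀ k : ℕ, L (NMCBand.cosC1 hX k) = ev k • NMCBand.cosC0 hY k) ∧
            -- the derivative of `Φ̄` in `(λ, v)`, a linear isomorphism and homeomorphism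
            ∃ T : (ℝ × NMCBand.X2 β) ≃L[ℝ] NMCBand.C0Space (β - α),
              HasFDerivAt (fun p : ℝ × NMCBand.X2 β => NMCBand.PhiBar α R 0 p.1 hX p.2)
                (T : (ℝ × NMCBand.X2 β) →L[ℝ] NMCBand.C0Space (β - α)) (1, 0) ∧
              ∀ (m : ℝ) (w : NMCBand.X2 β),
                T (m, w) = m • γ • NMCBand.cosC0 hY 1 + L (w : NMCBand.C1Space β) := by
  have hm : 0 < lapSymbol (2 + α) 1 := lapSymbol_one_pos (by linarith) (by linarith)
  have hiff : ∀ R : ℝ, 0 < R → ((∀ s : ℝ, NMCBand.Phi α R 0 1 Real.cos s = 0) ↔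
      bandCoef α R = lapSymbol (2 + α) 1) := fun R hR => by
    constructor
    · intro h
      have h0 := h 0
      rw [Phi_cos hα0 hα1 hR, Real.cos_zero, mul_one] at h0
      linarith
    · intro h s
      rw [Phi_cos hα0 hα1 hR, h, sub_self, zero_mul]
  refine ⟨fun R hR β hαβ hβ lam hlam φ => ?_, ?_, fun R hR hRcos => ?_⟩
  · have hβ1 : β < 1 := hβ.trans_le (min_le_left _ _)
    refine ⟨φ.PhiConverges hα0 hαβ hβ1 hR hlam, ?_⟩
    rw [φ.Phi_eq hα0 hαβ hβ1 hR hlam]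
    exact (bandOp hα0 hαβ hβ1 (mul_pos hlam hR) φ).mem
  · obtain ⟨R, ⟨hR, hRm⟩, huniq⟩ := existsUnique_bandCoef_eq hα0 hm
    exact ⟨R, ⟨hR, (hiff R hR).2 hRm⟩, fun R' hR' => huniq R' ⟨hR'.1, (hiff R' hR'.1).1 hR'.2⟩⟩
  have hRm := (hiff R hR).1 hRcos
  have hmono : StrictMono fun k : ℕ => bandSymbol α R k :=
    strictMono_nat_of_lt_succ (bandSymbol_lt_succ hα0 hα1 hR hRm.symm)
  have hev1 : bandSymbol α R 1 = 0 := by rw [bandSymbol_one hα0 hR, hRm, sub_self]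
  have hne : ∀ k : ℕ, k ≠ 1 → bandSymbol α R k ≠ 0 := fun k hk h =>
    hk (hmono.injective (h.trans (by rw [Nat.cast_one, hev1])))
  have hγ : 0 < R * ∫ t, (1 + Real.cos t) * kernelDR α R t :=
    mul_pos hR (bandCoef_deriv_pos hα0 hR)
  refine ⟨fun t ht => kernelP_eq_deriv_F ht, _, fun k => bandSymbol α R k, lapSymbol (2 + α) 1, hγ,
    ?_, ?_, hmono, hm, tendsto_bandSymbol_div hα0 hR, fun β hαβ hβ hX hY => ?_⟩
  · simpa using bandSymbol_zero_neg hα0 hR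
  · simpa using hev1
  have hβ1 : β < 1 := hβ.trans_le (min_le_left _ _)
  have hlam := hasDerivAt_PhiY_cos hα0 hαβ hβ1 hR hX hY
  obtain ⟨T, hT⟩ := exists_equiv hα0 hαβ hβ1 hR hY hγ.ne' hev1 hne
  refine ⟨hlam, bandOp hα0 hαβ hβ1 hR, ?_, fun ψ => linOp_eq hα0 hαβ hβ1 hR ψ,
    bandOp_cos hα0 hαβ hβ1 hR hX hY, T, ?_, fun m w => ?_⟩
  · exact (bandOp hα0 hαβ hβ1 hR).hasFDerivAt.congr_of_eventuallyEq
      (Eventually.of_forall (PhiY_one_eq hα0 hαβ hβ1 hR))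
  · rw [hT]
    exact hasFDerivAt_PhiBar hα0 hαβ hβ1 hR hX hlam
  · exact congrArg (fun A : (ℝ × X2 β) →L[ℝ] C0Space (β - α) => A (m, w)) hT
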